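/- Let $n\ge 2$. For real $u=\mathrm{diag}(u_1,\dots,u_n)$ with $u_1<\cdots<u_n$ and Hermitian $A\in\mathrm{Herm}(n)$ with diagonal entries $t_i=A_{ii}$, let $\Gamma(u,A)$ be the spectral curve $$\Gamma(u,A)=\Big\{(z,\mu)\in\mathbb C^*\times\mathbb C:\ \det\Big(\mathrm i\big(u+\tfrac{A}{2\pi z}\big)-\mu I_n\Big)=0\Big\},\qquad z_{ij}=-\frac{t_i-t_j}{2\pi(u_i-u_j)} .$$ For $t>0$, write $u\to u_{\rm cat}(t)$ (a point of the caterpillar line) if $u_2-u_1\to t$ and $\frac{u_{j+1}-u_j}{u_j-u_{j-1}}\to+\infty$ for $j=2,\dots,n-1$. There is an open subset $W$ of $\{u: u_1<\cdots<u_n\}\times\mathrm{Herm}(n)$ ("$u$ is sufficiently close to the caterpillar line and $A$ is sufficiently close to diagonal") with the following properties. Its closure contains all $(u_{\rm cat}(t),D)$ with $t>0$ and $D$ a real diagonal matrix. Moreover, for every $t>0$, every real diagonal $D$ with increasing diagonal entries, and all $u$ sufficiently close to $u_{\rm cat}(t)$, one has, for every $H\in\mathrm{Herm}(n)$ whose off-diagonal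 entries are all nonzero, $(u,D+sH)\in W$ for all sufficiently small $s>0$. For every $(u,A)\in W$ such that all off-diagonal entries of $A$ are nonzero and $t_1<\cdots<t_n$: 1. There are nondegenerate vertical segments $B_{ij}=B_{ji}=[z_{ij}^+,z_{ij}^-]\subset\mathbb C$ ($i\ne j$) such that the points $z_{ij}$ ($i<j$) are pairwise distinct and the ordering of the $\operatorname{Re} z_{ij}^{\pm}$ is the same as the ordering of the $z_{ij}$; and there are functions $\mu_1,\dots,\mu_n$ with $\lim_{z\to\infty}\mu_i(z)=\mathrm i u_i$, with $\mu_i$ analytic on $\mathbb C\setminus(\{0\}\cup\bigcup_{j\ne i}B_{ij})$, such that outside $0$ and all the segments (in particular for large $|z|$) the eigenvalues of $\mathrm i(u+\frac{A}{2\pi z})$, with multiplicity, are $\mu_1(z),\dots,\mu_n(z)$. 2. Continuation across $B_{ij}$ exchanges $\mu_i$ with $\mu_j$, while all other $\mu_k$ extend holomorphically across $B_{ij}$. 3. The endpoints $z_{ij}^\pm$ are $n(n-1)$ distinct points, and each of them is a simple branch point: over it there is exactly one ramification point of the projection $\Gamma(u,A)\to\mathbb C^*$, $(z,\mu)\mapsto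 z$, the curve is smooth there, and the ramification index is $2$. 4. $\Gamma(u,A)$ is smooth. 5. Each $\mu_i$ satisfies $\mu_i(\overline z)=-\overline{\mu_i(z)}$ for all $z$ in its domain $\mathbb C\setminus(\{0\}\cup\bigcup_{j\ne i}B_{ij})$. -/

import Mathlib

open Filter Topology Complex

noncomputable section

/-- `Herm(n)`: the real vector space of Hermitian `n × n` matrices, with its usual topology. -/
abbrev HermMat (n : ℕ) := selfAdjoint (Matrix (Fin n) (Fin n) ℂ)

/-- The diagonal Hermitian matrix with real diagonal entries `d`. -/
def diagHerm {n : ℕ} (d : Fin n → ℝ) : HermMat n :=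
  ⟨Matrix.diagonal (fun i => (d i : ℂ)), by
    rw [selfAdjoint.mem_iff, Matrix.star_eq_conjTranspose, Matrix.diagonal_conjTranspose]
    congr 1
    funext i
    exact Complex.conj_ofReal _⟩

/-- The diagonal entries `t_i = A_{ii}` (real, since `A` is Hermitian). -/
def diagEntry {n : ℕ} (A : HermMat n) (i : Fin n) : ℝ := (A.1 i i).re

/-- The trace on the chamber `u_1 < ⋯ < u_n` of the filter of neighbourhoods of the point
`u_cat(t)` of the caterpillar line in the De Concini–Procesi space: `u_2 - u_1 → t` and
`(u_{j+1} - u_j) / (u_j - u_{j-1}) → +∞` for `1 < j < n`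
(in the code indices start at `0`). -/
def nhdsCat {n : ℕ} (hn : 2 ≤ n) (t : ℝ) : Filter (Fin n → ℝ) :=
  comap (fun u => u ⟨1, by omega⟩ - u ⟨0, by omega⟩) (𝓝 t)
  ⊓ (⨅ (j : ℕ) (hj : j + 2 < n),
      comap (fun u : Fin n → ℝ => (u ⟨j + 2, hj⟩ - u ⟨j + 1, by omega⟩) /
        (u ⟨j + 1, by omega⟩ - u ⟨j, by omega⟩)) atTop)
  ⊓ 𝓟 {u | StrictMono u}

/-- The operator `i (u + A / (2 π z))`. -/
def specMat {n : ℕ} (u : Fin n → ℝ) (A : HermMat n) (z : ℂ) : Matrix (Fin n) (Fin n) ℂ :=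
  I • (Matrix.diagonal (fun i => (u i : ℂ)) + (1 / (2 * (Real.pi : ℂ) * z)) • A.1)

/-- The function `det (i u - A / (2 π i z) - μ)` of `(z, μ)`. -/
def specFun {n : ℕ} (u : Fin n → ℝ) (A : HermMat n) (z μ : ℂ) : ℂ :=
  (specMat u A z - μ • (1 : Matrix (Fin n) (Fin n) ℂ)).det

/-- The spectral curve `Γ(u, A)`, in the coordinates `(z, μ)`, `z ≠ 0`. -/
def spectralCurve {n : ℕ} (u : Fin n → ℝ) (A : HermMat n) : Set (ℂ × ℂ) :=
  {p | p.1 ≠ 0 ∧ specFun u A p.1 p.2 = 0}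

/-- Smoothness of the spectral curve at one of its points `p` (Jacobian criterion). -/
def SpectralSmoothAt {n : ℕ} (u : Fin n → ℝ) (A : HermMat n) (p : ℂ × ℂ) : Prop :=
  deriv (fun z => specFun u A z p.2) p.1 ≠ 0 ∨ deriv (fun μ => specFun u A p.1 μ) p.2 ≠ 0

/-- `z = b` is a simple branch point: over `b` there is exactly one ramification point
`(b, m)` of the projection of `Γ(u, A)` to the `z`-line, the curve is smooth there, and the
ramification index (at a smooth point, the multiplicity of `m` in the fibre over `b`) is `2`. -/
def IsSimpleBranchPoint {n : ℕ} (u : Fin n → ℝ) (A : HermMat n) (b : ℂ) : Prop :=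
  ∃ m : ℂ, (b, m) ∈ spectralCurve u A ∧ SpectralSmoothAt u A (b, m) ∧
    (specMat u A b).charpoly.rootMultiplicity m = 2 ∧
    ∀ m' : ℂ, m' ≠ m → (specMat u A b).charpoly.rootMultiplicity m' ≤ 1

/-- The point `z_{ij} = -(t_i - t_j) / (2 π (u_i - u_j))`. -/
def crossing {n : ℕ} (u : Fin n → ℝ) (A : HermMat n) (i j : Fin n) : ℝ :=
  -(diagEntry A i - diagEntry A j) / (2 * Real.pi * (u i - u j))

/-- The domain of the `i`-th sheet: the plane without `0` and without the segments
`B_{ij} = [zp i j, zm i j]`, `j ≠ i`. -/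
def sheetDomain {n : ℕ} (zp zm : Fin n → Fin n → ℂ) (i : Fin n) : Set ℂ :=
  {z | z ≠ 0 ∧ ∀ j, j ≠ i → z ∉ segment ℝ (zp i j) (zm i j)}

/-- Across the interior of the vertical segment `[b, c]`, the functions `f` and `g`, analytic on
both sides, are continued analytically into each other. -/
def ExchangedAcross (f g : ℂ → ℂ) (b c : ℂ) : Prop :=
  ∀ p ∈ openSegment ℝ b c, ∃ F G : ℂ → ℂ, AnalyticAt ℂ F p ∧ AnalyticAt ℂ G p ∧
    ∀ᶠ z in 𝓝 p, (z.re < p.re → F z = f z ∧ G z = g z) ∧ (p.re < z.re → F z = g z ∧ G z = f z)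

end

/-!
# Branch points and sheets of the spectral curve of a nearly diagonal Hermitian matrix

With `B = A / 2π` one has `i (u + A / 2πz) = (i / z) (z u + B)`, so everything is read off from the
eigenvalues of the linear pencil `z u + B`. If `B` is diagonal these are the lines
`u_i z + B_ii`; the `i`-th and the `j`-th line meet over the real point `z_ij` only. The set `W` is
`nearDiagonalSet`: the pencils with well separated crossings `z_ij`, small off-diagonal entries, and
no off-diagonal entry dominated by products of others (`NearDiagonal`).

By Rouché's theorem for the characteristic polynomial (`card_roots_pencil`), wherever the `i`-th line
stays away from the others there is exactly one eigenvalue `isoRoot` close to it, and it is analytic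
in `z` (`isoRoot_analyticAt`). Near `z_ij` this still applies to all `k ≠ i, j`; the two remaining
eigenvalues are the roots of a quadratic polynomial with analytic coefficients, whose discriminant
`pairDisc` is close to `(u_i - u_j)² (z - z_ij)²` on a circle around `z_ij`. The maximum principle
gives a zero of the discriminant inside (`NearDiagonal.exists_pairDisc_eq_zero`). A zero on the real
axis would be a double eigenvalue of a Hermitian matrix, with an eigenvector vanishing at `i`; its
`i`-th row then bounds `B_ij` by products of other entries, which is excluded
(`NearDiagonal.pairDisc_ofReal_ne_zero`). As the discriminant is real on the real axis, its zeros
come in a pair `c ± ih`, and the maximum principle for the quotient shows that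
`pairDisc = ((z - c)² + h²) g` with `g` close to the constant `(u_i - u_j)²`
(`NearDiagonal.exists_isCut`). Hence the two zeros are simple, there are no others, and the square
root of the discriminant is an explicit function cut along the vertical segment `[c + ih, c - ih]`
which changes its sign across it (`cutSqrt`, `pairRoot`). Gluing these local sheets to the isolated
eigenvalues gives the global sheets (`sheet`).

A perturbation `D + sK` of a diagonal matrix with distinct crossings is nearly diagonal for small
`s > 0`, because its off-diagonal entries are of order `s` and the competing products of order `s²`
(`eventually_mem_nearDiagonalSet`). Close to the caterpillar line the gaps of `u` grow fast, which
makes the crossings distinct (`eventually_crossing_ne`).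
-/

/-! ### Counting zeros of polynomials -/

open scoped Classical in
theorem circleIntegral_sum_inv_sub (c : ℂ) (R : ℝ) (hR : 0 < R) (s : Multiset ℂ)
    (hs : ∀ a ∈ s, a ∉ Metric.sphere c R) :
    CircleIntegrable (fun z => (s.map fun a => 1 / (z - a)).sum) c R ∧
    (∮ z in C(c, R), (s.map fun a => 1 / (z - a)).sum) =
      2 * Real.pi * I * (s.filter (· ∈ Metric.ball c R)).card := by
  induction s using Multiset.induction with
  | empty => simp [circleIntegral]
  | cons a s ih =>
    obtain ⟨ih1, ih2⟩ := ih fun b hb => hs b (Multiset.mem_cons_of_mem hb)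
    have ha : a ∉ Metric.sphere c R := hs a (Multiset.mem_cons_self a s)
    have hne : ∀ z ∈ Metric.sphere c R, z - a ≠ 0 := fun z hz h0 =>
      ha (sub_eq_zero.mp h0 ▸ hz)
    have hint : CircleIntegrable (fun z => 1 / (z - a)) c R :=
      ContinuousOn.circleIntegrable hR.le
        (continuousOn_const.div (by fun_prop) hne)
    simp only [Multiset.map_cons, Multiset.sum_cons]
    refine ⟨hint.add ih1, ?_⟩
    rw [circleIntegral.integral_add hint ih1, ih2]
    by_cases hb : a ∈ Metric.ball c R
    · have := circleIntegral.integral_sub_inv_of_mem_ball hb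
      simp only [one_div, this, Multiset.filter_cons_of_pos s hb, Multiset.card_cons]
      push_cast; ring
    · have hz : ∀ z ∈ Metric.closedBall c R, z - a ≠ 0 := by
        intro z hz h0
        rw [sub_eq_zero.mp h0, ← Metric.ball_union_sphere] at hz
        exact hz.elim hb ha
      have : (∮ z in C(c, R), 1 / (z - a)) = 0 := by
        refine circleIntegral_eq_zero_of_differentiable_on_off_countable hR.le
          Set.countable_empty (continuousOn_const.div (by fun_prop) hz) ?_
        intro z hz'
        exact (differentiableAt_const _).div (by fun_prop)
          (hz z (Metric.ball_subset_closedBall hz'.1))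
      rw [this, Multiset.filter_cons_of_neg s hb, zero_add]

open scoped Classical in
/-- Argument principle for a polynomial on a circle that carries no root. -/
theorem Polynomial.circleIntegral_logDeriv (p : Polynomial ℂ) (c : ℂ) (R : ℝ) (hR : 0 < R)
    (hp : ∀ z ∈ Metric.sphere c R, p.eval z ≠ 0) :
    (∮ z in C(c, R), p.derivative.eval z / p.eval z) =
      2 * Real.pi * I * (p.roots.filter (· ∈ Metric.ball c R)).card := by
  have h := (circleIntegral_sum_inv_sub c R hR p.roots fun a ha hs =>
    hp a hs (Polynomial.isRoot_of_mem_roots ha)).2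
  rw [← h]
  refine circleIntegral.integral_congr hR.le fun z hz => ?_
  exact (IsAlgClosed.splits p).eval_derivative_div_eval_of_ne_zero (hp z hz)

open scoped Classical in
/-- Rouché's theorem for polynomials: the logarithmic derivatives of `p` and `q` differ on the
circle by the derivative of `log (p / q)`. -/
theorem Polynomial.card_roots_ball_eq_of_norm_sub_lt (p q : Polynomial ℂ) (c : ℂ) (R : ℝ)
    (hR : 0 < R)
    (h : ∀ z ∈ Metric.sphere c R, ‖p.eval z - q.eval z‖ < ‖q.eval z‖) :
    (p.roots.filter (· ∈ Metric.ball c R)).card = (q.roots.filter (· ∈ Metric.ball c R)).card := by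
  have hq : ∀ z ∈ Metric.sphere c R, q.eval z ≠ 0 := fun z hz h0 => by
    have := h z hz
    rw [h0, norm_zero] at this
    exact absurd this (not_lt.mpr (norm_nonneg _))
  have hp : ∀ z ∈ Metric.sphere c R, p.eval z ≠ 0 := fun z hz h0 => by
    have := h z hz
    rw [h0, zero_sub, norm_neg] at this
    exact lt_irrefl _ this
  have hslit : ∀ z ∈ Metric.sphere c R, p.eval z / q.eval z ∈ slitPlane := fun z hz => by
    rw [← add_sub_cancel 1 (p.eval z / q.eval z)]
    refine mem_slitPlane_of_norm_lt_one ?_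
    rw [div_sub_one (hq z hz), norm_div, div_lt_one (norm_pos_iff.mpr (hq z hz))]
    exact h z hz
  have key : (∮ z in C(c, R), (p.derivative.eval z / p.eval z - q.derivative.eval z / q.eval z))
      = 0 := by
    refine circleIntegral.integral_eq_zero_of_hasDerivWithinAt
      (f := fun z => Complex.log (p.eval z / q.eval z)) hR.le fun z hz => ?_
    have h1 := (p.hasDerivAt z).div (q.hasDerivAt z) (hq z hz)
    have h2 := (h1.clog (hslit z hz)).hasDerivWithinAt (s := Metric.sphere c R)
    refine h2.congr_deriv ?_
    have := hq z hz
    have := hp z hz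
    change _ / (p.eval z / q.eval z) = _
    field_simp
  have hcp : CircleIntegrable (fun z => p.derivative.eval z / p.eval z) c R :=
    ContinuousOn.circleIntegrable hR.le
      (p.derivative.continuous.continuousOn.div p.continuous.continuousOn hp)
  have hcq : CircleIntegrable (fun z => q.derivative.eval z / q.eval z) c R :=
    ContinuousOn.circleIntegrable hR.le
      (q.derivative.continuous.continuousOn.div q.continuous.continuousOn hq)
  rw [circleIntegral.integral_sub hcp hcq, p.circleIntegral_logDeriv c R hR hp,
    q.circleIntegral_logDeriv c R hR hq, ← mul_sub] at key
  have hpi : (2 * Real.pi * I : ℂ) ≠ 0 := by simp [Real.pi_ne_zero]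
  exact_mod_cast sub_eq_zero.mp ((mul_eq_zero.mp key).resolve_left hpi)

/-! ### Perturbation of the determinant of a diagonal matrix -/

theorem exists_pos_forall_norm_det_diagonal_add_sub_lt (n : ℕ) :
    ∃ η : ℝ, 0 < η ∧ ∀ (d : Fin n → ℂ) (E : Matrix (Fin n) (Fin n) ℂ) (ρ : ℝ), 0 < ρ →
      (∀ i, ρ ≤ ‖d i‖) → (∀ i j, ‖E i j‖ < η * ρ) →
      ‖(Matrix.diagonal d + E).det - ∏ i, d i‖ < ‖∏ i, d i‖ := by
  have hc : Continuous fun E : Fin n → Fin n → ℂ =>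
      ((1 : Matrix (Fin n) (Fin n) ℂ) + Matrix.of E).det :=
    Continuous.matrix_det (continuous_const.add continuous_id)
  obtain ⟨η, hη, H⟩ := Metric.continuousAt_iff.mp (hc.continuousAt (x := 0)) 1 one_pos
  refine ⟨η, hη, fun d E ρ hρ hd hE => ?_⟩
  have hd0 : ∀ i, d i ≠ 0 := fun i => norm_pos_iff.mp (hρ.trans_le (hd i))
  have hfac : Matrix.diagonal d + E =
      Matrix.diagonal d * (1 + Matrix.of fun i j => E i j / d i) := by
    ext i j
    rw [mul_add, mul_one, Matrix.add_apply, Matrix.add_apply, Matrix.diagonal_mul]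
    simp only [Matrix.of_apply]
    rw [mul_div_cancel₀ _ (hd0 i)]
  have hsmall : dist (fun i j => E i j / d i) (0 : Fin n → Fin n → ℂ) < η := by
    rw [dist_zero_right]
    refine (pi_norm_lt_iff hη).mpr fun i => (pi_norm_lt_iff hη).mpr fun j => ?_
    rw [norm_div, div_lt_iff₀ (norm_pos_iff.mpr (hd0 i))]
    exact (hE i j).trans_le (mul_le_mul_of_nonneg_left (hd i) hη.le)
  have h1 := H hsmall
  have h0 : ((1 : Matrix (Fin n) (Fin n) ℂ) + Matrix.of (0 : Fin n → Fin n → ℂ)).det = 1 := by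
    have : Matrix.of (0 : Fin n → Fin n → ℂ) = 0 := rfl
    rw [this, add_zero, Matrix.det_one]
  rw [h0, dist_eq_norm] at h1
  rw [hfac, Matrix.det_mul, Matrix.det_diagonal]
  have hpos : 0 < ‖∏ i, d i‖ := norm_pos_iff.mpr (Finset.prod_ne_zero_iff.mpr fun i _ => hd0 i)
  calc _ = ‖∏ i, d i‖ * ‖(1 + Matrix.of fun i j => E i j / d i).det - 1‖ := by
        rw [← norm_mul, mul_sub, mul_one]
    _ < ‖∏ i, d i‖ * 1 := mul_lt_mul_of_pos_left h1 hpos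
    _ = _ := mul_one _

/-! ### A square root of `(z - c)² + h²` with a vertical cut -/

/-- The square root on the slit plane with positive real part. -/
noncomputable def csqrt (x : ℂ) : ℂ := exp (log x / 2)

theorem csqrt_sq {x : ℂ} (hx : x ≠ 0) : csqrt x ^ 2 = x := by
  rw [csqrt, ← exp_nat_mul]
  simp [mul_div_cancel₀, exp_log hx]

theorem csqrt_ne_zero (x : ℂ) : csqrt x ≠ 0 := exp_ne_zero _

theorem csqrt_re_pos {x : ℂ} (hx : x ∈ slitPlane) : 0 < (csqrt x).re := by
  rw [csqrt, exp_re]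
  have h1 : (log x / 2).im = x.arg / 2 := by
    rw [← log_im]; simp
  have h2 := (mem_slitPlane_iff_arg.mp hx).1
  have h3 := neg_pi_lt_arg x
  have h4 := (arg_le_pi x).lt_of_ne h2
  rw [h1]
  exact mul_pos (Real.exp_pos _) (Real.cos_pos_of_mem_Ioo ⟨by linarith, by linarith⟩)

theorem csqrt_analyticAt {x : ℂ} (hx : x ∈ slitPlane) : AnalyticAt ℂ csqrt x := by
  unfold csqrt
  exact ((analyticAt_clog hx).div_const).cexp

theorem csqrt_conj {x : ℂ} (hx : x ∈ slitPlane) :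
    csqrt ((starRingEnd ℂ) x) = (starRingEnd ℂ) (csqrt x) := by
  rw [csqrt, csqrt, log_conj _ (mem_slitPlane_iff_arg.mp hx).1, ← exp_conj, map_div₀, map_ofNat]

/-- If `w²` is close to `1` and `w` has positive real part then `w` is close to `1`. -/
theorem norm_sub_one_le_of_re_pos {w : ℂ} (hw : 0 ≤ w.re) : ‖w - 1‖ ≤ ‖w ^ 2 - 1‖ := by
  have h1 : (1 : ℝ) ≤ ‖w + 1‖ := by
    refine le_trans ?_ (re_le_norm _)
    simpa using hw
  calc ‖w - 1‖ = ‖w - 1‖ * 1 := (mul_one _).symm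
    _ ≤ ‖w - 1‖ * ‖w + 1‖ := by gcongr
    _ = ‖w ^ 2 - 1‖ := by rw [← norm_mul]; congr 1; ring

/-- The branch of `√((z - c)² + h²)` cut along the vertical segment `[c + ih, c - ih]` and
asymptotic to `z - c` at infinity. -/
noncomputable def cutSqrt (c h : ℝ) (z : ℂ) : ℂ :=
  (z - c) * csqrt (1 + (h : ℂ) ^ 2 / (z - c) ^ 2)

/-- The vertical segment from `c - ih` to `c + ih`. -/
def vSeg (c h : ℝ) : Set ℂ := {z | z.re = c ∧ |z.im| ≤ h}

theorem mem_slitPlane_of_notMem_vSeg {c h : ℝ} (hh : 0 < h) {z : ℂ} (hz : z ∉ vSeg c h) :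
    z - c ≠ 0 ∧ 1 + (h : ℂ) ^ 2 / (z - c) ^ 2 ∈ slitPlane := by
  have hne : z - c ≠ 0 := by
    intro h0
    apply hz
    have : z = c := sub_eq_zero.mp h0
    subst this
    exact ⟨by simp, by simpa using hh.le⟩
  refine ⟨hne, ?_⟩
  by_contra hcon
  rw [mem_slitPlane_iff, not_or, not_not, not_lt] at hcon
  obtain ⟨h1, h2⟩ := hcon
  set q : ℂ := 1 + (h : ℂ) ^ 2 / (z - c) ^ 2 with hq
  -- `q` is a real number `≤ 0`, hence `(z - c)²` is a real number in `[-h², 0)`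
  have hqr : q = (q.re : ℂ) := by
    apply Complex.ext <;> simp [h2]
  have hq1 : q.re - 1 < 0 := by linarith
  have hw : (z - c) ^ 2 = ((h ^ 2 / (q.re - 1) : ℝ) : ℂ) := by
    have e1 : (h : ℂ) ^ 2 / (z - c) ^ 2 = ((q.re - 1 : ℝ) : ℂ) := by
      push_cast; rw [← hqr, hq]; ring
    push_cast at e1 ⊢
    have h3 : ((q.re : ℂ) - 1) ≠ 0 := by
      exact_mod_cast hq1.ne
    rw [eq_div_iff h3, ← e1]
    field_simp
  have hre := congrArg re hw
  have him := congrArg im hw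
  simp only [pow_two, mul_re, mul_im, sub_re, sub_im, ofReal_re, ofReal_im, sub_zero] at hre him
  have hneg : h * h / (q.re - 1) < 0 := div_neg_of_pos_of_neg (by positivity) hq1
  have hb : -(h * h) ≤ h * h / (q.re - 1) := by
    rw [le_div_iff_of_neg hq1]
    nlinarith [mul_pos hh hh]
  have hprod : (z.re - c) * z.im = 0 := by linarith
  rcases mul_eq_zero.mp hprod with h0 | h0
  · apply hz
    refine ⟨by linarith, ?_⟩
    rw [h0] at hre
    exact abs_le_of_sq_le_sq (by nlinarith) hh.le
  · rw [h0] at hre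
    nlinarith [mul_self_nonneg (z.re - c)]

theorem cutSqrt_sq {c h : ℝ} (hh : 0 < h) {z : ℂ} (hz : z ∉ vSeg c h) :
    cutSqrt c h z ^ 2 = (z - c) ^ 2 + (h : ℂ) ^ 2 := by
  obtain ⟨h1, h2⟩ := mem_slitPlane_of_notMem_vSeg hh hz
  rw [cutSqrt, mul_pow, csqrt_sq (slitPlane_ne_zero h2)]
  field_simp

theorem cutSqrt_analyticAt {c h : ℝ} (hh : 0 < h) {z : ℂ} (hz : z ∉ vSeg c h) :
    AnalyticAt ℂ (cutSqrt c h) z := by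
  obtain ⟨h1, h2⟩ := mem_slitPlane_of_notMem_vSeg hh hz
  have h3 : (z - c) ^ 2 ≠ 0 := pow_ne_zero 2 h1
  unfold cutSqrt
  refine AnalyticAt.mul (by fun_prop) (AnalyticAt.fun_comp (csqrt_analyticAt h2) ?_)
  exact analyticAt_const.add (analyticAt_const.div (by fun_prop) h3)

theorem cutSqrt_conj {c h : ℝ} (hh : 0 < h) {z : ℂ} (hz : z ∉ vSeg c h) :
    cutSqrt c h ((starRingEnd ℂ) z) = (starRingEnd ℂ) (cutSqrt c h z) := by
  obtain ⟨h1, h2⟩ := mem_slitPlane_of_notMem_vSeg hh hz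
  rw [cutSqrt, cutSqrt, map_mul, ← csqrt_conj h2]
  simp

theorem sq_add_sq_mem_slitPlane {c h : ℝ} {z : ℂ} (hz : z.re ≠ c ∨ |z.im| < h) :
    (z - c) ^ 2 + (h : ℂ) ^ 2 ∈ slitPlane := by
  rw [mem_slitPlane_iff]
  have hre : ((z - c) ^ 2 + (h : ℂ) ^ 2).re = (z.re - c) ^ 2 - z.im ^ 2 + h ^ 2 := by
    simp [pow_two]
  have him : ((z - c) ^ 2 + (h : ℂ) ^ 2).im = 2 * ((z.re - c) * z.im) := by
    simp [pow_two]; ring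
  rw [hre, him]
  by_cases h0 : z.im = 0
  · left
    rcases hz with hz | hz
    · have : 0 < (z.re - c) ^ 2 := by
        have := sub_ne_zero.mpr hz
        positivity
      rw [h0]; nlinarith [sq_nonneg h]
    · rw [h0] at hz ⊢
      rw [abs_zero] at hz
      nlinarith [sq_nonneg (z.re - c), mul_pos hz hz]
  · by_cases h1 : z.re = c
    · left
      have := hz.resolve_left (not_not.mpr h1)
      have := sq_lt_sq' (by linarith [neg_abs_le z.im, abs_nonneg z.im]) (this)
      rw [sq_abs] at this
      rw [h1]; nlinarith
    · right
      exact mul_ne_zero two_ne_zero (mul_ne_zero (sub_ne_zero.mpr h1) h0)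

/-- The sign of `Re (q · conj w)` is that of `Re w` for the principal root `q` of `w² + h²`. -/
theorem re_mul_conj_sign {q w : ℂ} {h : ℝ} (hq : 0 < q.re) (hsq : q ^ 2 = w ^ 2 + (h : ℂ) ^ 2) :
    (0 < w.re → 0 < (q * (starRingEnd ℂ) w).re) ∧ (w.re < 0 → (q * (starRingEnd ℂ) w).re < 0) := by
  have him := congrArg im hsq
  simp only [pow_two, mul_im, add_im, ofReal_re, ofReal_im] at him
  have e : q.re * q.im = w.re * w.im := by linarith
  have e2 : (q * (starRingEnd ℂ) w).re * q.re = w.re * (q.re ^ 2 + w.im ^ 2) := by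
    simp only [mul_re, conj_re, conj_im]
    linear_combination w.im * e
  have hp : 0 < q.re ^ 2 + w.im ^ 2 := by positivity
  constructor
  · intro hw
    exact pos_of_mul_pos_left (by rw [e2]; exact mul_pos hw hp) hq.le
  · intro hw
    have : (q * (starRingEnd ℂ) w).re * q.re < 0 := by rw [e2]; exact mul_neg_of_neg_of_pos hw hp
    by_contra hcon
    exact absurd this (not_lt.mpr (mul_nonneg (not_lt.mp hcon) hq.le))

theorem re_cutSqrt_mul_conj_pos {c h : ℝ} (hh : 0 < h) {z : ℂ} (hz : z ∉ vSeg c h) :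
    0 < (cutSqrt c h z * (starRingEnd ℂ) (z - c)).re := by
  obtain ⟨h1, h2⟩ := mem_slitPlane_of_notMem_vSeg hh hz
  have : cutSqrt c h z * (starRingEnd ℂ) (z - c) =
      ((normSq (z - c) : ℝ) : ℂ) * csqrt (1 + (h : ℂ) ^ 2 / (z - c) ^ 2) := by
    rw [cutSqrt, ← mul_conj]; ring
  rw [this, re_ofReal_mul]
  exact mul_pos (normSq_pos.mpr h1) (csqrt_re_pos h2)

/-- To the right (left) of the cut, `cutSqrt` is plus (minus) the principal root. -/
theorem cutSqrt_eq {c h : ℝ} (hh : 0 < h) (z : ℂ) :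
    (c < z.re → cutSqrt c h z = csqrt ((z - c) ^ 2 + (h : ℂ) ^ 2)) ∧
    (z.re < c → cutSqrt c h z = -csqrt ((z - c) ^ 2 + (h : ℂ) ^ 2)) := by
  have main : z.re ≠ c → 0 < (cutSqrt c h z * (starRingEnd ℂ) (z - c)).re ∧
      0 < (csqrt ((z - c) ^ 2 + (h : ℂ) ^ 2)).re ∧
      csqrt ((z - c) ^ 2 + (h : ℂ) ^ 2) ^ 2 = (z - c) ^ 2 + (h : ℂ) ^ 2 ∧
      (cutSqrt c h z = csqrt ((z - c) ^ 2 + (h : ℂ) ^ 2) ∨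
        cutSqrt c h z = -csqrt ((z - c) ^ 2 + (h : ℂ) ^ 2)) := by
    intro hz
    have hz' : z ∉ vSeg c h := fun hm => hz hm.1
    have hs := sq_add_sq_mem_slitPlane (h := h) (Or.inl hz)
    have h2 := csqrt_sq (slitPlane_ne_zero hs)
    exact ⟨re_cutSqrt_mul_conj_pos hh hz', csqrt_re_pos hs, h2,
      sq_eq_sq_iff_eq_or_eq_neg.mp ((cutSqrt_sq hh hz').trans h2.symm)⟩
  constructor
  · intro hz
    obtain ⟨a, b, d, e⟩ := main hz.ne'
    refine e.resolve_right fun he => ?_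
    have := (re_mul_conj_sign b d).1 (by simpa using hz)
    rw [he, neg_mul, neg_re] at a
    linarith
  · intro hz
    obtain ⟨a, b, d, e⟩ := main hz.ne
    refine e.resolve_left fun he => ?_
    have := (re_mul_conj_sign b d).2 (by simpa using hz)
    rw [he] at a
    linarith

/-! ### Isolated eigenvalues of a Hermitian pencil -/

/-- A radius of perturbations for which
`exists_pos_forall_norm_det_diagonal_add_sub_lt` holds. -/
noncomputable def detConst (n : ℕ) : ℝ :=
  Classical.choose (exists_pos_forall_norm_det_diagonal_add_sub_lt n)

theorem detConst_pos (n : ℕ) : 0 < detConst n :=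
  (Classical.choose_spec (exists_pos_forall_norm_det_diagonal_add_sub_lt n)).1

theorem norm_det_diagonal_add_sub_lt {n : ℕ} (d : Fin n → ℂ) (E : Matrix (Fin n) (Fin n) ℂ)
    {ρ : ℝ} (hρ : 0 < ρ) (hd : ∀ i, ρ ≤ ‖d i‖) (hE : ∀ i j, ‖E i j‖ < detConst n * ρ) :
    ‖(Matrix.diagonal d + E).det - ∏ i, d i‖ < ‖∏ i, d i‖ :=
  (Classical.choose_spec (exists_pos_forall_norm_det_diagonal_add_sub_lt n)).2 d E ρ hρ hd hE

section Pencil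

variable {n : ℕ} (u : Fin n → ℝ) (B : Matrix (Fin n) (Fin n) ℂ)

/-- The linear pencil `z u + B`. -/
noncomputable def pencil (z : ℂ) : Matrix (Fin n) (Fin n) ℂ :=
  z • Matrix.diagonal (fun i => (u i : ℂ)) + B

/-- The diagonal entries `u_i z + B_ii` of the pencil: the unperturbed eigenvalues. -/
noncomputable def pencilDiag (i : Fin n) (z : ℂ) : ℂ := u i * z + B i i

/-- The `i`-th diagonal entry of the pencil at `z` is at distance more than `2ρ` from the
others. -/
def Isolated (ρ : ℝ) (i : Fin n) (z : ℂ) : Prop :=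
  ∀ j, j ≠ i → 2 * ρ < ‖pencilDiag u B j z - pencilDiag u B i z‖

variable {u B}

theorem pencil_apply (z : ℂ) (i j : Fin n) :
    pencil u B z i j = (if i = j then (u i : ℂ) * z else 0) + B i j := by
  by_cases h : i = j
  · subst h; simp [pencil, mul_comm]
  · simp [pencil, h]

theorem eval_charpoly_pencil (z ν : ℂ) :
    (pencil u B z).charpoly.eval ν =
      (Matrix.diagonal (fun i => ν - pencilDiag u B i z) +
        Matrix.of fun i j => if i = j then 0 else -B i j).det := by
  rw [Matrix.eval_charpoly]
  congr 1
  ext i j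
  rw [Matrix.sub_apply, pencil_apply]
  by_cases h : i = j
  · subst h; simp [pencilDiag]
  · simp [h]

open scoped Classical in
/-- The number of eigenvalues of the pencil in a disc of radius `ρ` around `a` is that of the
diagonal part, when the diagonal entries other than `a` are far from `a`. -/
theorem card_roots_pencil {ρ : ℝ} (hρ : 0 < ρ)
    (hB : ∀ i j, i ≠ j → ‖B i j‖ < detConst n * ρ) (z a : ℂ)
    (ha : ∀ m, pencilDiag u B m z = a ∨ 2 * ρ < ‖pencilDiag u B m z - a‖) :
    ((pencil u B z).charpoly.roots.filter (· ∈ Metric.ball a ρ)).card =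
      (Finset.univ.filter fun m => pencilDiag u B m z = a).card := by
  set q : Polynomial ℂ := ∏ m, (Polynomial.X - Polynomial.C (pencilDiag u B m z)) with hq
  have hroots : q.roots = Finset.univ.val.map fun m => pencilDiag u B m z := by
    rw [hq]
    have h := Polynomial.roots_multiset_prod_X_sub_C
      (Finset.univ.val.map fun m => pencilDiag u B m z)
    rw [Multiset.map_map] at h
    exact h
  have heq : ∀ ν, q.eval ν = ∏ m, (ν - pencilDiag u B m z) := fun ν => by
    rw [hq, Polynomial.eval_prod]; simp
  rw [Polynomial.card_roots_ball_eq_of_norm_sub_lt _ q a ρ hρ, hroots, Multiset.filter_map,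
    Multiset.card_map, Finset.card_def, Finset.filter_val]
  · congr 1
    refine Multiset.filter_congr fun m _ => ?_
    simp only [Function.comp, Metric.mem_ball, dist_eq_norm]
    constructor
    · intro h
      rcases ha m with h' | h'
      · exact h'
      · linarith
    · intro h
      rw [h, sub_self, norm_zero]; exact hρ
  · intro ν hν
    rw [heq, eval_charpoly_pencil]
    rw [mem_sphere_iff_norm] at hν
    refine norm_det_diagonal_add_sub_lt _ _ hρ (fun m => ?_) fun i j => ?_
    · rcases ha m with h | h
      · rw [h, hν]
      · have := norm_sub_le (ν - a) (ν - pencilDiag u B m z)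
        rw [show ν - a - (ν - pencilDiag u B m z) = pencilDiag u B m z - a by ring] at this
        linarith
    · by_cases h : i = j
      · simpa [h] using mul_pos (detConst_pos n) hρ
      · simpa [h] using hB i j h

open scoped Classical in
/-- The eigenvalue of the pencil that is close to an isolated diagonal entry. -/
noncomputable def isoRoot (u : Fin n → ℝ) (B : Matrix (Fin n) (Fin n) ℂ) (ρ : ℝ) (i : Fin n)
    (z : ℂ) : ℂ :=
  if h : ∃ ν ∈ Metric.ball (pencilDiag u B i z) ρ, ν ∈ (pencil u B z).charpoly.roots then
    Classical.choose h else 0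

open scoped Classical in
theorem filter_roots_eq_isoRoot {ρ : ℝ} (hρ : 0 < ρ)
    (hB : ∀ i j, i ≠ j → ‖B i j‖ < detConst n * ρ) {i : Fin n} {z : ℂ}
    (hi : Isolated u B ρ i z) :
    (pencil u B z).charpoly.roots.filter (· ∈ Metric.ball (pencilDiag u B i z) ρ) =
      {isoRoot u B ρ i z} := by
  have hcard := card_roots_pencil hρ hB z (pencilDiag u B i z) fun m => by
    by_cases h : m = i
    · exact Or.inl (by rw [h])
    · exact Or.inr (hi m h)
  have hone : (Finset.univ.filter fun m => pencilDiag u B m z = pencilDiag u B i z) = {i} := by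
    ext m
    simp only [Finset.mem_filter, Finset.mem_univ, true_and, Finset.mem_singleton]
    refine ⟨fun h => ?_, fun h => by rw [h]⟩
    by_contra hm
    have := hi m hm
    rw [h, sub_self, norm_zero] at this
    linarith
  rw [hone, Finset.card_singleton] at hcard
  obtain ⟨ν, hν⟩ := Multiset.card_eq_one.mp hcard
  have hmem : ν ∈ (pencil u B z).charpoly.roots.filter
      (· ∈ Metric.ball (pencilDiag u B i z) ρ) := hν ▸ Multiset.mem_singleton_self ν
  have hex : ∃ ν ∈ Metric.ball (pencilDiag u B i z) ρ, ν ∈ (pencil u B z).charpoly.roots :=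
    ⟨ν, (Multiset.mem_filter.mp hmem).2, (Multiset.mem_filter.mp hmem).1⟩
  have hs := Classical.choose_spec hex
  have : isoRoot u B ρ i z ∈ (pencil u B z).charpoly.roots.filter
      (· ∈ Metric.ball (pencilDiag u B i z) ρ) := by
    rw [isoRoot, dif_pos hex]
    exact Multiset.mem_filter.mpr ⟨hs.2, hs.1⟩
  rw [hν, Multiset.mem_singleton] at this
  rw [hν, this]

theorem isoRoot_mem {ρ : ℝ} (hρ : 0 < ρ)
    (hB : ∀ i j, i ≠ j → ‖B i j‖ < detConst n * ρ) {i : Fin n} {z : ℂ}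
    (hi : Isolated u B ρ i z) :
    isoRoot u B ρ i z ∈ (pencil u B z).charpoly.roots ∧
      ‖isoRoot u B ρ i z - pencilDiag u B i z‖ < ρ := by
  classical
  have h := Multiset.mem_singleton_self (isoRoot u B ρ i z)
  rw [← filter_roots_eq_isoRoot hρ hB hi, Multiset.mem_filter, mem_ball_iff_norm] at h
  exact h

theorem eq_isoRoot {ρ : ℝ} (hρ : 0 < ρ)
    (hB : ∀ i j, i ≠ j → ‖B i j‖ < detConst n * ρ) {i : Fin n} {z ν : ℂ}
    (hi : Isolated u B ρ i z) (h1 : (pencil u B z).charpoly.eval ν = 0)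
    (h2 : ‖ν - pencilDiag u B i z‖ < ρ) : ν = isoRoot u B ρ i z := by
  classical
  have : ν ∈ (pencil u B z).charpoly.roots.filter
      (· ∈ Metric.ball (pencilDiag u B i z) ρ) := by
    rw [Multiset.mem_filter, mem_ball_iff_norm]
    exact ⟨(Polynomial.mem_roots (Matrix.charpoly_monic _).ne_zero).mpr h1, h2⟩
  rwa [filter_roots_eq_isoRoot hρ hB hi, Multiset.mem_singleton] at this

theorem rootMultiplicity_isoRoot {ρ : ℝ} (hρ : 0 < ρ)
    (hB : ∀ i j, i ≠ j → ‖B i j‖ < detConst n * ρ) {i : Fin n} {z : ℂ}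
    (hi : Isolated u B ρ i z) :
    (pencil u B z).charpoly.rootMultiplicity (isoRoot u B ρ i z) = 1 := by
  classical
  have h := isoRoot_mem hρ hB hi
  rw [← Polynomial.count_roots, ← Multiset.count_filter_of_pos
    (p := (· ∈ Metric.ball (pencilDiag u B i z) ρ)) (mem_ball_iff_norm.mpr h.2),
    filter_roots_eq_isoRoot hρ hB hi, Multiset.count_singleton_self]

theorem isoRoot_ne {ρ : ℝ} (hρ : 0 < ρ)
    (hB : ∀ i j, i ≠ j → ‖B i j‖ < detConst n * ρ) {i j : Fin n} {z : ℂ} (hij : i ≠ j)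
    (hi : Isolated u B ρ i z) (hj : Isolated u B ρ j z) :
    isoRoot u B ρ i z ≠ isoRoot u B ρ j z := by
  intro h
  have h1 := (isoRoot_mem hρ hB hi).2
  have h2 := (isoRoot_mem hρ hB hj).2
  have h3 := hi j hij.symm
  rw [h] at h1
  have := norm_sub_le (isoRoot u B ρ j z - pencilDiag u B i z)
    (isoRoot u B ρ j z - pencilDiag u B j z)
  rw [show isoRoot u B ρ j z - pencilDiag u B i z - (isoRoot u B ρ j z - pencilDiag u B j z)
    = pencilDiag u B j z - pencilDiag u B i z by ring] at this
  linarith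

theorem isOpen_isolated (ρ : ℝ) (i : Fin n) : IsOpen {z | Isolated u B ρ i z} := by
  simp only [Isolated, Set.ofPred_forall]
  refine isOpen_iInter_of_finite fun j => isOpen_iInter_of_finite fun _ => ?_
  refine isOpen_lt continuous_const ?_
  unfold pencilDiag
  fun_prop

theorem contDiff_eval_charpoly_pencil :
    ContDiff ℂ ⊤ fun p : ℂ × ℂ => (pencil u B p.1).charpoly.eval p.2 := by
  have : (fun p : ℂ × ℂ => (pencil u B p.1).charpoly.eval p.2) = fun p : ℂ × ℂ =>
      ∑ σ : Equiv.Perm (Fin n), (Equiv.Perm.sign σ : ℤ) •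
        ∏ i, ((if σ i = i then p.2 - pencilDiag u B i p.1 else 0) +
          if σ i = i then 0 else -B (σ i) i) := by
    funext p
    rw [eval_charpoly_pencil, Matrix.det_apply]
    refine Finset.sum_congr rfl fun σ _ => ?_
    congr 1
    refine Finset.prod_congr rfl fun i _ => ?_
    rw [Matrix.add_apply, Matrix.diagonal_apply, Matrix.of_apply]
    by_cases h : σ i = i <;> simp [h]
  rw [this]
  refine ContDiff.sum fun σ _ => ContDiff.const_smul _ (contDiff_prod fun i _ => ?_)
  by_cases h : σ i = i
  · simp only [h, if_true, pencilDiag]; fun_prop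
  · simp only [h, if_false]; fun_prop

/-- An isolated eigenvalue is a simple root, so it depends analytically on `z` by the implicit
function theorem. -/
theorem isoRoot_analyticAt {ρ : ℝ} (hρ : 0 < ρ)
    (hB : ∀ i j, i ≠ j → ‖B i j‖ < detConst n * ρ) {i : Fin n} {z : ℂ}
    (hi : Isolated u B ρ i z) : AnalyticAt ℂ (isoRoot u B ρ i) z := by
  set ν := isoRoot u B ρ i z with hν
  set F : ℂ × ℂ → ℂ := fun p => (pencil u B p.1).charpoly.eval p.2 with hF
  have hcd : ContDiffAt ℂ ⊤ F (z, ν) := contDiff_eval_charpoly_pencil.contDiffAt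
  have hmem := isoRoot_mem hρ hB hi
  have hF0 : F (z, ν) = 0 := Polynomial.isRoot_of_mem_roots hmem.1
  have hder : (pencil u B z).charpoly.derivative.eval ν ≠ 0 := by
    intro h0
    have h1 := rootMultiplicity_isoRoot hρ hB hi
    rw [← hν] at h1
    have h2 := (Polynomial.one_lt_rootMultiplicity_iff_isRoot
      (Matrix.charpoly_monic (pencil u B z)).ne_zero (t := ν)).mpr ⟨hF0, h0⟩
    omega
  have hinr : (fderiv ℂ F (z, ν) ∘L .inr ℂ ℂ ℂ) 1 =
      (pencil u B z).charpoly.derivative.eval ν := by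
    have h1 : HasFDerivAt F (fderiv ℂ F (z, ν)) (z, ν) :=
      (hcd.differentiableAt (by simp)).hasFDerivAt
    have h2 : HasDerivAt (fun w : ℂ => (z, w)) ((0 : ℂ), (1 : ℂ)) ν :=
      (hasDerivAt_const ν z).prodMk (hasDerivAt_id ν)
    have h3 := h1.comp_hasDerivAt (x := ν) (f := fun w : ℂ => (z, w)) h2
    have h4 : HasDerivAt (F ∘ fun w : ℂ => (z, w)) _ ν :=
      (pencil u B z).charpoly.hasDerivAt ν
    simpa using h3.unique h4
  have hinv : (fderiv ℂ F (z, ν) ∘L .inr ℂ ℂ ℂ).IsInvertible := by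
    refine ⟨ContinuousLinearEquiv.unitsEquivAut ℂ (Units.mk0 _ hder), ?_⟩
    refine ContinuousLinearMap.ext_ring ?_
    rw [hinr]
    simp
  set ψ := hcd.implicitFunction (by simp) hinv with hψ
  have hψc : ContDiffAt ℂ ⊤ ψ z := hcd.contDiffAt_implicitFunction (by simp) hinv
  have hψ0 : ψ z = ν := hcd.implicitFunction_apply_self (by simp) hinv
  have hψan : AnalyticAt ℂ ψ z := hψc.analyticAt
  have hev : ∀ᶠ x in 𝓝 z, F (x, ψ x) = F (z, ν) :=
    hcd.eventually_apply_implicitFunction (by simp) hinv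
  refine hψan.congr ?_
  have hnear : ∀ᶠ x in 𝓝 z, ‖ψ x - pencilDiag u B i x‖ < ρ := by
    have hc : ContinuousAt (fun x => ‖ψ x - pencilDiag u B i x‖) z := by
      have := hψan.continuousAt
      unfold pencilDiag
      fun_prop
    refine hc.eventually_lt continuousAt_const ?_
    rw [hψ0]; exact hmem.2
  filter_upwards [hev, hnear, (isOpen_isolated ρ i).mem_nhds hi] with x h1 h2 h3
  exact eq_isoRoot hρ hB h3 (h1.trans hF0) h2

/-! ### Reality -/

theorem eval_charpoly_pencil_conj (hB : B.IsHermitian) (z ν : ℂ) :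
    (pencil u B ((starRingEnd ℂ) z)).charpoly.eval ((starRingEnd ℂ) ν) =
      (starRingEnd ℂ) ((pencil u B z).charpoly.eval ν) := by
  rw [Matrix.eval_charpoly, Matrix.eval_charpoly]
  change _ = star _
  rw [← Matrix.det_conjTranspose]
  congr 1
  ext i j
  have := congrFun (congrFun hB i) j
  rw [Matrix.conjTranspose_apply] at this
  simp only [Matrix.sub_apply, pencil_apply, Matrix.conjTranspose_apply, star_sub, star_add, this]
  by_cases h : i = j
  · subst h; simp
  · simp [h, Ne.symm h]

theorem pencilDiag_conj (hB : B.IsHermitian) (i : Fin n) (z : ℂ) :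
    pencilDiag u B i ((starRingEnd ℂ) z) = (starRingEnd ℂ) (pencilDiag u B i z) := by
  have := congrFun (congrFun hB i) i
  rw [Matrix.conjTranspose_apply] at this
  simp only [pencilDiag, map_add, map_mul, conj_ofReal]
  rw [starRingEnd_apply (R := ℂ) (B i i), this]

theorem Isolated.conj (hB : B.IsHermitian) {ρ : ℝ} {i : Fin n} {z : ℂ}
    (hi : Isolated u B ρ i z) : Isolated u B ρ i ((starRingEnd ℂ) z) := fun j hj => by
  rw [pencilDiag_conj hB, pencilDiag_conj hB, ← map_sub, norm_conj]
  exact hi j hj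

theorem isoRoot_conj (hH : B.IsHermitian) {ρ : ℝ} (hρ : 0 < ρ)
    (hB : ∀ i j, i ≠ j → ‖B i j‖ < detConst n * ρ) {i : Fin n} {z : ℂ}
    (hi : Isolated u B ρ i z) :
    isoRoot u B ρ i ((starRingEnd ℂ) z) = (starRingEnd ℂ) (isoRoot u B ρ i z) := by
  symm
  obtain ⟨h1, h2⟩ := isoRoot_mem hρ hB hi
  refine eq_isoRoot hρ hB (hi.conj hH) ?_ ?_
  · rw [eval_charpoly_pencil_conj hH, (Polynomial.isRoot_of_mem_roots h1 : _ = _), map_zero]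
  · rw [pencilDiag_conj hH, ← map_sub, norm_conj]
    exact h2

/-! ### The two remaining eigenvalues -/

/-- The sum of the two eigenvalues of the pencil other than the `k`-th ones, `k ≠ i, j`. -/
noncomputable def pairSum (u : Fin n → ℝ) (B : Matrix (Fin n) (Fin n) ℂ) (ρ : ℝ) (i j : Fin n)
    (z : ℂ) : ℂ :=
  (pencil u B z).trace - ∑ k ∈ ({i, j} : Finset (Fin n))ᶜ, isoRoot u B ρ k z

/-- The discriminant `(α - β)²` of the two eigenvalues `α`, `β` of the pencil other than the
`k`-th ones, `k ≠ i, j`. It is computed from `α + β` and from the value `(x - α) (x - β)` at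
`x = u_i z + B_ii` of the corresponding quadratic factor of the characteristic polynomial. -/
noncomputable def pairDisc (u : Fin n → ℝ) (B : Matrix (Fin n) (Fin n) ℂ) (ρ : ℝ) (i j : Fin n)
    (z : ℂ) : ℂ :=
  (2 * pencilDiag u B i z - pairSum u B ρ i j z) ^ 2 -
    4 * ((pencil u B z).charpoly.eval (pencilDiag u B i z) /
      ∏ k ∈ ({i, j} : Finset (Fin n))ᶜ, (pencilDiag u B i z - isoRoot u B ρ k z))

/-- Away from `i` and `j` all diagonal entries are isolated. -/
def PairIsolated (u : Fin n → ℝ) (B : Matrix (Fin n) (Fin n) ℂ) (ρ : ℝ) (i j : Fin n) (z : ℂ) :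
    Prop :=
  ∀ k, k ≠ i → k ≠ j → Isolated u B ρ k z

theorem PairIsolated.symm {ρ : ℝ} {i j : Fin n} {z : ℂ} (h : PairIsolated u B ρ i j z) :
    PairIsolated u B ρ j i z := fun k h1 h2 => h k h2 h1

theorem map_isoRoot_le_roots {ρ : ℝ} (hρ : 0 < ρ)
    (hB : ∀ i j, i ≠ j → ‖B i j‖ < detConst n * ρ) {z : ℂ} (s : Finset (Fin n))
    (hs : ∀ k ∈ s, Isolated u B ρ k z) :
    s.val.map (fun k => isoRoot u B ρ k z) ≤ (pencil u B z).charpoly.roots := by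
  refine (Multiset.le_iff_subset ?_).mpr fun x hx => ?_
  · refine Multiset.Nodup.map_on (fun k hk l hl h => ?_) s.nodup
    by_contra hkl
    exact isoRoot_ne hρ hB hkl (hs k hk) (hs l hl) h
  · obtain ⟨k, hk, rfl⟩ := Multiset.mem_map.mp hx
    exact (isoRoot_mem hρ hB (hs k hk)).1

theorem card_roots_charpoly (M : Matrix (Fin n) (Fin n) ℂ) : M.charpoly.roots.card = n := by
  rw [← (IsAlgClosed.splits M.charpoly).natDegree_eq_card_roots,
    Matrix.charpoly_natDegree_eq_dim, Fintype.card_fin]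

theorem roots_pencil_eq_of_forall_isolated {ρ : ℝ} (hρ : 0 < ρ)
    (hB : ∀ i j, i ≠ j → ‖B i j‖ < detConst n * ρ) {z : ℂ}
    (hs : ∀ k, Isolated u B ρ k z) :
    (pencil u B z).charpoly.roots = Finset.univ.val.map (fun k => isoRoot u B ρ k z) := by
  refine (Multiset.eq_of_le_of_card_le (map_isoRoot_le_roots hρ hB Finset.univ fun k _ => hs k)
    ?_).symm
  rw [card_roots_charpoly, Multiset.card_map]
  simp

theorem exists_roots_pencil_eq {ρ : ℝ} (hρ : 0 < ρ)
    (hB : ∀ i j, i ≠ j → ‖B i j‖ < detConst n * ρ) {i j : Fin n} (hij : i ≠ j) {z : ℂ}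
    (h : PairIsolated u B ρ i j z) :
    ∃ α β : ℂ, (pencil u B z).charpoly.roots =
        (({i, j} : Finset (Fin n))ᶜ.val.map fun k => isoRoot u B ρ k z) + {α, β} ∧
      (∀ k, k ≠ i → k ≠ j → ρ ≤ ‖α - pencilDiag u B k z‖ ∧ ρ ≤ ‖β - pencilDiag u B k z‖) := by
  classical
  have hs : ∀ k ∈ ({i, j} : Finset (Fin n))ᶜ, Isolated u B ρ k z := fun k hk => by
    simp only [Finset.mem_compl, Finset.mem_insert, Finset.mem_singleton, not_or] at hk
    exact h k hk.1 hk.2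
  obtain ⟨t, ht⟩ := Multiset.le_iff_exists_add.mp (map_isoRoot_le_roots hρ hB _ hs)
  have hc := congrArg Multiset.card ht
  have hcard2 : ({i, j} : Finset (Fin n)).card = 2 := Finset.card_pair hij
  have hle : ({i, j} : Finset (Fin n)).card ≤ n := by
    simpa using Finset.card_le_univ ({i, j} : Finset (Fin n))
  rw [card_roots_charpoly, Multiset.card_add, Multiset.card_map, Finset.card_val,
    Finset.card_compl, Fintype.card_fin, hcard2] at hc
  have ht2 : t.card = 2 := by omega
  obtain ⟨α, β, rfl⟩ := Multiset.card_eq_two.mp ht2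
  refine ⟨α, β, ht, fun k hki hkj => ?_⟩
  have hk := h k hki hkj
  have hf := filter_roots_eq_isoRoot hρ hB hk
  rw [ht, Multiset.filter_add] at hf
  have hmem : isoRoot u B ρ k z ∈
      ((({i, j} : Finset (Fin n))ᶜ.val.map fun k => isoRoot u B ρ k z).filter
        (· ∈ Metric.ball (pencilDiag u B k z) ρ)) := by
    refine Multiset.mem_filter.mpr
      ⟨Multiset.mem_map.mpr ⟨k, Finset.mem_val.mpr (by simp [hki, hkj]), rfl⟩, ?_⟩
    exact mem_ball_iff_norm.mpr (isoRoot_mem hρ hB hk).2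
  have h1 := Multiset.card_pos_iff_exists_mem.mpr ⟨_, hmem⟩
  have h2 := congrArg Multiset.card hf
  rw [Multiset.card_add, Multiset.card_singleton] at h2
  have h3 : (({α, β} : Multiset ℂ).filter (· ∈ Metric.ball (pencilDiag u B k z) ρ)) = 0 :=
    Multiset.card_eq_zero.mp (by omega)
  rw [Multiset.filter_eq_nil] at h3
  constructor
  · have := h3 α (by simp)
    rwa [mem_ball_iff_norm, not_lt] at this
  · have := h3 β (by simp)
    rwa [mem_ball_iff_norm, not_lt] at this

theorem eval_charpoly_eq_prod_roots (M : Matrix (Fin n) (Fin n) ℂ) (x : ℂ) :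
    M.charpoly.eval x = (M.charpoly.roots.map fun a => x - a).prod := by
  rw [(IsAlgClosed.splits M.charpoly).eval_eq_prod_roots_of_monic (Matrix.charpoly_monic M)]

theorem pairSum_pairDisc_eq {ρ : ℝ} (hρ : 0 < ρ)
    (hB : ∀ i j, i ≠ j → ‖B i j‖ < detConst n * ρ) {i j : Fin n} {z : ℂ}
    (h : PairIsolated u B ρ i j z) {α β : ℂ}
    (hαβ : (pencil u B z).charpoly.roots =
        (({i, j} : Finset (Fin n))ᶜ.val.map fun k => isoRoot u B ρ k z) + {α, β}) :
    pairSum u B ρ i j z = α + β ∧ pairDisc u B ρ i j z = (α - β) ^ 2 := by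
  have h1 : pairSum u B ρ i j z = α + β := by
    rw [pairSum, Matrix.trace_eq_sum_roots_charpoly, hαβ, Multiset.sum_add, Finset.sum]
    simp
  refine ⟨h1, ?_⟩
  have hne : ∏ k ∈ ({i, j} : Finset (Fin n))ᶜ, (pencilDiag u B i z - isoRoot u B ρ k z) ≠ 0 := by
    refine Finset.prod_ne_zero_iff.mpr fun k hk => ?_
    simp only [Finset.mem_compl, Finset.mem_insert, Finset.mem_singleton, not_or] at hk
    have h3 := h k hk.1 hk.2
    have h4 := (isoRoot_mem hρ hB h3).2
    intro h0
    have h5 := h3 i (Ne.symm hk.1)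
    rw [sub_eq_zero.mp h0] at h5
    linarith
  rw [pairDisc, h1, eval_charpoly_eq_prod_roots, hαβ, Multiset.map_add, Multiset.prod_add,
    Multiset.map_map]
  have : (Multiset.map ((fun a => pencilDiag u B i z - a) ∘ fun k => isoRoot u B ρ k z)
      ({i, j} : Finset (Fin n))ᶜ.val).prod =
      ∏ k ∈ ({i, j} : Finset (Fin n))ᶜ, (pencilDiag u B i z - isoRoot u B ρ k z) := rfl
  rw [this, mul_div_cancel_left₀ _ hne]
  simp
  ring

theorem pairSum_comm (ρ : ℝ) (i j : Fin n) (z : ℂ) :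
    pairSum u B ρ i j z = pairSum u B ρ j i z := by
  rw [pairSum, pairSum, Finset.pair_comm]

theorem pairDisc_comm {ρ : ℝ} (hρ : 0 < ρ)
    (hB : ∀ i j, i ≠ j → ‖B i j‖ < detConst n * ρ) {i j : Fin n} (hij : i ≠ j) {z : ℂ}
    (h : PairIsolated u B ρ i j z) : pairDisc u B ρ i j z = pairDisc u B ρ j i z := by
  obtain ⟨α, β, h1, -⟩ := exists_roots_pencil_eq hρ hB hij h
  rw [(pairSum_pairDisc_eq hρ hB h h1).2]
  rw [Finset.pair_comm] at h1
  rw [(pairSum_pairDisc_eq hρ hB h.symm h1).2]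

/-- Where `i` and `j` are isolated too, the remaining eigenvalues are the `i`-th and the `j`-th. -/
theorem pairSum_pairDisc_eq_isoRoot {ρ : ℝ} (hρ : 0 < ρ)
    (hB : ∀ i j, i ≠ j → ‖B i j‖ < detConst n * ρ) {i j : Fin n} (hij : i ≠ j) {z : ℂ}
    (h : ∀ k, Isolated u B ρ k z) :
    pairSum u B ρ i j z = isoRoot u B ρ i z + isoRoot u B ρ j z ∧
      pairDisc u B ρ i j z = (isoRoot u B ρ i z - isoRoot u B ρ j z) ^ 2 := by
  refine pairSum_pairDisc_eq hρ hB (fun k _ _ => h k) ?_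
  rw [roots_pencil_eq_of_forall_isolated hρ hB h]
  have h1 : (Finset.univ : Finset (Fin n)).val =
      ({i, j} : Finset (Fin n))ᶜ.val + ({i, j} : Finset (Fin n)).val := by
    rw [← Finset.disjUnion_val _ _ disjoint_compl_left, Finset.disjUnion_eq_union,
      Finset.union_comm, Finset.union_compl]
  have h2 : ({i, j} : Finset (Fin n)).val = {i, j} :=
    Finset.insert_val_of_notMem (by simpa using hij)
  rw [h1, h2, Multiset.map_add]
  simp

theorem pairSum_analyticAt {ρ : ℝ} (hρ : 0 < ρ)
    (hB : ∀ i j, i ≠ j → ‖B i j‖ < detConst n * ρ) {i j : Fin n} {z : ℂ}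
    (h : PairIsolated u B ρ i j z) : AnalyticAt ℂ (pairSum u B ρ i j) z := by
  unfold pairSum
  refine AnalyticAt.sub ?_ (Finset.analyticAt_fun_sum _ fun k hk => ?_)
  · simp only [Matrix.trace, Matrix.diag, pencil_apply, if_true]
    exact Finset.analyticAt_fun_sum _ fun k _ => by fun_prop
  · simp only [Finset.mem_compl, Finset.mem_insert, Finset.mem_singleton, not_or] at hk
    exact isoRoot_analyticAt hρ hB (h k hk.1 hk.2)

theorem pairDisc_analyticAt {ρ : ℝ} (hρ : 0 < ρ)
    (hB : ∀ i j, i ≠ j → ‖B i j‖ < detConst n * ρ) {i j : Fin n} {z : ℂ}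
    (h : PairIsolated u B ρ i j z) : AnalyticAt ℂ (pairDisc u B ρ i j) z := by
  have hd : AnalyticAt ℂ (fun z => pencilDiag u B i z) z := by
    unfold pencilDiag; fun_prop
  have hF : AnalyticAt ℂ (fun z => (pencil u B z).charpoly.eval (pencilDiag u B i z)) z := by
    have h1 : AnalyticAt ℂ (fun p : ℂ × ℂ => (pencil u B p.1).charpoly.eval p.2)
        (z, pencilDiag u B i z) := contDiff_eval_charpoly_pencil.contDiffAt.analyticAt
    exact AnalyticAt.fun_comp (g := fun p : ℂ × ℂ => (pencil u B p.1).charpoly.eval p.2)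
      (f := fun z => (z, pencilDiag u B i z)) h1 (analyticAt_id.prod hd)
  unfold pairDisc
  refine ((analyticAt_const.mul hd).sub (pairSum_analyticAt hρ hB h)).pow 2 |>.sub
    (analyticAt_const.mul (hF.div (Finset.analyticAt_fun_prod _ fun k hk => ?_) ?_))
  · simp only [Finset.mem_compl, Finset.mem_insert, Finset.mem_singleton, not_or] at hk
    exact hd.sub (isoRoot_analyticAt hρ hB (h k hk.1 hk.2))
  · refine Finset.prod_ne_zero_iff.mpr fun k hk => ?_
    simp only [Finset.mem_compl, Finset.mem_insert, Finset.mem_singleton, not_or] at hk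
    have h3 := h k hk.1 hk.2
    have h4 := (isoRoot_mem hρ hB h3).2
    intro h0
    have h5 := h3 i (Ne.symm hk.1)
    rw [sub_eq_zero.mp h0] at h5
    linarith

theorem pairSum_conj (hH : B.IsHermitian) {ρ : ℝ} (hρ : 0 < ρ)
    (hB : ∀ i j, i ≠ j → ‖B i j‖ < detConst n * ρ) {i j : Fin n} {z : ℂ}
    (h : PairIsolated u B ρ i j z) :
    pairSum u B ρ i j ((starRingEnd ℂ) z) = (starRingEnd ℂ) (pairSum u B ρ i j z) := by
  rw [pairSum, pairSum, map_sub, map_sum]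
  congr 1
  · simp only [Matrix.trace, Matrix.diag, map_sum]
    refine Finset.sum_congr rfl fun k _ => ?_
    have := pencilDiag_conj (u := u) hH k z
    simpa [pencil_apply, pencilDiag] using this
  · refine Finset.sum_congr rfl fun k hk => ?_
    simp only [Finset.mem_compl, Finset.mem_insert, Finset.mem_singleton, not_or] at hk
    exact isoRoot_conj hH hρ hB (h k hk.1 hk.2)

theorem pairDisc_conj (hH : B.IsHermitian) {ρ : ℝ} (hρ : 0 < ρ)
    (hB : ∀ i j, i ≠ j → ‖B i j‖ < detConst n * ρ) {i j : Fin n} {z : ℂ}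
    (h : PairIsolated u B ρ i j z) :
    pairDisc u B ρ i j ((starRingEnd ℂ) z) = (starRingEnd ℂ) (pairDisc u B ρ i j z) := by
  rw [pairDisc, pairDisc, pairSum_conj hH hρ hB h, pencilDiag_conj hH,
    eval_charpoly_pencil_conj hH]
  simp only [map_sub, map_mul, map_pow, map_div₀, map_prod, map_ofNat]
  congr 3
  refine Finset.prod_congr rfl fun k hk => ?_
  simp only [Finset.mem_compl, Finset.mem_insert, Finset.mem_singleton, not_or] at hk
  rw [isoRoot_conj hH hρ hB (h k hk.1 hk.2)]

end Pencil

/-! ### Double eigenvalues of Hermitian matrices -/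

/-- A Hermitian matrix has two independent eigenvectors for a double eigenvalue, hence one that
vanishes at a prescribed index. -/
theorem Matrix.IsHermitian.exists_eigenvector_apply_eq_zero
    {n : ℕ} {M : Matrix (Fin n) (Fin n) ℂ} (hM : M.IsHermitian) {a : ℂ}
    (ha : ({a, a} : Multiset ℂ) ≤ M.charpoly.roots) (i : Fin n) :
    ∃ v : Fin n → ℂ, v ≠ 0 ∧ M.mulVec v = a • v ∧ v i = 0 := by
  classical
  rw [hM.roots_charpoly_eq_eigenvalues] at ha
  have hc := Multiset.count_le_of_le a ha
  rw [Multiset.count_map, show Multiset.count a ({a, a} : Multiset ℂ) = 2 by simp] at hc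
  have hc' : 1 < (Finset.univ.filter fun k : Fin n =>
      a = (RCLike.ofReal ∘ hM.eigenvalues) k).card := by
    rw [Finset.card_def, Finset.filter_val]; omega
  obtain ⟨k, hk, l, hl, hkl⟩ := Finset.one_lt_card.mp hc'
  simp only [Finset.mem_filter, Finset.mem_univ, true_and, Function.comp] at hk hl
  set v : Fin n → ℂ := ⇑(hM.eigenvectorBasis k) with hv
  set w : Fin n → ℂ := ⇑(hM.eigenvectorBasis l) with hw
  have hMv : M.mulVec v = a • v := by
    rw [hv, hM.mulVec_eigenvectorBasis, hk]; ext; simp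
  have hMw : M.mulVec w = a • w := by
    rw [hw, hM.mulVec_eigenvectorBasis, hl]; ext; simp
  have hli : ∀ s t : ℂ, s • v + t • w = 0 → s = 0 ∧ t = 0 := by
    intro s t h
    have h1 := hM.eigenvectorBasis.orthonormal.linearIndependent
    have h2 := h1.comp ![k, l] (by
      intro x y hxy
      fin_cases x <;> fin_cases y <;> simp_all [hkl.symm])
    have e : ⇑hM.eigenvectorBasis ∘ ![k, l] =
        ![hM.eigenvectorBasis k, hM.eigenvectorBasis l] := by
      funext x; fin_cases x <;> rfl
    rw [e] at h2
    have h3 := LinearIndependent.pair_iff.mp h2 s t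
    refine h3 ?_
    ext m
    exact congrFun h m
  by_cases h0 : v i = 0
  · refine ⟨v, fun hv0 => ?_, hMv, h0⟩
    exact one_ne_zero (hli 1 0 (by rw [hv0]; simp)).1
  · refine ⟨-w i • v + v i • w, fun hv0 => h0 (hli _ _ hv0).2, ?_, ?_⟩
    · rw [Matrix.mulVec_add, Matrix.mulVec_smul, Matrix.mulVec_smul, hMv, hMw, smul_add,
        smul_comm a, smul_comm a]
    · simp; ring

/-! ### Hermitian pencils with small off-diagonal part -/

/-- The point where the `i`-th and the `j`-th diagonal entries of the pencil coincide. -/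
noncomputable def pencilCross {n : ℕ} (u : Fin n → ℝ) (B : Matrix (Fin n) (Fin n) ℂ)
    (i j : Fin n) : ℝ :=
  -((B i i).re - (B j j).re) / (u i - u j)

/-- A Hermitian pencil `z u + B` that is close to a diagonal one with distinct crossing points:
`R` bounds the distances between these points and to `0`, the eigenvalues are localized within `ρ`
of the diagonal entries, and `ε` bounds the off-diagonal entries of `B`. No off-diagonal entry is
small compared to the products of two others (`coupling_lt`). The constant in `gap_lt` makes the
`i`-th and `j`-th diagonal entries at least `2ρ` apart outside the disc of radius `R / 100` around
`z_ij`; the one in `cross_sep` keeps the disc of radius `3R` around `z_ij` at distance `R` from the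
other crossings. -/
structure NearDiagonal {n : ℕ} (u : Fin n → ℝ) (B : Matrix (Fin n) (Fin n) ℂ) (R ρ ε : ℝ) :
    Prop where
  herm : B.IsHermitian
  u_ne : ∀ i j, i ≠ j → u i ≠ u j
  R_pos : 0 < R
  ρ_pos : 0 < ρ
  off_lt : ∀ i j, i ≠ j → ‖B i j‖ < ε
  ε_lt : ε < detConst n * ρ
  two_n_ε_lt : 2 * (n * ε) < ρ
  coupling_lt : ∀ i j, i ≠ j → n * ε * (n * ε / ρ) < ‖B i j‖
  gap_lt : ∀ i j, i ≠ j → 200 * ρ < R * |u i - u j|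
  cross_far : ∀ i j, i ≠ j → R < |pencilCross u B i j|
  cross_sep : ∀ i j k l, i < j → k < l → (i, j) ≠ (k, l) →
    4 * R < |pencilCross u B i j - pencilCross u B k l|

section

variable {n : ℕ} {u : Fin n → ℝ} {B : Matrix (Fin n) (Fin n) ℂ} {R ρ ε : ℝ}

theorem pencilCross_comm (i j : Fin n) : pencilCross u B i j = pencilCross u B j i := by
  rw [pencilCross, pencilCross, ← neg_sub (u j), div_neg, ← neg_sub (B j j).re]
  ring

namespace NearDiagonal

variable (H : NearDiagonal u B R ρ ε)
include H

theorem off (i j : Fin n) (h : i ≠ j) : ‖B i j‖ < detConst n * ρ := (H.off_lt i j h).trans H.ε_lt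

theorem sub_ne_zero {i j : Fin n} (h : i ≠ j) : (u i : ℂ) - u j ≠ 0 := by
  rw [← ofReal_sub, ofReal_ne_zero]
  exact _root_.sub_ne_zero.mpr (H.u_ne i j h)

theorem pencilDiag_sub {i j : Fin n} (h : i ≠ j) (z : ℂ) :
    pencilDiag u B i z - pencilDiag u B j z =
      ((u i : ℂ) - u j) * (z - (pencilCross u B i j : ℝ)) := by
  have hre : ∀ k, B k k = ((B k k).re : ℂ) := fun k => by
    have := congrFun (congrFun H.herm k) k
    rw [Matrix.conjTranspose_apply] at this
    exact (conj_eq_iff_re.mp this).symm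
  have := H.sub_ne_zero h
  rw [pencilDiag, pencilDiag, pencilCross, hre i, hre j]
  simp only [ofReal_re]
  push_cast
  field_simp
  ring

theorem norm_gap {i j : Fin n} (h : i ≠ j) : 200 * ρ < R * ‖(u i : ℂ) - u j‖ := by
  rw [← ofReal_sub, norm_real, Real.norm_eq_abs]
  exact H.gap_lt i j h

theorem isolated_of_far {i : Fin n} {z : ℂ}
    (hz : ∀ j, j ≠ i → R / 100 ≤ ‖z - (pencilCross u B i j : ℝ)‖) : Isolated u B ρ i z := by
  intro j hj
  have hz := hz j hj
  rw [H.pencilDiag_sub hj, norm_mul, pencilCross_comm j i]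
  have h1 := H.norm_gap hj
  have := mul_le_mul_of_nonneg_left hz (norm_nonneg ((u j : ℂ) - u i))
  linarith

theorem cross_sep' {i j k l : Fin n} (hij : i ≠ j) (hkl : k ≠ l) (h1 : ¬(i = k ∧ j = l))
    (h2 : ¬(i = l ∧ j = k)) : 4 * R < |pencilCross u B i j - pencilCross u B k l| := by
  rcases lt_or_gt_of_ne hij with a | a <;> rcases lt_or_gt_of_ne hkl with b | b
  · exact H.cross_sep i j k l a b (by simpa using h1)
  · rw [pencilCross_comm k l]
    exact H.cross_sep i j l k a b (by simpa using h2)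
  · rw [pencilCross_comm i j]
    exact H.cross_sep j i k l a b (by simpa [and_comm] using h2)
  · rw [pencilCross_comm i j, pencilCross_comm k l]
    exact H.cross_sep j i l k a b (by simpa [and_comm] using h1)

theorem far_of_near {i j k l : Fin n} (hij : i ≠ j) (hkl : k ≠ l) (h1 : ¬(i = k ∧ j = l))
    (h2 : ¬(i = l ∧ j = k)) {z : ℂ} (hz : ‖z - (pencilCross u B i j : ℝ)‖ < 3 * R) :
    R < ‖z - (pencilCross u B k l : ℝ)‖ := by
  have h3 := H.cross_sep' hij hkl h1 h2
  have h4 := norm_sub_le (z - (pencilCross u B k l : ℝ)) (z - (pencilCross u B i j : ℝ))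
  rw [sub_sub_sub_cancel_left, ← ofReal_sub, norm_real, Real.norm_eq_abs] at h4
  linarith

theorem pairIsolated {i j : Fin n} (hij : i ≠ j) {z : ℂ}
    (hz : ‖z - (pencilCross u B i j : ℝ)‖ < 3 * R) : PairIsolated u B ρ i j z := by
  intro k hki hkj
  refine H.isolated_of_far fun l hl => ?_
  have := H.far_of_near hij hl.symm (fun h => hki h.1.symm) (fun h => hkj h.2.symm) hz
  have := H.R_pos
  linarith

theorem isolated_pair {i j : Fin n} (hij : i ≠ j) {z : ℂ}
    (hz : ‖z - (pencilCross u B i j : ℝ)‖ < 3 * R)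
    (hz' : R / 100 ≤ ‖z - (pencilCross u B i j : ℝ)‖) : Isolated u B ρ i z := by
  refine H.isolated_of_far fun l hl => ?_
  by_cases h : l = j
  · rw [h]; exact hz'
  · have := H.far_of_near hij hl.symm (fun e => h e.2.symm) (fun e => hij e.2.symm) hz
    have := H.R_pos
    linarith

theorem isolated_all {i j : Fin n} (hij : i ≠ j) {z : ℂ}
    (hz : ‖z - (pencilCross u B i j : ℝ)‖ < 3 * R)
    (hz' : R / 100 ≤ ‖z - (pencilCross u B i j : ℝ)‖) (k : Fin n) : Isolated u B ρ k z := by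
  by_cases h : k = i
  · rw [h]; exact H.isolated_pair hij hz hz'
  · by_cases h' : k = j
    · rw [h']
      rw [pencilCross_comm] at hz hz'
      exact H.isolated_pair hij.symm hz hz'
    · exact H.pairIsolated hij hz k h h'

/-! ### Real points carry no double eigenvalue -/

/-- An eigenvector of the pencil at a real point that vanishes at `i` is concentrated at `j`, and
then its `i`-th row bounds `B_ij` by products of other off-diagonal entries. -/
theorem pairDisc_ofReal_ne_zero {i j : Fin n} (hij : i ≠ j) {x : ℝ}
    (hx : ‖(x : ℂ) - (pencilCross u B i j : ℝ)‖ < 3 * R) : pairDisc u B ρ i j x ≠ 0 := by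
  intro h0
  have hp := H.pairIsolated hij hx
  obtain ⟨α, β, hαβ, hfar⟩ := exists_roots_pencil_eq H.ρ_pos H.off hij hp
  rw [(pairSum_pairDisc_eq H.ρ_pos H.off hp hαβ).2] at h0
  have hαeq : α = β := sub_eq_zero.mp (pow_eq_zero_iff two_ne_zero |>.mp h0)
  subst hαeq
  have hM : (pencil u B (x : ℂ)).IsHermitian := by
    ext k l
    have := congrFun (congrFun H.herm k) l
    rw [Matrix.conjTranspose_apply] at this ⊢
    rw [pencil_apply, pencil_apply, star_add, this]
    by_cases h : k = l
    · subst h; simp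
    · simp [h, Ne.symm h]
  obtain ⟨v, hv0, hMv, hvi⟩ := hM.exists_eigenvector_apply_eq_zero
    (a := α) (hαβ ▸ Multiset.le_add_left _ _) i
  have hrow : ∀ k, (α - pencilDiag u B k x) * v k =
      ∑ l, (if k = l then 0 else B k l) * v l := by
    intro k
    have h1 := congrFun hMv k
    rw [Matrix.mulVec, dotProduct, Pi.smul_apply, smul_eq_mul] at h1
    rw [sub_mul, ← h1, sub_eq_iff_eq_add, ← Finset.sum_add_sum_compl {k}, Finset.sum_singleton,
      ← Finset.sum_add_sum_compl {k} fun l => (if k = l then 0 else B k l) * v l,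
      Finset.sum_singleton]
    rw [pencil_apply]
    have : ∑ l ∈ ({k} : Finset (Fin n))ᶜ, pencil u B x k l * v l =
        ∑ l ∈ ({k} : Finset (Fin n))ᶜ, (if k = l then 0 else B k l) * v l := by
      refine Finset.sum_congr rfl fun l hl => ?_
      simp only [Finset.mem_compl, Finset.mem_singleton] at hl
      rw [pencil_apply, if_neg (Ne.symm hl), if_neg (Ne.symm hl), zero_add]
    rw [this, if_pos rfl, if_pos rfl, pencilDiag]
    ring
  have hε : 0 < ε := (norm_nonneg _).trans_lt (H.off_lt i j hij)
  have hn : (0 : ℝ) < n := by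
    have := i.pos
    exact_mod_cast this
  have hV : 0 < ‖v‖ := norm_pos_iff.mpr hv0
  have hsmall : ∀ k, k ≠ j → ‖v k‖ ≤ n * ε / ρ * ‖v‖ := by
    intro k hkj
    by_cases hki : k = i
    · rw [hki, hvi, norm_zero]
      have := H.ρ_pos
      positivity
    · have h1 : ρ * ‖v k‖ ≤ n * ε * ‖v‖ := by
        calc ρ * ‖v k‖ ≤ ‖α - pencilDiag u B k x‖ * ‖v k‖ :=
              mul_le_mul_of_nonneg_right (hfar k hki hkj).1 (norm_nonneg _)
          _ = ‖∑ l, (if k = l then 0 else B k l) * v l‖ := by rw [← norm_mul, hrow k]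
          _ ≤ ∑ _l : Fin n, ε * ‖v‖ := by
              refine norm_sum_le_of_le _ fun l _ => ?_
              rw [norm_mul]
              refine mul_le_mul ?_ (norm_le_pi_norm v l) (norm_nonneg _) hε.le
              by_cases h : k = l
              · simpa [h] using hε.le
              · simpa [h] using (H.off_lt k l h).le
          _ = n * ε * ‖v‖ := by simp; ring
      rw [div_mul_eq_mul_div, le_div_iff₀ H.ρ_pos]
      linarith
  have hhalf : n * ε / ρ < 1 / 2 := by
    rw [div_lt_iff₀ H.ρ_pos]
    linarith [H.two_n_ε_lt]
  have hvj : ‖v‖ ≤ ‖v j‖ := by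
    by_contra hcon
    have : ‖v‖ < ‖v‖ := by
      refine (pi_norm_lt_iff hV).mpr fun k => ?_
      by_cases hk : k = j
      · rw [hk]; exact not_le.mp hcon
      · exact (hsmall k hk).trans_lt (by nlinarith)
    exact lt_irrefl _ this
  have hri := hrow i
  rw [hvi, mul_zero, ← Finset.sum_add_sum_compl {j}, Finset.sum_singleton, if_neg hij] at hri
  have hB : ‖B i j‖ * ‖v‖ ≤ n * ε * (n * ε / ρ) * ‖v‖ := by
    calc ‖B i j‖ * ‖v‖ ≤ ‖B i j‖ * ‖v j‖ := mul_le_mul_of_nonneg_left hvj (norm_nonneg _)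
      _ = ‖∑ l ∈ ({j} : Finset (Fin n))ᶜ, (if i = l then 0 else B i l) * v l‖ := by
          rw [← norm_mul, eq_neg_of_add_eq_zero_left hri.symm, norm_neg]
      _ ≤ ∑ _l ∈ ({j} : Finset (Fin n))ᶜ, ε * (n * ε / ρ * ‖v‖) := by
          refine norm_sum_le_of_le _ fun l hl => ?_
          simp only [Finset.mem_compl, Finset.mem_singleton] at hl
          rw [norm_mul]
          refine mul_le_mul ?_ (hsmall l hl) (norm_nonneg _) hε.le
          by_cases h : i = l
          · simpa [h] using hε.le
          · simpa [h] using (H.off_lt i l h).le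
      _ ≤ ∑ _l : Fin n, ε * (n * ε / ρ * ‖v‖) := by
          have := H.ρ_pos
          exact Finset.sum_le_sum_of_subset_of_nonneg (Finset.subset_univ _)
            fun _ _ _ => by positivity
      _ = n * ε * (n * ε / ρ) * ‖v‖ := by simp; ring
  exact absurd (le_of_mul_le_mul_right hB hV) (not_le.mpr (H.coupling_lt i j hij))

/-! ### The two branch points near a crossing -/

theorem norm_pairDisc_cross_lt {i j : Fin n} (hij : i ≠ j) :
    ‖pairDisc u B ρ i j (pencilCross u B i j : ℝ)‖ < 4 * ρ ^ 2 := by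
  classical
  set x : ℂ := ((pencilCross u B i j : ℝ) : ℂ) with hx
  have hp : PairIsolated u B ρ i j x :=
    H.pairIsolated hij (by rw [sub_self, norm_zero]; linarith [H.R_pos])
  obtain ⟨α, β, hαβ, hfar⟩ := exists_roots_pencil_eq H.ρ_pos H.off hij hp
  rw [(pairSum_pairDisc_eq H.ρ_pos H.off hp hαβ).2]
  have heq : pencilDiag u B j x = pencilDiag u B i x := by
    have := H.pencilDiag_sub hij x
    rw [hx, sub_self, mul_zero] at this
    exact (sub_eq_zero.mp this).symm
  have hfar' : ∀ m, m ≠ i → m ≠ j → 2 * ρ < ‖pencilDiag u B m x - pencilDiag u B i x‖ :=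
    fun m hmi hmj => by
      rw [norm_sub_rev]; exact hp m hmi hmj i (Ne.symm hmi)
  have hcard := card_roots_pencil H.ρ_pos H.off x (pencilDiag u B i x) fun m => by
    by_cases h : m = i
    · left; rw [h]
    · by_cases h' : m = j
      · left; rw [h', heq]
      · exact Or.inr (hfar' m h h')
  have htwo : (Finset.univ.filter fun m => pencilDiag u B m x = pencilDiag u B i x) = {i, j} := by
    ext m
    simp only [Finset.mem_filter, Finset.mem_univ, true_and, Finset.mem_insert,
      Finset.mem_singleton]
    constructor
    · intro h
      by_contra hm
      rw [not_or] at hm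
      have := hfar' m hm.1 hm.2
      rw [h, sub_self, norm_zero] at this
      linarith [H.ρ_pos]
    · rintro (h | h)
      · rw [h]
      · rw [h, heq]
  have hnil : (({i, j} : Finset (Fin n))ᶜ.val.map fun k => isoRoot u B ρ k x).filter
      (· ∈ Metric.ball (pencilDiag u B i x) ρ) = 0 := by
    rw [Multiset.filter_eq_nil]
    intro a ha hmem
    obtain ⟨k, hk, rfl⟩ := Multiset.mem_map.mp ha
    rw [Finset.mem_val] at hk
    simp only [Finset.mem_compl, Finset.mem_insert, Finset.mem_singleton, not_or] at hk
    have h1 := (isoRoot_mem H.ρ_pos H.off (hp k hk.1 hk.2)).2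
    have h2 := hfar' k hk.1 hk.2
    rw [mem_ball_iff_norm] at hmem
    have h3 := norm_sub_le (isoRoot u B ρ k x - pencilDiag u B i x)
      (isoRoot u B ρ k x - pencilDiag u B k x)
    rw [sub_sub_sub_cancel_left] at h3
    linarith
  rw [htwo, Finset.card_pair hij, hαβ, Multiset.filter_add, hnil, zero_add] at hcard
  have hall := Multiset.filter_eq_self.mp (Multiset.eq_of_le_of_card_le
    (Multiset.filter_le (· ∈ Metric.ball (pencilDiag u B i x) ρ) {α, β}) (by rw [hcard]; simp))
  have h1 := mem_ball_iff_norm.mp (hall α (by simp))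
  have h2 := mem_ball_iff_norm.mp (hall β (by simp))
  have h3 := norm_sub_le (α - pencilDiag u B i x) (β - pencilDiag u B i x)
  rw [sub_sub_sub_cancel_right] at h3
  rw [norm_pow]
  nlinarith [norm_nonneg (α - β), H.ρ_pos]

theorem norm_isoRoot_sub_lt {i j : Fin n} (hij : i ≠ j) {z : ℂ} (hi : Isolated u B ρ i z)
    (hj : Isolated u B ρ j z) :
    ‖isoRoot u B ρ i z - isoRoot u B ρ j z -
      ((u i : ℂ) - u j) * (z - (pencilCross u B i j : ℝ))‖ < 2 * ρ := by
  rw [← H.pencilDiag_sub hij]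
  have h1 := (isoRoot_mem H.ρ_pos H.off hi).2
  have h2 := (isoRoot_mem H.ρ_pos H.off hj).2
  have := norm_sub_le (isoRoot u B ρ i z - pencilDiag u B i z)
    (isoRoot u B ρ j z - pencilDiag u B j z)
  rw [show isoRoot u B ρ i z - isoRoot u B ρ j z - (pencilDiag u B i z - pencilDiag u B j z) =
    isoRoot u B ρ i z - pencilDiag u B i z - (isoRoot u B ρ j z - pencilDiag u B j z) by ring]
  linarith

theorem norm_sub_lt_of_pairDisc_eq_zero {i j : Fin n} (hij : i ≠ j) {z : ℂ}
    (hz : ‖z - (pencilCross u B i j : ℝ)‖ < 3 * R) (h0 : pairDisc u B ρ i j z = 0) :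
    ‖z - (pencilCross u B i j : ℝ)‖ < R / 100 := by
  by_contra hcon
  have hall := H.isolated_all hij hz (not_lt.mp hcon)
  rw [(pairSum_pairDisc_eq_isoRoot H.ρ_pos H.off hij hall).2] at h0
  exact isoRoot_ne H.ρ_pos H.off hij (hall i) (hall j)
    (sub_eq_zero.mp (pow_eq_zero_iff two_ne_zero |>.mp h0))

/-- Otherwise the inverse of the discriminant would violate the maximum principle, as the
discriminant is smaller at the crossing than on a circle around it. -/
theorem exists_pairDisc_eq_zero {i j : Fin n} (hij : i ≠ j) :
    ∃ z : ℂ, ‖z - (pencilCross u B i j : ℝ)‖ < R / 100 ∧ pairDisc u B ρ i j z = 0 := by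
  set x : ℂ := ((pencilCross u B i j : ℝ) : ℂ) with hx
  by_contra hcon
  push Not at hcon
  have hR := H.R_pos
  have hne : ∀ z ∈ Metric.closedBall x (2 * R), pairDisc u B ρ i j z ≠ 0 := by
    intro z hz h0
    rw [mem_closedBall_iff_norm] at hz
    exact hcon z (H.norm_sub_lt_of_pairDisc_eq_zero hij (by linarith) h0) h0
  have han : ∀ z ∈ Metric.closedBall x (2 * R), AnalyticAt ℂ (pairDisc u B ρ i j) z := by
    intro z hz
    rw [mem_closedBall_iff_norm] at hz
    exact pairDisc_analyticAt H.ρ_pos H.off (H.pairIsolated hij (by linarith))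
  have hd : DiffContOnCl ℂ (fun z => (pairDisc u B ρ i j z)⁻¹) (Metric.ball x (2 * R)) := by
    refine DifferentiableOn.diffContOnCl fun z hz => ?_
    rw [closure_ball _ (by positivity)] at hz
    exact ((han z hz).differentiableAt.inv (hne z hz)).differentiableWithinAt
  have hρ := H.ρ_pos
  have hmax := Complex.norm_le_of_forall_mem_frontier_norm_le (C := (4 * ρ ^ 2)⁻¹)
    Metric.isBounded_ball hd (fun z hz => by
      rw [frontier_ball _ (by positivity), mem_sphere_iff_norm] at hz
      have hall := H.isolated_all hij (z := z) (by linarith) (by linarith)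
      rw [(pairSum_pairDisc_eq_isoRoot H.ρ_pos H.off hij hall).2, norm_inv, norm_pow]
      have h1 := H.norm_isoRoot_sub_lt hij (hall i) (hall j)
      have h2 := norm_sub_norm_le (((u i : ℂ) - u j) * (z - x))
        (((u i : ℂ) - u j) * (z - x) - (isoRoot u B ρ i z - isoRoot u B ρ j z))
      rw [sub_sub_cancel, norm_mul, hz, norm_sub_rev (((u i : ℂ) - u j) * (z - x))] at h2
      have h3 := H.norm_gap hij
      have h4 : 2 * ρ ≤ ‖isoRoot u B ρ i z - isoRoot u B ρ j z‖ := by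
        nlinarith
      exact inv_anti₀ (by positivity) (by nlinarith)) (z := x)
    (subset_closure (Metric.mem_ball_self (by positivity)))
  rw [norm_inv] at hmax
  have h5 := H.norm_pairDisc_cross_lt hij
  have h6 : 0 < ‖pairDisc u B ρ i j x‖ :=
    norm_pos_iff.mpr (hne x (Metric.mem_closedBall_self (by positivity)))
  exact absurd ((inv_le_inv₀ h6 (by positivity)).mp hmax) (not_le.mpr h5)

end NearDiagonal

end

section

variable {n : ℕ} {u : Fin n → ℝ} {B : Matrix (Fin n) (Fin n) ℂ} {R ρ ε : ℝ}

/-- The branch points near the crossing of `i` and `j` are `c ± ih`: the discriminant of the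
corresponding two eigenvalues is `((z - c)² + h²) g` with `g` holomorphic and close to the constant
`(u_i - u_j)²` it has for a diagonal pencil. -/
structure IsCut (u : Fin n → ℝ) (B : Matrix (Fin n) (Fin n) ℂ) (R ρ : ℝ) (i j : Fin n)
    (c h : ℝ) : Prop where
  h_pos : 0 < h
  near : ‖(⟨c, h⟩ : ℂ) - (pencilCross u B i j : ℝ)‖ < R / 100
  fac : ∃ g : ℂ → ℂ, DifferentiableOn ℂ g (Metric.ball (pencilCross u B i j : ℝ) (3 * R)) ∧
    (∀ z ∈ Metric.ball ((pencilCross u B i j : ℝ) : ℂ) (3 * R),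
      pairDisc u B ρ i j z = ((z - c) ^ 2 + (h : ℂ) ^ 2) * g z) ∧
    ∀ z ∈ Metric.closedBall ((pencilCross u B i j : ℝ) : ℂ) (2 * R),
      ‖g z / ((u i : ℂ) - u j) ^ 2 - 1‖ ≤ 1 / 10

namespace NearDiagonal

variable (H : NearDiagonal u B R ρ ε)
include H

/-- The two conjugate zeros of the discriminant are split off; the quotient is estimated on a
circle around them, and then inside it by the maximum principle. -/
theorem exists_isCut {i j : Fin n} (hij : i ≠ j) : ∃ c h : ℝ, IsCut u B R ρ i j c h := by
  have hR := H.R_pos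
  set x : ℂ := ((pencilCross u B i j : ℝ) : ℂ) with hx
  have hconj : ∀ z : ℂ, ‖z - x‖ < 3 * R → pairDisc u B ρ i j z = 0 →
      pairDisc u B ρ i j ((starRingEnd ℂ) z) = 0 := fun z hz h0 => by
    rw [pairDisc_conj H.herm H.ρ_pos H.off (H.pairIsolated hij hz), h0, map_zero]
  have hconjx : ∀ z : ℂ, ‖(starRingEnd ℂ) z - x‖ = ‖z - x‖ := fun z => by
    rw [← norm_conj (z - x), map_sub, hx, conj_ofReal]
  obtain ⟨p, hpn, hp0, hpim⟩ : ∃ p : ℂ, ‖p - x‖ < R / 100 ∧ pairDisc u B ρ i j p = 0 ∧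
      0 < p.im := by
    obtain ⟨p, hpn, hp0⟩ := H.exists_pairDisc_eq_zero hij
    rcases lt_trichotomy p.im 0 with h | h | h
    · exact ⟨(starRingEnd ℂ) p, by rw [hconjx]; exact hpn, hconj p (by linarith) hp0,
        by simpa using h⟩
    · exfalso
      have hpr : p = ((p.re : ℝ) : ℂ) := by apply Complex.ext <;> simp [h]
      rw [hpr] at hp0 hpn
      exact H.pairDisc_ofReal_ne_zero hij (by linarith) hp0
    · exact ⟨p, hpn, hp0, h⟩
  set U := Metric.ball x (3 * R) with hU
  have hUo : IsOpen U := Metric.isOpen_ball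
  have hpU : p ∈ U := mem_ball_iff_norm.mpr (by linarith)
  set q := (starRingEnd ℂ) p with hq
  have hqU : q ∈ U := mem_ball_iff_norm.mpr (by rw [hq, hconjx]; linarith)
  have hqp : q ≠ p := fun h => by
    have := congrArg im h
    rw [hq, conj_im] at this
    linarith
  have hD : DifferentiableOn ℂ (pairDisc u B ρ i j) U := fun z hz =>
    (pairDisc_analyticAt H.ρ_pos H.off (H.pairIsolated hij
      (mem_ball_iff_norm.mp hz))).differentiableAt.differentiableWithinAt
  set g₁ := dslope (pairDisc u B ρ i j) p with hg₁
  have hg₁d : DifferentiableOn ℂ g₁ U := (differentiableOn_dslope (hUo.mem_nhds hpU)).mpr hD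
  have hfac₁ : ∀ z, pairDisc u B ρ i j z = (z - p) * g₁ z := fun z => by
    have := sub_smul_dslope (pairDisc u B ρ i j) p z
    rw [hp0, sub_zero, smul_eq_mul] at this
    exact this.symm
  have hg₁q : g₁ q = 0 := by
    have h1 := hfac₁ q
    rw [hq, hconj p (by linarith) hp0] at h1
    exact (mul_eq_zero.mp h1.symm).resolve_left (_root_.sub_ne_zero.mpr hqp)
  set g := dslope g₁ q with hg
  have hgd : DifferentiableOn ℂ g U := (differentiableOn_dslope (hUo.mem_nhds hqU)).mpr hg₁d
  have hfac : ∀ z, pairDisc u B ρ i j z = (z - p) * (z - q) * g z := fun z => by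
    have := sub_smul_dslope g₁ q z
    rw [hg₁q, sub_zero, smul_eq_mul] at this
    rw [hfac₁ z, ← this, mul_assoc]
  have hquad : ∀ z : ℂ, (z - p) * (z - q) = (z - p.re) ^ 2 + (p.im : ℂ) ^ 2 := fun z => by
    have hp' : p = p.re + p.im * I := (re_add_im p).symm
    have hq' : q = p.re - p.im * I := by
      rw [hq]; apply Complex.ext <;> simp
    linear_combination (-(z - q)) * hp' - (z - (p.re + p.im * I)) * hq' - (p.im : ℂ) ^ 2 * I_sq
  set κ := (u i : ℂ) - u j with hκ
  have hκ0 : κ ≠ 0 := H.sub_ne_zero hij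
  have hgap : 200 * ρ < R * ‖κ‖ := H.norm_gap hij
  refine ⟨p.re, p.im, hpim, hpn, g, hgd, fun z _ => by rw [hfac z, hquad z], ?_⟩
  have hdc : DiffContOnCl ℂ (fun z => g z / κ ^ 2 - 1) (Metric.ball x (2 * R)) := by
    refine DifferentiableOn.diffContOnCl ?_
    rw [closure_ball _ (by positivity)]
    exact ((hgd.mono (Metric.closedBall_subset_ball (by linarith))).div_const _).sub_const _
  intro z hz
  rw [← closure_ball _ (by positivity : (2 * R) ≠ 0)] at hz
  refine Complex.norm_le_of_forall_mem_frontier_norm_le Metric.isBounded_ball hdc ?_ hz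
  intro w hw
  rw [frontier_ball _ (by positivity), mem_sphere_iff_norm] at hw
  have hw0 : w - x ≠ 0 := norm_pos_iff.mp (by rw [hw]; positivity)
  have hall := H.isolated_all hij (z := w) (by linarith) (by linarith)
  have hδ := H.norm_isoRoot_sub_lt hij (hall i) (hall j)
  set δ := isoRoot u B ρ i w - isoRoot u B ρ j w with hδ'
  have hδ2 : pairDisc u B ρ i j w = δ ^ 2 :=
    (pairSum_pairDisc_eq_isoRoot H.ρ_pos H.off hij hall).2
  -- relative errors with respect to the diagonal pencil
  set θ := δ / (κ * (w - x)) - 1 with hθ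
  set a := (p - x) / (w - x) with ha
  set b := (q - x) / (w - x) with hb
  have hθn : ‖θ‖ ≤ 1 / 200 := by
    rw [hθ, div_sub_one (mul_ne_zero hκ0 hw0), norm_div, norm_mul, hw,
      div_le_iff₀ (by have := norm_pos_iff.mpr hκ0; positivity)]
    linarith
  have han : ‖a‖ ≤ 1 / 200 := by
    rw [ha, norm_div, hw, div_le_iff₀ (by positivity)]
    linarith
  have hbn : ‖b‖ ≤ 1 / 200 := by
    rw [hb, norm_div, hw, div_le_iff₀ (by positivity), hq, hconjx]
    linarith
  have ha1 : 199 / 200 ≤ ‖1 - a‖ := by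
    have := norm_sub_norm_le (1 : ℂ) a
    rw [norm_one] at this; linarith
  have hb1 : 199 / 200 ≤ ‖1 - b‖ := by
    have := norm_sub_norm_le (1 : ℂ) b
    rw [norm_one] at this; linarith
  have ha0 : 1 - a ≠ 0 := norm_pos_iff.mp (by linarith)
  have hb0 : 1 - b ≠ 0 := norm_pos_iff.mp (by linarith)
  have hga : g w / κ ^ 2 = (1 + θ) ^ 2 / ((1 - a) * (1 - b)) := by
    have e1 : δ = κ * (w - x) * (1 + θ) := by
      rw [hθ]; field_simp; ring
    have e2 : w - p = (w - x) * (1 - a) := by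
      rw [ha]; field_simp; ring
    have e3 : w - q = (w - x) * (1 - b) := by
      rw [hb]; field_simp; ring
    have h1 := hfac w
    rw [hδ2, e1, e2, e3] at h1
    rw [div_eq_div_iff (pow_ne_zero 2 hκ0) (mul_ne_zero ha0 hb0)]
    have h2 : (w - x) ^ 2 ≠ 0 := pow_ne_zero 2 hw0
    refine mul_left_cancel₀ h2 ?_
    linear_combination -h1
  rw [hga, div_sub_one (mul_ne_zero ha0 hb0), norm_div, norm_mul,
    div_le_iff₀ (by have := norm_pos_iff.mpr ha0; have := norm_pos_iff.mpr hb0; positivity)]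
  have hnum : (1 + θ) ^ 2 - (1 - a) * (1 - b) = 2 * θ + θ * θ + a + b - a * b := by ring
  have hnn : ‖2 * θ + θ * θ + a + b - a * b‖ ≤
      2 * ‖θ‖ + ‖θ‖ * ‖θ‖ + ‖a‖ + ‖b‖ + ‖a‖ * ‖b‖ := by
    refine (norm_sub_le _ _).trans ?_
    rw [norm_mul a b]
    refine add_le_add_left ((norm_add_le _ _).trans (add_le_add_left ((norm_add_le _ _).trans
      (add_le_add_left ((norm_add_le _ _).trans ?_) _)) _)) _
    rw [norm_mul, norm_mul, RCLike.norm_ofNat]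
  rw [hnum]
  have h1 : ‖θ‖ * ‖θ‖ ≤ 1 / 200 * (1 / 200) :=
    mul_le_mul hθn hθn (norm_nonneg _) (by norm_num)
  have h2 : ‖a‖ * ‖b‖ ≤ 1 / 200 * (1 / 200) :=
    mul_le_mul han hbn (norm_nonneg _) (by norm_num)
  have h3 : 199 / 200 * (199 / 200) ≤ ‖1 - a‖ * ‖1 - b‖ :=
    mul_le_mul ha1 hb1 (by norm_num) (norm_nonneg _)
  linarith

end NearDiagonal

/-! ### The two sheets near a crossing -/

/-- The `i`-th of the two sheets near the crossing of `i` and `j`, cut along the vertical segment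
between the branch points `c ± ih`. -/
noncomputable def pairRoot (u : Fin n → ℝ) (B : Matrix (Fin n) (Fin n) ℂ) (ρ : ℝ) (i j : Fin n)
    (c h : ℝ) (z : ℂ) : ℂ :=
  (pairSum u B ρ i j z + ((u i : ℂ) - u j) * cutSqrt c h z *
    csqrt (pairDisc u B ρ i j z / ((z - c) ^ 2 + (h : ℂ) ^ 2) / ((u i : ℂ) - u j) ^ 2)) / 2

theorem NearDiagonal.pairRoot_add (H : NearDiagonal u B R ρ ε)
    {i j : Fin n} (hij : i ≠ j) (c h : ℝ) {z : ℂ} (hz : ‖z - (pencilCross u B i j : ℝ)‖ < 2 * R) :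
    pairRoot u B ρ i j c h z + pairRoot u B ρ j i c h z = pairSum u B ρ i j z := by
  have hR := H.R_pos
  rw [pairRoot, pairRoot, pairSum_comm ρ j i,
    pairDisc_comm H.ρ_pos H.off hij (H.pairIsolated hij (by linarith)), ← neg_sub (u i : ℂ), neg_sq]
  ring

theorem NearDiagonal.pairRoot_sub (H : NearDiagonal u B R ρ ε)
    {i j : Fin n} (hij : i ≠ j) (c h : ℝ) {z : ℂ} (hz : ‖z - (pencilCross u B i j : ℝ)‖ < 2 * R) :
    pairRoot u B ρ i j c h z - pairRoot u B ρ j i c h z =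
      ((u i : ℂ) - u j) * cutSqrt c h z * csqrt
        (pairDisc u B ρ i j z / ((z - c) ^ 2 + (h : ℂ) ^ 2) / ((u i : ℂ) - u j) ^ 2) := by
  have hR := H.R_pos
  rw [pairRoot, pairRoot, pairSum_comm ρ j i,
    ← pairDisc_comm H.ρ_pos H.off hij (H.pairIsolated hij (by linarith)), ← neg_sub (u i : ℂ),
    neg_sq]
  ring

namespace IsCut

variable {i j : Fin n} {c h : ℝ} (hc : IsCut u B R ρ i j c h)

section

include hc

theorem norm_sub_lt_of_mem_vSeg {z : ℂ} (hz : z ∈ vSeg c h) :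
    ‖z - (pencilCross u B i j : ℝ)‖ < R / 100 := by
  refine lt_of_le_of_lt ?_ hc.near
  rw [norm_def, norm_def]
  refine Real.sqrt_le_sqrt ?_
  obtain ⟨h1, h2⟩ := hz
  have := sq_le_sq' (abs_le.mp h2).1 (abs_le.mp h2).2
  simp only [normSq_apply, sub_re, sub_im, ofReal_re, ofReal_im, sub_zero, h1]
  nlinarith

theorem abs_c_sub_lt : |c - pencilCross u B i j| < R / 100 := by
  have := abs_re_le_norm ((⟨c, h⟩ : ℂ) - (pencilCross u B i j : ℝ))
  exact lt_of_le_of_lt (by simpa using this) hc.near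

theorem h_lt : h < R / 100 := by
  have := abs_im_le_norm ((⟨c, h⟩ : ℂ) - (pencilCross u B i j : ℝ))
  have h2 := hc.near
  simp only [sub_im, ofReal_im, sub_zero] at this
  linarith [le_abs_self h]

theorem sq_add_sq_ne_zero {z : ℂ} (hz : z ∉ vSeg c h) : (z - c) ^ 2 + (h : ℂ) ^ 2 ≠ 0 := by
  rw [← cutSqrt_sq hc.h_pos hz]
  exact pow_ne_zero 2 (mul_ne_zero (mem_slitPlane_of_notMem_vSeg hc.h_pos hz).1 (csqrt_ne_zero _))

variable (H : NearDiagonal u B R ρ ε)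

include H

theorem pairDisc_eq_zero_iff {z : ℂ} (hz : ‖z - (pencilCross u B i j : ℝ)‖ < 2 * R) :
    pairDisc u B ρ i j z = 0 ↔ (z - c) ^ 2 + (h : ℂ) ^ 2 = 0 := by
  have hR := H.R_pos
  obtain ⟨g, hg1, hg2, hg3⟩ := hc.fac
  rw [hg2 z (mem_ball_iff_norm.mpr (by linarith)), mul_eq_zero]
  refine or_iff_left fun h0 => ?_
  have := hg3 z (mem_closedBall_iff_norm.mpr hz.le)
  rw [h0, zero_div, zero_sub, norm_neg, norm_one] at this
  norm_num at this

theorem norm_ratio_sub_one_le {z : ℂ} (hz : ‖z - (pencilCross u B i j : ℝ)‖ < 2 * R)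
    (h0 : (z - c) ^ 2 + (h : ℂ) ^ 2 ≠ 0) :
    ‖pairDisc u B ρ i j z / ((z - c) ^ 2 + (h : ℂ) ^ 2) / ((u i : ℂ) - u j) ^ 2 - 1‖ ≤ 1 / 10 := by
  have hR := H.R_pos
  obtain ⟨g, hg1, hg2, hg3⟩ := hc.fac
  rw [hg2 z (mem_ball_iff_norm.mpr (by linarith)), mul_div_cancel_left₀ _ h0]
  exact hg3 z (mem_closedBall_iff_norm.mpr hz.le)

theorem ratio_mem_slitPlane {z : ℂ} (hz : ‖z - (pencilCross u B i j : ℝ)‖ < 2 * R)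
    (h0 : (z - c) ^ 2 + (h : ℂ) ^ 2 ≠ 0) :
    pairDisc u B ρ i j z / ((z - c) ^ 2 + (h : ℂ) ^ 2) / ((u i : ℂ) - u j) ^ 2 ∈ slitPlane := by
  have := mem_slitPlane_of_norm_lt_one
    ((hc.norm_ratio_sub_one_le H hz h0).trans_lt (by norm_num))
  simpa using this

end

variable (H : NearDiagonal u B R ρ ε) (hij : i ≠ j)

include H hij hc

theorem symm : IsCut u B R ρ j i c h := by
  obtain ⟨hh, hn, g, hg1, hg2, hg3⟩ := hc
  refine ⟨hh, by rwa [pencilCross_comm], g, by rwa [pencilCross_comm], fun z hz => ?_,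
    fun z hz => ?_⟩
  · rw [pencilCross_comm] at hz
    rw [← hg2 z hz, pairDisc_comm H.ρ_pos H.off hij (H.pairIsolated hij (mem_ball_iff_norm.mp hz))]
  · rw [pencilCross_comm] at hz
    rw [← neg_sub (u i : ℂ), neg_sq]
    exact hg3 z hz

theorem csqrt_ratio_analyticAt {z : ℂ} (hz : ‖z - (pencilCross u B i j : ℝ)‖ < 2 * R)
    (h0 : (z - c) ^ 2 + (h : ℂ) ^ 2 ≠ 0) :
    AnalyticAt ℂ (fun z => csqrt
      (pairDisc u B ρ i j z / ((z - c) ^ 2 + (h : ℂ) ^ 2) / ((u i : ℂ) - u j) ^ 2)) z := by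
  have hR := H.R_pos
  refine AnalyticAt.fun_comp (csqrt_analyticAt (hc.ratio_mem_slitPlane H hz h0)) ?_
  exact ((pairDisc_analyticAt H.ρ_pos H.off (H.pairIsolated hij (z := z) (by linarith))).div
    (by fun_prop) h0).div_const

theorem pairRoot_analyticAt {z : ℂ} (hz : ‖z - (pencilCross u B i j : ℝ)‖ < 2 * R)
    (hz' : z ∉ vSeg c h) : AnalyticAt ℂ (pairRoot u B ρ i j c h) z := by
  have hR := H.R_pos
  unfold pairRoot
  exact ((pairSum_analyticAt H.ρ_pos H.off (H.pairIsolated hij (z := z) (by linarith))).add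
    ((analyticAt_const.mul (cutSqrt_analyticAt hc.h_pos hz')).mul
      (hc.csqrt_ratio_analyticAt H hij hz (hc.sq_add_sq_ne_zero hz')))).div_const

theorem pairRoot_sub_sq {z : ℂ} (hz : ‖z - (pencilCross u B i j : ℝ)‖ < 2 * R)
    (hz' : z ∉ vSeg c h) :
    (pairRoot u B ρ i j c h z - pairRoot u B ρ j i c h z) ^ 2 = pairDisc u B ρ i j z := by
  have h0 := hc.sq_add_sq_ne_zero hz'
  have hκ := H.sub_ne_zero hij
  rw [H.pairRoot_sub hij c h hz, mul_pow, mul_pow, cutSqrt_sq hc.h_pos hz',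
    csqrt_sq (slitPlane_ne_zero (hc.ratio_mem_slitPlane H hz h0))]
  field_simp

theorem roots_pencil_eq {z : ℂ} (hz : ‖z - (pencilCross u B i j : ℝ)‖ < 2 * R)
    (hz' : z ∉ vSeg c h) :
    (pencil u B z).charpoly.roots =
      (({i, j} : Finset (Fin n))ᶜ.val.map fun k => isoRoot u B ρ k z) +
        {pairRoot u B ρ i j c h z, pairRoot u B ρ j i c h z} := by
  have hR := H.R_pos
  have hp := H.pairIsolated hij (z := z) (by linarith)
  obtain ⟨α, β, hαβ, -⟩ := exists_roots_pencil_eq H.ρ_pos H.off hij hp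
  obtain ⟨hs, hd⟩ := pairSum_pairDisc_eq H.ρ_pos H.off hp hαβ
  have h1 := H.pairRoot_add hij c h hz
  have h2 := hc.pairRoot_sub_sq H hij hz hz'
  rw [hs] at h1
  rw [hd] at h2
  rw [hαβ]
  congr 1
  rcases sq_eq_sq_iff_eq_or_eq_neg.mp h2 with h3 | h3
  · have e1 : pairRoot u B ρ i j c h z = α := by linear_combination (h1 + h3) / 2
    have e2 : pairRoot u B ρ j i c h z = β := by linear_combination (h1 - h3) / 2
    rw [e1, e2]
  · have e1 : pairRoot u B ρ i j c h z = β := by linear_combination (h1 + h3) / 2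
    have e2 : pairRoot u B ρ j i c h z = α := by linear_combination (h1 - h3) / 2
    rw [e1, e2, Multiset.pair_comm]

/-- At distance at least `R` from the crossing the local sheet is the isolated eigenvalue: the
squares of the differences agree, and both differences are close to `(u_i - u_j) (z - z_ij)`. -/
theorem pairRoot_eq_isoRoot {z : ℂ} (hz : ‖z - (pencilCross u B i j : ℝ)‖ < 2 * R)
    (hz' : R ≤ ‖z - (pencilCross u B i j : ℝ)‖) :
    pairRoot u B ρ i j c h z = isoRoot u B ρ i z := by
  have hR := H.R_pos
  set x : ℂ := ((pencilCross u B i j : ℝ) : ℂ) with hx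
  have hall := H.isolated_all hij (z := z) (by linarith) (by linarith)
  have hseg : z ∉ vSeg c h := fun hm => by
    have := hc.norm_sub_lt_of_mem_vSeg hm
    linarith
  obtain ⟨hs, hd⟩ := pairSum_pairDisc_eq_isoRoot H.ρ_pos H.off hij hall
  have h1 := H.pairRoot_add hij c h hz
  have h2 := hc.pairRoot_sub_sq H hij hz hseg
  rw [hs] at h1
  rw [hd] at h2
  rcases sq_eq_sq_iff_eq_or_eq_neg.mp h2 with h3 | h3
  · linear_combination (h1 + h3) / 2
  exfalso
  have hκ := H.sub_ne_zero hij
  have hδ := H.norm_isoRoot_sub_lt hij (hall i) (hall j)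
  have hgap := H.norm_gap hij
  set κ := (u i : ℂ) - u j with hκ'
  set δ := isoRoot u B ρ i z - isoRoot u B ρ j z with hδ'
  have hw0 : z - x ≠ 0 := norm_pos_iff.mp (by linarith)
  obtain ⟨hw, hsl⟩ := mem_slitPlane_of_notMem_vSeg hc.h_pos hseg
  have h0 := hc.sq_add_sq_ne_zero hseg
  rw [H.pairRoot_sub hij c h hz, ← hκ'] at h3
  set X := csqrt (1 + (h : ℂ) ^ 2 / (z - c) ^ 2) with hX
  set Y := (z - c) / (z - x) with hY
  set Z := csqrt (pairDisc u B ρ i j z / ((z - c) ^ 2 + (h : ℂ) ^ 2) / κ ^ 2) with hZ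
  set V := δ / (κ * (z - x)) with hV
  have hprod : X * Y * Z = -V := by
    have e : cutSqrt c h z = (z - c) * X := rfl
    rw [hV, ← neg_div, ← h3, e, hY]
    field_simp
  have hcx : ‖x - c‖ ≤ R / 100 := by
    rw [hx, ← ofReal_sub, norm_real, Real.norm_eq_abs, abs_sub_comm]
    exact (hc.abs_c_sub_lt).le
  have hzc : 99 / 100 * R ≤ ‖z - c‖ := by
    have := norm_sub_le (z - c) (x - c)
    rw [sub_sub_sub_cancel_right] at this
    linarith
  have hX1 : ‖X - 1‖ ≤ 1 / 100 := by
    refine (norm_sub_one_le_of_re_pos (csqrt_re_pos hsl).le).trans ?_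
    rw [csqrt_sq (slitPlane_ne_zero hsl), add_sub_cancel_left, norm_div, norm_pow, norm_pow,
      div_le_iff₀ (by have := norm_pos_iff.mpr hw; positivity), norm_real, Real.norm_eq_abs,
      sq_abs]
    have e1 := hc.h_lt
    have e2 := hc.h_pos
    have e3 : h ^ 2 ≤ (R / 100) ^ 2 := by gcongr
    have e4 : (99 / 100 * R) ^ 2 ≤ ‖z - c‖ ^ 2 := by gcongr
    nlinarith
  have hY1 : ‖Y - 1‖ ≤ 1 / 100 := by
    rw [hY, div_sub_one hw0, norm_div, sub_sub_sub_cancel_left,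
      div_le_iff₀ (norm_pos_iff.mpr hw0)]
    linarith
  have hZ1 : ‖Z - 1‖ ≤ 1 / 10 := by
    have hr := hc.ratio_mem_slitPlane H hz h0
    refine (norm_sub_one_le_of_re_pos (csqrt_re_pos hr).le).trans ?_
    rw [csqrt_sq (slitPlane_ne_zero hr)]
    exact hc.norm_ratio_sub_one_le H hz h0
  have hV1 : ‖V - 1‖ ≤ 1 / 100 := by
    rw [hV, div_sub_one (mul_ne_zero hκ hw0), norm_div, norm_mul,
      div_le_iff₀ (by have := norm_pos_iff.mpr hκ; have := norm_pos_iff.mpr hw0; positivity)]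
    have := mul_le_mul_of_nonneg_left hz' (norm_nonneg κ)
    linarith
  have hY2 : ‖Y‖ ≤ 101 / 100 := by
    have := norm_add_le (Y - 1) 1
    rw [sub_add_cancel, norm_one] at this
    linarith
  have hZ2 : ‖Z‖ ≤ 11 / 10 := by
    have := norm_add_le (Z - 1) 1
    rw [sub_add_cancel, norm_one] at this
    linarith
  clear_value X Y Z V
  have hsum : (2 : ℂ) = -(V - 1) - ((X - 1) * (Y * Z) + (Y - 1) * Z + (Z - 1)) := by
    linear_combination hprod
  have e1 : ‖(X - 1) * (Y * Z)‖ ≤ 1 / 100 * (101 / 100 * (11 / 10)) := by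
    rw [norm_mul, norm_mul]
    gcongr
  have e2 : ‖(Y - 1) * Z‖ ≤ 1 / 100 * (11 / 10) := by
    rw [norm_mul]
    gcongr
  have e3 := norm_sub_le (-(V - 1)) ((X - 1) * (Y * Z) + (Y - 1) * Z + (Z - 1))
  have e4 := norm_add₃_le (a := (X - 1) * (Y * Z)) (b := (Y - 1) * Z) (c := Z - 1)
  rw [← hsum, norm_neg, RCLike.norm_ofNat] at e3
  linarith

theorem pairRoot_conj {z : ℂ} (hz : ‖z - (pencilCross u B i j : ℝ)‖ < 2 * R)
    (hz' : z ∉ vSeg c h) :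
    pairRoot u B ρ i j c h ((starRingEnd ℂ) z) = (starRingEnd ℂ) (pairRoot u B ρ i j c h z) := by
  have hR := H.R_pos
  have hp := H.pairIsolated hij (z := z) (by linarith)
  have hr := hc.ratio_mem_slitPlane H hz (hc.sq_add_sq_ne_zero hz')
  rw [pairRoot, pairRoot, pairSum_conj H.herm H.ρ_pos H.off hp,
    pairDisc_conj H.herm H.ρ_pos H.off hp, cutSqrt_conj hc.h_pos hz', map_div₀, map_add, map_mul,
    map_mul, ← csqrt_conj hr, map_ofNat]
  simp

/-- Across the cut the factor `cutSqrt` changes its sign, so that the two local sheets are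
continued into each other. -/
theorem exchangedAcross_pairRoot {p : ℂ} (hp1 : p.re = c) (hp2 : |p.im| < h) :
    ∃ F G : ℂ → ℂ, AnalyticAt ℂ F p ∧ AnalyticAt ℂ G p ∧ ∀ᶠ z in 𝓝 p,
      (z.re < p.re → F z = pairRoot u B ρ i j c h z ∧ G z = pairRoot u B ρ j i c h z) ∧
      (p.re < z.re → F z = pairRoot u B ρ j i c h z ∧ G z = pairRoot u B ρ i j c h z) := by
  have hR := H.R_pos
  have hnear : ‖p - (pencilCross u B i j : ℝ)‖ < 2 * R := by
    have := hc.norm_sub_lt_of_mem_vSeg (z := p) ⟨hp1, hp2.le⟩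
    linarith
  have hsp := sq_add_sq_mem_slitPlane (c := c) (Or.inr hp2)
  have hq : AnalyticAt ℂ (fun z : ℂ => csqrt ((z - c) ^ 2 + (h : ℂ) ^ 2)) p :=
    AnalyticAt.fun_comp (g := csqrt) (csqrt_analyticAt hsp) (by fun_prop)
  have hd := (analyticAt_const (v := (u i : ℂ) - u j)).mul hq |>.mul
    (hc.csqrt_ratio_analyticAt H hij hnear (slitPlane_ne_zero hsp))
  have hs := pairSum_analyticAt H.ρ_pos H.off (H.pairIsolated hij (z := p) (by linarith))
  refine ⟨_, _, (hs.sub hd).div_const (c := 2), (hs.add hd).div_const (c := 2), ?_⟩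
  have hopen : ∀ᶠ z : ℂ in 𝓝 p, ‖z - (pencilCross u B i j : ℝ)‖ < 2 * R :=
    (isOpen_lt (by fun_prop) continuous_const).mem_nhds hnear
  filter_upwards [hopen] with z hz
  have h1 := H.pairRoot_add hij c h hz
  have h2 := H.pairRoot_sub hij c h hz
  simp only [Pi.sub_apply, Pi.add_apply, Pi.mul_apply]
  constructor
  · intro hlt
    rw [(cutSqrt_eq hc.h_pos z).2 (hp1 ▸ hlt)] at h2
    constructor
    · linear_combination (-h1 - h2) / 2
    · linear_combination (-h1 + h2) / 2
  · intro hlt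
    rw [(cutSqrt_eq hc.h_pos z).1 (hp1 ▸ hlt)] at h2
    constructor
    · linear_combination (-h1 + h2) / 2
    · linear_combination (-h1 - h2) / 2

end IsCut

end

section

variable {n : ℕ} {u : Fin n → ℝ} {B : Matrix (Fin n) (Fin n) ℂ} {R ρ ε : ℝ}

/-! ### The sheets on the cut plane -/

/-- Branch points `c_ij ± i h_ij` near all the crossings. -/
structure IsCutSystem (u : Fin n → ℝ) (B : Matrix (Fin n) (Fin n) ℂ) (R ρ : ℝ)
    (c h : Fin n → Fin n → ℝ) : Prop where
  c_comm : ∀ i j, c i j = c j i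
  h_comm : ∀ i j, h i j = h j i
  isCut : ∀ i j, i ≠ j → IsCut u B R ρ i j (c i j) (h i j)

theorem NearDiagonal.exists_isCutSystem (H : NearDiagonal u B R ρ ε) :
    ∃ c h : Fin n → Fin n → ℝ, IsCutSystem u B R ρ c h := by
  have : ∀ i j : Fin n, ∃ q : ℝ × ℝ, i < j → IsCut u B R ρ i j q.1 q.2 := fun i j => by
    by_cases hij : i < j
    · obtain ⟨c, h, hc⟩ := H.exists_isCut hij.ne
      exact ⟨(c, h), fun _ => hc⟩
    · exact ⟨(0, 0), fun h => absurd h hij⟩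
  choose q hq using this
  refine ⟨fun i j => (q (min i j) (max i j)).1, fun i j => (q (min i j) (max i j)).2,
    fun i j => by simp only [min_comm, max_comm], fun i j => by simp only [min_comm, max_comm],
    fun i j hij => ?_⟩
  rcases lt_or_gt_of_ne hij with h | h
  · simp only [min_eq_left h.le, max_eq_right h.le]
    exact hq i j h
  · simp only [min_eq_right h.le, max_eq_left h.le]
    exact (hq j i h).symm H h.ne

open scoped Classical in
/-- The `i`-th eigenvalue of the pencil on the cut plane: the local sheet near the crossings of `i`,
and the isolated eigenvalue elsewhere. -/
noncomputable def sheet (u : Fin n → ℝ) (B : Matrix (Fin n) (Fin n) ℂ) (R ρ : ℝ)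
    (c h : Fin n → Fin n → ℝ) (i : Fin n) (z : ℂ) : ℂ :=
  if hx : ∃ j, j ≠ i ∧ ‖z - (pencilCross u B i j : ℝ)‖ < R then
    pairRoot u B ρ i (Classical.choose hx) (c i (Classical.choose hx)) (h i (Classical.choose hx)) z
  else isoRoot u B ρ i z

theorem sheet_eq_isoRoot {c h : Fin n → Fin n → ℝ} {i : Fin n} {z : ℂ}
    (hz : ∀ j, j ≠ i → R ≤ ‖z - (pencilCross u B i j : ℝ)‖) :
    sheet u B R ρ c h i z = isoRoot u B ρ i z := by
  rw [sheet, dif_neg]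
  rintro ⟨j, hj, hlt⟩
  exact absurd hlt (not_lt.mpr (hz j hj))

/-- On the ball of radius `3R` around the crossing of `i` and `j` the other sheets are isolated. -/
theorem NearDiagonal.sheet_eq_isoRoot_of_near (H : NearDiagonal u B R ρ ε)
    {c h : Fin n → Fin n → ℝ} {i j : Fin n} (hij : i ≠ j) {z : ℂ}
    (hz : ‖z - (pencilCross u B i j : ℝ)‖ < 3 * R) {k : Fin n} (hki : k ≠ i) (hkj : k ≠ j) :
    sheet u B R ρ c h k z = isoRoot u B ρ k z :=
  sheet_eq_isoRoot fun _ hl =>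
    (H.far_of_near hij hl.symm (fun e => hki e.1.symm) (fun e => hkj e.2.symm) hz).le

theorem NearDiagonal.tendsto_sheet_div (H : NearDiagonal u B R ρ ε)
    (c h : Fin n → Fin n → ℝ) (i : Fin n) :
    Tendsto (fun z => sheet u B R ρ c h i z / z) (Bornology.cobounded ℂ) (𝓝 (u i : ℂ)) := by
  have hR := H.R_pos
  have hfar : ∀ᶠ z : ℂ in Bornology.cobounded ℂ,
      ∀ j, j ≠ i → R ≤ ‖z - (pencilCross u B i j : ℝ)‖ := by
    refine eventually_all.mpr fun j => ?_
    filter_upwards [(tendsto_norm_cobounded_atTop (E := ℂ)).eventually_ge_atTop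
      (R + ‖((pencilCross u B i j : ℝ) : ℂ)‖)] with z hz _
    have := norm_sub_norm_le z ((pencilCross u B i j : ℝ) : ℂ)
    linarith
  have hlim : Tendsto (fun z : ℂ => (ρ + ‖B i i‖) * ‖z‖⁻¹) (Bornology.cobounded ℂ) (𝓝 0) := by
    have := (tendsto_inv_atTop_zero.comp (tendsto_norm_cobounded_atTop (E := ℂ))).const_mul
      (ρ + ‖B i i‖)
    simpa using this
  refine tendsto_iff_norm_sub_tendsto_zero.mpr (squeeze_zero' (Eventually.of_forall fun z =>
    norm_nonneg _) ?_ hlim)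
  filter_upwards [hfar, (tendsto_norm_cobounded_atTop (E := ℂ)).eventually_gt_atTop 0] with z hz h0
  have hz0 : z ≠ 0 := norm_pos_iff.mp h0
  have hi := (isoRoot_mem H.ρ_pos H.off (H.isolated_of_far (i := i) (z := z)
    fun j hj => by linarith [hz j hj])).2
  rw [sheet_eq_isoRoot hz, div_sub' hz0, norm_div, div_eq_mul_inv]
  refine mul_le_mul_of_nonneg_right ?_ (by positivity)
  have := norm_add_le (isoRoot u B ρ i z - pencilDiag u B i z) (B i i)
  rw [show isoRoot u B ρ i z - pencilDiag u B i z + B i i = isoRoot u B ρ i z - z * u i by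
    rw [pencilDiag]; ring] at this
  linarith

namespace IsCutSystem

variable {c h : Fin n → Fin n → ℝ} (C : IsCutSystem u B R ρ c h) (H : NearDiagonal u B R ρ ε)
include C H

theorem sheet_eq_pairRoot {i j : Fin n} (hij : i ≠ j) {z : ℂ}
    (hz : ‖z - (pencilCross u B i j : ℝ)‖ < 2 * R) :
    sheet u B R ρ c h i z = pairRoot u B ρ i j (c i j) (h i j) z := by
  have hR := H.R_pos
  by_cases hx : ∃ j, j ≠ i ∧ ‖z - (pencilCross u B i j : ℝ)‖ < R
  · rw [sheet, dif_pos hx]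
    have hs := Classical.choose_spec hx
    have : Classical.choose hx = j := by
      by_contra hne
      have := H.far_of_near hij (Ne.symm hs.1) (fun e => hne e.2.symm) (fun e => hij e.2.symm)
        (z := z) (by linarith)
      linarith [hs.2]
    rw [this]
  · rw [sheet, dif_neg hx, (C.isCut i j hij).pairRoot_eq_isoRoot H hij hz]
    by_contra hlt
    exact hx ⟨j, hij.symm, not_le.mp hlt⟩

theorem sheet_analyticAt {i : Fin n} {z : ℂ} (hz : ∀ j, j ≠ i → z ∉ vSeg (c i j) (h i j)) :
    AnalyticAt ℂ (sheet u B R ρ c h i) z := by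
  have hR := H.R_pos
  have hcont : ∀ j, Continuous fun w : ℂ => ‖w - (pencilCross u B i j : ℝ)‖ := fun j => by fun_prop
  by_cases hx : ∃ j, j ≠ i ∧ ‖z - (pencilCross u B i j : ℝ)‖ < 2 * R
  · obtain ⟨j, hj, hlt⟩ := hx
    refine ((C.isCut i j hj.symm).pairRoot_analyticAt H hj.symm hlt (hz j hj)).congr ?_
    filter_upwards [(isOpen_lt (hcont j) continuous_const).mem_nhds hlt] with w hw
    exact (C.sheet_eq_pairRoot H hj.symm hw).symm
  · push Not at hx
    refine (isoRoot_analyticAt (i := i) H.ρ_pos H.off (H.isolated_of_far fun j hj => ?_)).congr ?_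
    · linarith [hx j hj]
    · have : ∀ᶠ w : ℂ in 𝓝 z, ∀ j, j ≠ i → R < ‖w - (pencilCross u B i j : ℝ)‖ := by
        refine eventually_all.mpr fun j => ?_
        by_cases hj : j = i
        · exact Eventually.of_forall fun w h => absurd hj h
        · filter_upwards [(isOpen_lt continuous_const (hcont j)).mem_nhds
            (show R < _ by linarith [hx j hj])] with w hw _
          exact hw
      filter_upwards [this] with w hw
      exact (sheet_eq_isoRoot fun j hj => (hw j hj).le).symm

theorem roots_pencil_eq_sheet {z : ℂ} (hz : ∀ i j, j ≠ i → z ∉ vSeg (c i j) (h i j)) :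
    (pencil u B z).charpoly.roots = Finset.univ.val.map fun k => sheet u B R ρ c h k z := by
  have hR := H.R_pos
  by_cases hx : ∃ i j, i ≠ j ∧ ‖z - (pencilCross u B i j : ℝ)‖ < 2 * R
  · obtain ⟨i, j, hij, hlt⟩ := hx
    have hlt' := hlt
    rw [pencilCross_comm] at hlt'
    rw [(C.isCut i j hij).roots_pencil_eq H hij hlt (hz i j hij.symm)]
    have h1 : (Finset.univ : Finset (Fin n)).val =
        ({i, j} : Finset (Fin n))ᶜ.val + ({i, j} : Finset (Fin n)).val := by
      rw [← Finset.disjUnion_val _ _ disjoint_compl_left, Finset.disjUnion_eq_union,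
        Finset.union_comm, Finset.union_compl]
    have h2 : ({i, j} : Finset (Fin n)).val = {i, j} :=
      Finset.insert_val_of_notMem (by simpa using hij)
    have h3 : Multiset.map (fun k => sheet u B R ρ c h k z) ({i, j} : Multiset (Fin n)) =
        {pairRoot u B ρ i j (c i j) (h i j) z, pairRoot u B ρ j i (c i j) (h i j) z} := by
      rw [← C.sheet_eq_pairRoot H hij hlt, C.c_comm, C.h_comm,
        ← C.sheet_eq_pairRoot H hij.symm hlt']
      simp
    rw [h1, h2, Multiset.map_add, h3]
    congr 1
    refine Multiset.map_congr rfl fun k hk => ?_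
    rw [Finset.mem_val] at hk
    simp only [Finset.mem_compl, Finset.mem_insert, Finset.mem_singleton, not_or] at hk
    exact (H.sheet_eq_isoRoot_of_near hij (by linarith) hk.1 hk.2).symm
  · push Not at hx
    rw [roots_pencil_eq_of_forall_isolated H.ρ_pos H.off fun k =>
      H.isolated_of_far fun l hl => by linarith [hx k l hl.symm]]
    refine Multiset.map_congr rfl fun k _ => ?_
    exact (sheet_eq_isoRoot fun l hl => by linarith [hx k l hl.symm]).symm

theorem sheet_conj {i : Fin n} {z : ℂ} (hz : ∀ j, j ≠ i → z ∉ vSeg (c i j) (h i j)) :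
    sheet u B R ρ c h i ((starRingEnd ℂ) z) = (starRingEnd ℂ) (sheet u B R ρ c h i z) := by
  have hR := H.R_pos
  have hconj : ∀ j, ‖(starRingEnd ℂ) z - (pencilCross u B i j : ℝ)‖ =
      ‖z - (pencilCross u B i j : ℝ)‖ := fun j => by
    rw [← norm_conj (z - _), map_sub, conj_ofReal]
  by_cases hx : ∃ j, j ≠ i ∧ ‖z - (pencilCross u B i j : ℝ)‖ < 2 * R
  · obtain ⟨j, hj, hlt⟩ := hx
    rw [C.sheet_eq_pairRoot H hj.symm hlt,
      C.sheet_eq_pairRoot H hj.symm ((hconj j).trans_lt hlt)]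
    exact (C.isCut i j hj.symm).pairRoot_conj H hj.symm hlt (hz j hj)
  · push Not at hx
    rw [sheet_eq_isoRoot (z := z) fun j hj => by linarith [hx j hj],
      sheet_eq_isoRoot (z := (starRingEnd ℂ) z) fun j hj => by rw [hconj]; linarith [hx j hj]]
    exact isoRoot_conj H.herm H.ρ_pos H.off
      (H.isolated_of_far fun j hj => by linarith [hx j hj])

end IsCutSystem

/-! ### Multiplicities of the eigenvalues -/

namespace NearDiagonal

variable (H : NearDiagonal u B R ρ ε)
include H

theorem nodup_and_notMem_map_isoRoot {i j : Fin n} {z : ℂ} (hp : PairIsolated u B ρ i j z) :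
    (({i, j} : Finset (Fin n))ᶜ.val.map fun k => isoRoot u B ρ k z).Nodup ∧
    ∀ a, (∀ k, k ≠ i → k ≠ j → ρ ≤ ‖a - pencilDiag u B k z‖) →
      a ∉ (({i, j} : Finset (Fin n))ᶜ.val.map fun k => isoRoot u B ρ k z) := by
  have hs : ∀ k ∈ ({i, j} : Finset (Fin n))ᶜ, Isolated u B ρ k z := fun k hk => by
    simp only [Finset.mem_compl, Finset.mem_insert, Finset.mem_singleton, not_or] at hk
    exact hp k hk.1 hk.2
  constructor
  · refine Multiset.Nodup.map_on (fun k hk l hl he => ?_) (Finset.nodup _)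
    by_contra hkl
    exact isoRoot_ne H.ρ_pos H.off hkl (hs k hk) (hs l hl) he
  · intro a ha hmem
    obtain ⟨k, hk, rfl⟩ := Multiset.mem_map.mp hmem
    have h1 := (isoRoot_mem H.ρ_pos H.off (hs k hk)).2
    rw [Finset.mem_val] at hk
    simp only [Finset.mem_compl, Finset.mem_insert, Finset.mem_singleton, not_or] at hk
    exact absurd h1 (not_lt.mpr (ha k hk.1 hk.2))

theorem nodup_roots_of_pairDisc_ne_zero {i j : Fin n} (hij : i ≠ j) {z : ℂ}
    (hp : PairIsolated u B ρ i j z) (h0 : pairDisc u B ρ i j z ≠ 0) :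
    (pencil u B z).charpoly.roots.Nodup := by
  obtain ⟨α, β, hαβ, hfar⟩ := exists_roots_pencil_eq H.ρ_pos H.off hij hp
  rw [(pairSum_pairDisc_eq H.ρ_pos H.off hp hαβ).2] at h0
  obtain ⟨h1, h2⟩ := H.nodup_and_notMem_map_isoRoot hp
  have hne : α ≠ β := fun h => h0 (by rw [h, sub_self]; simp)
  rw [hαβ, Multiset.nodup_add]
  refine ⟨h1, by simpa using hne, Multiset.disjoint_left.mpr fun {a} ha hm => ?_⟩
  simp only [Multiset.insert_eq_cons, Multiset.mem_cons, Multiset.mem_singleton] at hm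
  rcases hm with rfl | rfl
  · exact h2 a (fun k hki hkj => (hfar k hki hkj).1) ha
  · exact h2 a (fun k hki hkj => (hfar k hki hkj).2) ha

theorem count_roots_of_pairDisc_eq_zero {i j : Fin n} (hij : i ≠ j) {z : ℂ}
    (hp : PairIsolated u B ρ i j z) (h0 : pairDisc u B ρ i j z = 0) :
    (pencil u B z).charpoly.roots.count (pairSum u B ρ i j z / 2) = 2 ∧
      (∀ a, a ≠ pairSum u B ρ i j z / 2 → (pencil u B z).charpoly.roots.count a ≤ 1) ∧
      ∏ k ∈ ({i, j} : Finset (Fin n))ᶜ, (pairSum u B ρ i j z / 2 - isoRoot u B ρ k z) ≠ 0 := by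
  obtain ⟨α, β, hαβ, hfar⟩ := exists_roots_pencil_eq H.ρ_pos H.off hij hp
  obtain ⟨hs, hd⟩ := pairSum_pairDisc_eq H.ρ_pos H.off hp hαβ
  rw [hd] at h0
  have heq : α = β := sub_eq_zero.mp (pow_eq_zero_iff two_ne_zero |>.mp h0)
  subst heq
  have hα : pairSum u B ρ i j z / 2 = α := by rw [hs]; ring
  obtain ⟨h1, h2⟩ := H.nodup_and_notMem_map_isoRoot hp
  have h3 := h2 α fun k hki hkj => (hfar k hki hkj).1
  rw [hα, hαβ]
  refine ⟨?_, fun a ha => ?_, ?_⟩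
  · rw [Multiset.count_add, Multiset.count_eq_zero_of_notMem h3]
    simp
  · rw [Multiset.count_add, Multiset.count_eq_zero_of_notMem (s := {α, α}) (by simpa using ha),
      add_zero]
    exact Multiset.nodup_iff_count_le_one.mp h1 a
  · refine Finset.prod_ne_zero_iff.mpr fun k hk => ?_
    intro h
    exact h3 (Multiset.mem_map.mpr ⟨k, hk, (sub_eq_zero.mp h).symm⟩)

theorem eval_charpoly_pencil_eq {i j : Fin n} (hij : i ≠ j) {z : ℂ}
    (hp : PairIsolated u B ρ i j z) (x : ℂ) :
    (pencil u B z).charpoly.eval x =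
      (∏ k ∈ ({i, j} : Finset (Fin n))ᶜ, (x - isoRoot u B ρ k z)) *
        ((x - pairSum u B ρ i j z / 2) ^ 2 - pairDisc u B ρ i j z / 4) := by
  obtain ⟨α, β, hαβ, hfar⟩ := exists_roots_pencil_eq H.ρ_pos H.off hij hp
  obtain ⟨hs, hd⟩ := pairSum_pairDisc_eq H.ρ_pos H.off hp hαβ
  rw [eval_charpoly_eq_prod_roots, hαβ, Multiset.map_add, Multiset.prod_add, Multiset.map_map,
    hs, hd]
  congr 1
  simp
  ring

/-- Points away from the branch points carry only simple eigenvalues. -/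
theorem nodup_roots {z : ℂ}
    (h0 : ∀ i j, i ≠ j → ‖z - (pencilCross u B i j : ℝ)‖ < 2 * R → pairDisc u B ρ i j z ≠ 0) :
    (pencil u B z).charpoly.roots.Nodup := by
  have hR := H.R_pos
  by_cases hx : ∃ i j, i ≠ j ∧ ‖z - (pencilCross u B i j : ℝ)‖ < 2 * R
  · obtain ⟨i, j, hij, hlt⟩ := hx
    exact H.nodup_roots_of_pairDisc_ne_zero hij (H.pairIsolated hij (by linarith)) (h0 i j hij hlt)
  · push Not at hx
    have hall : ∀ k, Isolated u B ρ k z := fun k =>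
      H.isolated_of_far fun l hl => by linarith [hx k l hl.symm]
    rw [roots_pencil_eq_of_forall_isolated H.ρ_pos H.off hall]
    refine Multiset.Nodup.map_on (fun k _ l _ he => ?_) (Finset.nodup _)
    by_contra hkl
    exact isoRoot_ne H.ρ_pos H.off hkl (hall k) (hall l) he

end NearDiagonal

theorem IsCut.deriv_pairDisc_ne_zero {i j : Fin n} {c h : ℝ} (hc : IsCut u B R ρ i j c h)
    (H : NearDiagonal u B R ρ ε) {z : ℂ}
    (hz : ‖z - (pencilCross u B i j : ℝ)‖ < 2 * R) (h0 : (z - c) ^ 2 + (h : ℂ) ^ 2 = 0) :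
    deriv (pairDisc u B ρ i j) z ≠ 0 := by
  have hR := H.R_pos
  obtain ⟨g, hg1, hg2, hg3⟩ := hc.fac
  have hU : Metric.ball ((pencilCross u B i j : ℝ) : ℂ) (3 * R) ∈ 𝓝 z :=
    Metric.isOpen_ball.mem_nhds (mem_ball_iff_norm.mpr (by linarith))
  have hev : pairDisc u B ρ i j =ᶠ[𝓝 z] fun z => ((z - c) ^ 2 + (h : ℂ) ^ 2) * g z := by
    filter_upwards [hU] with w hw
    exact hg2 w hw
  have hq : HasDerivAt (fun z : ℂ => (z - c) ^ 2 + (h : ℂ) ^ 2) (2 * (z - c)) z := by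
    have := (((hasDerivAt_id z).sub_const (c : ℂ)).pow 2).add_const ((h : ℂ) ^ 2)
    simpa using this
  have hgz := (hg1.differentiableAt hU).hasDerivAt
  rw [hev.deriv_eq, (hq.fun_mul hgz).deriv, h0, zero_mul, add_zero]
  have hg0 : g z ≠ 0 := fun e => by
    have := hg3 z (mem_closedBall_iff_norm.mpr hz.le)
    rw [e, zero_div, zero_sub, norm_neg, norm_one] at this
    norm_num at this
  refine mul_ne_zero (mul_ne_zero two_ne_zero fun e => ?_) hg0
  rw [e] at h0
  have := hc.h_pos.ne'
  simp [this] at h0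

end

/-! ### From the pencil to the spectral curve -/

theorem Matrix.scalar_mul_sub_smul {n : ℕ} (a y : ℂ) (M : Matrix (Fin n) (Fin n) ℂ) :
    Matrix.scalar (Fin n) (a * y) - a • M = a • (Matrix.scalar (Fin n) y - M) := by
  ext i j
  by_cases h : i = j
  · subst h; simp [mul_sub]
  · simp [h]

theorem Matrix.charpoly_smul_eq_prod {n : ℕ} (M : Matrix (Fin n) (Fin n) ℂ) {a : ℂ} (ha : a ≠ 0) :
    (a • M).charpoly = (M.charpoly.roots.map fun x => Polynomial.X - Polynomial.C (a * x)).prod := by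
  refine Polynomial.funext fun x => ?_
  rw [Matrix.eval_charpoly, Polynomial.eval_multiset_prod, Multiset.map_map]
  have h1 := scalar_mul_sub_smul a (x / a) M
  rw [mul_div_cancel₀ _ ha] at h1
  have h2 : (M.charpoly.roots.map fun _ => a).prod = a ^ n := by
    rw [Multiset.map_const', Multiset.prod_replicate, card_roots_charpoly]
  rw [h1, Matrix.det_smul, ← Matrix.eval_charpoly, eval_charpoly_eq_prod_roots, Fintype.card_fin,
    ← h2, ← Multiset.prod_map_mul]
  congr 1
  refine Multiset.map_congr rfl fun y _ => ?_
  simp only [Function.comp, Polynomial.eval_sub, Polynomial.eval_X, Polynomial.eval_C]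
  field_simp

section

variable {n : ℕ} {u : Fin n → ℝ} {A : HermMat n}

/-- The coefficient `A / 2π` of the pencil `z u + A / 2π = z (u + A / (2π z))`. -/
noncomputable def curvePencil (A : HermMat n) : Matrix (Fin n) (Fin n) ℂ :=
  (1 / (2 * (Real.pi : ℂ))) • A.1

theorem specMat_eq_smul_pencil {z : ℂ} (hz : z ≠ 0) :
    specMat u A z = (I / z) • pencil u (curvePencil A) z := by
  rw [specMat, pencil, curvePencil, smul_add, smul_add, smul_smul, smul_smul, smul_smul]
  have hpi : (Real.pi : ℂ) ≠ 0 := ofReal_ne_zero.mpr Real.pi_ne_zero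
  congr 2
  · field_simp
  · field_simp

theorem pencilCross_curvePencil (i j : Fin n) :
    pencilCross u (curvePencil A) i j = crossing u A i j := by
  have hre : ∀ k, (curvePencil A k k).re = diagEntry A k / (2 * Real.pi) := fun k => by
    rw [curvePencil, Matrix.smul_apply, smul_eq_mul,
      show (1 / (2 * (Real.pi : ℂ))) = ((1 / (2 * Real.pi) : ℝ) : ℂ) by push_cast; rfl,
      re_ofReal_mul, diagEntry]
    ring
  have := Real.pi_ne_zero
  rw [pencilCross, crossing, hre, hre, ← sub_div, ← neg_div, div_div]

theorem roots_charpoly_specMat {z : ℂ} (hz : z ≠ 0) :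
    (specMat u A z).charpoly.roots =
      (pencil u (curvePencil A) z).charpoly.roots.map fun x => I / z * x := by
  rw [specMat_eq_smul_pencil hz, Matrix.charpoly_smul_eq_prod _ (div_ne_zero I_ne_zero hz)]
  have := Polynomial.roots_multiset_prod_X_sub_C
    ((pencil u (curvePencil A) z).charpoly.roots.map fun x => I / z * x)
  rwa [Multiset.map_map] at this

theorem specFun_eq (z μ : ℂ) :
    specFun u A z μ = (-1) ^ n * (specMat u A z).charpoly.eval μ := by
  rw [specFun, Matrix.eval_charpoly, ← neg_sub, Matrix.det_neg, Fintype.card_fin]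
  congr 3
  ext i j
  simp [Matrix.one_apply, Matrix.diagonal_apply]

theorem mem_spectralCurve_iff {p : ℂ × ℂ} :
    p ∈ spectralCurve u A ↔ p.1 ≠ 0 ∧ p.2 ∈ (specMat u A p.1).charpoly.roots := by
  rw [spectralCurve, Set.mem_ofPred_eq, specFun_eq, Polynomial.mem_roots
    (Matrix.charpoly_monic _).ne_zero, Polynomial.IsRoot]
  simp

/-- At a simple eigenvalue the curve is smooth, and `z` is a local coordinate. -/
theorem spectralSmoothAt_of_count_le_one {p : ℂ × ℂ} (hp : p ∈ spectralCurve u A)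
    (h : (specMat u A p.1).charpoly.rootMultiplicity p.2 ≤ 1) : SpectralSmoothAt u A p := by
  right
  have h1 : (fun μ => specFun u A p.1 μ) =
      fun μ => (-1) ^ n * (specMat u A p.1).charpoly.eval μ := by
    funext μ; exact specFun_eq _ _
  rw [h1, (((specMat u A p.1).charpoly.hasDerivAt p.2).const_mul ((-1 : ℂ) ^ n)).deriv]
  refine mul_ne_zero (pow_ne_zero _ (by norm_num)) fun h0 => ?_
  have h2 := (Polynomial.one_lt_rootMultiplicity_iff_isRoot
    (Matrix.charpoly_monic (specMat u A p.1)).ne_zero (t := p.2)).mpr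
    ⟨Polynomial.isRoot_of_mem_roots (mem_spectralCurve_iff.mp hp).2, h0⟩
  omega

theorem rootMultiplicity_specMat {z : ℂ} (hz : z ≠ 0) (ν : ℂ) :
    (specMat u A z).charpoly.rootMultiplicity (I / z * ν) =
      (pencil u (curvePencil A) z).charpoly.roots.count ν := by
  rw [← Polynomial.count_roots, roots_charpoly_specMat hz]
  exact Multiset.count_map_eq_count' _ _
    (mul_right_injective₀ (div_ne_zero I_ne_zero hz)) ν

variable {R ρ ε : ℝ}

theorem NearDiagonal.ne_zero_of_near (H : NearDiagonal u (curvePencil A) R ρ ε) {i j : Fin n}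
    (hij : i ≠ j) {z : ℂ} (hz : ‖z - (pencilCross u (curvePencil A) i j : ℝ)‖ < R) : z ≠ 0 := by
  rintro rfl
  have := H.cross_far i j hij
  rw [zero_sub, norm_neg, norm_real, Real.norm_eq_abs] at hz
  linarith

/-- At a zero `b` of the discriminant the fibre has one double point, and there `∂_z` of the
equation of the curve is a non-zero multiple of the derivative of the discriminant. -/
theorem IsCut.isSimpleBranchPoint (H : NearDiagonal u (curvePencil A) R ρ ε) {i j : Fin n}
    (hij : i ≠ j) {c h : ℝ} (hc : IsCut u (curvePencil A) R ρ i j c h) {b : ℂ}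
    (hb : ‖b - (pencilCross u (curvePencil A) i j : ℝ)‖ < R)
    (h0 : (b - c) ^ 2 + (h : ℂ) ^ 2 = 0) : IsSimpleBranchPoint u A b := by
  have hR := H.R_pos
  set B := curvePencil A with hB
  have hb0 : b ≠ 0 := H.ne_zero_of_near hij hb
  have hp := H.pairIsolated hij (z := b) (by linarith)
  have hD0 : pairDisc u B ρ i j b = 0 := (hc.pairDisc_eq_zero_iff H (by linarith)).mpr h0
  obtain ⟨h1, h2, h3⟩ := H.count_roots_of_pairDisc_eq_zero hij hp hD0
  set m := pairSum u B ρ i j b / 2 with hm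
  have hmult : (specMat u A b).charpoly.rootMultiplicity (I / b * m) = 2 := by
    rw [rootMultiplicity_specMat hb0]; exact h1
  refine ⟨I / b * m, mem_spectralCurve_iff.mpr ⟨hb0, ?_⟩, Or.inl ?_, hmult, fun m' hm' => ?_⟩
  · rw [← Multiset.count_pos, Polynomial.count_roots, hmult]; norm_num
  · set N : ℂ → ℂ := fun z => z / b * m with hN
    set Q : ℂ → ℂ := fun z =>
      (N z - pairSum u B ρ i j z / 2) ^ 2 - pairDisc u B ρ i j z / 4 with hQ
    set P : ℂ → ℂ := fun z => (-1) ^ n * ((I / z) ^ n *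
      ∏ k ∈ ({i, j} : Finset (Fin n))ᶜ, (N z - isoRoot u B ρ k z)) with hP
    have hev : (fun z => specFun u A z (I / b * m)) =ᶠ[𝓝 b] fun z => P z * Q z := by
      have hnear : ∀ᶠ z : ℂ in 𝓝 b, ‖z - (pencilCross u B i j : ℝ)‖ < R :=
        (isOpen_lt (by fun_prop) continuous_const).mem_nhds hb
      filter_upwards [hnear] with z hz
      have hz0 : z ≠ 0 := H.ne_zero_of_near hij hz
      have hev := H.eval_charpoly_pencil_eq hij (H.pairIsolated hij (z := z) (by linarith)) (N z)
      have hmat : Matrix.scalar (Fin n) (I / b * m) - specMat u A z =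
          (I / z) • (Matrix.scalar (Fin n) (N z) - pencil u B z) := by
        rw [specMat_eq_smul_pencil hz0, ← Matrix.scalar_mul_sub_smul, hN]
        congr 2
        field_simp
      rw [specFun_eq, Matrix.eval_charpoly, hmat, Matrix.det_smul, ← Matrix.eval_charpoly, hev,
        Fintype.card_fin]
      simp only [hP, hQ]
      ring
    have hNb : N b = m := by rw [hN]; field_simp
    have hQb : Q b = 0 := by
      simp only [hQ]; rw [hNb, hD0, ← hm]; simp
    have hNd : DifferentiableAt ℂ N b := by simp only [hN]; fun_prop
    have hSd := (pairSum_analyticAt H.ρ_pos H.off hp).differentiableAt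
    have hDd := (pairDisc_analyticAt H.ρ_pos H.off hp).differentiableAt
    have hQd : HasDerivAt Q (-(deriv (pairDisc u B ρ i j) b / 4)) b := by
      have := ((hNd.hasDerivAt.sub (hSd.hasDerivAt.div_const 2)).pow 2).sub
        (hDd.hasDerivAt.div_const 4)
      refine this.congr_deriv ?_
      simp [hNb, ← hm]
    have hPd : DifferentiableAt ℂ P b := by
      refine DifferentiableAt.const_mul (DifferentiableAt.mul ?_ ?_) _
      · exact ((differentiableAt_const I).div differentiableAt_id hb0).pow n
      · refine DifferentiableAt.fun_finsetProd fun k hk => hNd.sub ?_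
        simp only [Finset.mem_compl, Finset.mem_insert, Finset.mem_singleton, not_or] at hk
        exact (isoRoot_analyticAt H.ρ_pos H.off (hp k hk.1 hk.2)).differentiableAt
    rw [hev.deriv_eq, (hPd.hasDerivAt.fun_mul hQd).deriv, hQb, mul_zero, zero_add]
    refine mul_ne_zero (mul_ne_zero (pow_ne_zero _ (by norm_num)) (mul_ne_zero
      (pow_ne_zero _ (div_ne_zero I_ne_zero hb0)) ?_)) ?_
    · rw [hNb]; exact h3
    · exact neg_ne_zero.mpr (div_ne_zero
        (hc.deriv_pairDisc_ne_zero H (by linarith) h0) (by norm_num))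
  · have e : m' = I / b * (m' * b / I) := by
      field_simp
    rw [e, rootMultiplicity_specMat hb0]
    refine h2 _ fun e' => hm' ?_
    rw [e, e']

/-- A simple branch point is smooth at its ramification point, and at the other points of the fibre
the eigenvalue is simple. -/
theorem IsSimpleBranchPoint.spectralSmoothAt {p : ℂ × ℂ} (hb : IsSimpleBranchPoint u A p.1)
    (hp : p ∈ spectralCurve u A) : SpectralSmoothAt u A p := by
  obtain ⟨m, -, hs, -, hm⟩ := hb
  by_cases h : p.2 = m
  · rw [← h] at hs; exact hs
  · exact spectralSmoothAt_of_count_le_one hp (hm _ h)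

/-! ### Vertical segments -/

theorem mem_vSeg_of_mem_segment {c h : ℝ} (hh : 0 < h) {z : ℂ}
    (hz : z ∈ segment ℝ (⟨c, h⟩ : ℂ) ⟨c, -h⟩) : z ∈ vSeg c h := by
  obtain ⟨a, b, ha, hb, hab, rfl⟩ := hz
  refine ⟨?_, abs_le.mpr ?_⟩
  · simp only [add_re, real_smul, re_ofReal_mul]
    rw [← add_mul, hab, one_mul]
  · simp only [add_im, real_smul, im_ofReal_mul]
    constructor <;> nlinarith

theorem mem_segment_of_mem_vSeg {c h : ℝ} (hh : 0 < h) {z : ℂ} (hz : z ∈ vSeg c h) :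
    z ∈ segment ℝ (⟨c, h⟩ : ℂ) ⟨c, -h⟩ := by
  obtain ⟨h1, h2⟩ := hz
  rw [abs_le] at h2
  refine ⟨(h + z.im) / (2 * h), (h - z.im) / (2 * h), div_nonneg (by linarith) (by linarith),
    div_nonneg (by linarith) (by linarith), by field_simp; ring, ?_⟩
  apply Complex.ext
  · simp only [add_re, real_smul, re_ofReal_mul]
    rw [h1]; field_simp; ring
  · simp only [add_im, real_smul, im_ofReal_mul]
    field_simp; ring

theorem re_eq_and_abs_im_lt_of_mem_openSegment {c h : ℝ} (hh : 0 < h) {z : ℂ}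
    (hz : z ∈ openSegment ℝ (⟨c, h⟩ : ℂ) ⟨c, -h⟩) : z.re = c ∧ |z.im| < h := by
  obtain ⟨a, b, ha, hb, hab, rfl⟩ := hz
  refine ⟨?_, abs_lt.mpr ?_⟩
  · simp only [add_re, real_smul, re_ofReal_mul]
    rw [← add_mul, hab, one_mul]
  · simp only [add_im, real_smul, im_ofReal_mul]
    constructor <;> nlinarith [mul_pos ha hh, mul_pos hb hh]

end

section

variable {n : ℕ} {u : Fin n → ℝ} {A : HermMat n} {R ρ ε : ℝ} {c h : Fin n → Fin n → ℝ}

/-! ### The conclusions for nearly diagonal pencils -/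

theorem IsCutSystem.notMem_vSeg_of_mem_sheetDomain (C : IsCutSystem u (curvePencil A) R ρ c h) {i : Fin n}
    {z : ℂ}
    (hz : z ∈ sheetDomain (fun i j => ⟨c i j, h i j⟩) (fun i j => ⟨c i j, -h i j⟩) i) :
    z ≠ 0 ∧ ∀ j, j ≠ i → z ∉ vSeg (c i j) (h i j) :=
  ⟨hz.1, fun j hj hm => hz.2 j hj (mem_segment_of_mem_vSeg (C.isCut i j hj.symm).h_pos hm)⟩

theorem IsCutSystem.norm_branchPoint_sub_lt (C : IsCutSystem u (curvePencil A) R ρ c h)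
    {i j : Fin n} (hij : i ≠ j) (s : ℝ) (hs : s = h i j ∨ s = -h i j) :
    ‖(⟨c i j, s⟩ : ℂ) - (pencilCross u (curvePencil A) i j : ℝ)‖ < R / 100 := by
  refine (C.isCut i j hij).norm_sub_lt_of_mem_vSeg ⟨rfl, ?_⟩
  have := (C.isCut i j hij).h_pos
  rcases hs with rfl | rfl
  · exact (abs_of_pos this).le
  · rw [abs_neg]; exact (abs_of_pos this).le

/-- Points near distinct crossings are distinct. -/
theorem NearDiagonal.eq_or_swap_of_near (H : NearDiagonal u (curvePencil A) R ρ ε) {i j k l : Fin n} (hij : i ≠ j) (hkl : k ≠ l) {b : ℂ}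
    (h1 : ‖b - (pencilCross u (curvePencil A) i j : ℝ)‖ < R / 100)
    (h2 : ‖b - (pencilCross u (curvePencil A) k l : ℝ)‖ < R / 100) :
    (i = k ∧ j = l) ∨ (i = l ∧ j = k) := by
  have hR := H.R_pos
  by_contra hcon
  rw [not_or] at hcon
  have := H.far_of_near hij hkl hcon.1 hcon.2 (z := b) (by linarith)
  linarith

namespace IsCutSystem

variable (C : IsCutSystem u (curvePencil A) R ρ c h) (H : NearDiagonal u (curvePencil A) R ρ ε)
include C H

theorem analyticAt_sheet_div {i : Fin n} {z : ℂ} (hz0 : z ≠ 0)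
    (hz : ∀ j, j ≠ i → z ∉ vSeg (c i j) (h i j)) :
    AnalyticAt ℂ (fun z => I / z * sheet u (curvePencil A) R ρ c h i z) z :=
  (analyticAt_const.div analyticAt_id hz0).mul (C.sheet_analyticAt H hz)

theorem charpoly_specMat_eq {z : ℂ} (hz0 : z ≠ 0)
    (hz : ∀ i j, j ≠ i → z ∉ vSeg (c i j) (h i j)) :
    (specMat u A z).charpoly = ∏ i, (Polynomial.X -
      Polynomial.C (I / z * sheet u (curvePencil A) R ρ c h i z)) := by
  rw [specMat_eq_smul_pencil hz0, Matrix.charpoly_smul_eq_prod _ (div_ne_zero I_ne_zero hz0),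
    C.roots_pencil_eq_sheet H hz, Multiset.map_map]
  rfl

theorem exchangedAcross_sheet {i j : Fin n} (hij : i ≠ j) :
    ExchangedAcross (fun z => I / z * sheet u (curvePencil A) R ρ c h i z)
      (fun z => I / z * sheet u (curvePencil A) R ρ c h j z)
      ⟨c i j, h i j⟩ ⟨c i j, -h i j⟩ := by
  intro p hp
  have hR := H.R_pos
  have hcut := C.isCut i j hij
  obtain ⟨h1, h2⟩ := re_eq_and_abs_im_lt_of_mem_openSegment hcut.h_pos hp
  have hnear := hcut.norm_sub_lt_of_mem_vSeg (z := p) ⟨h1, h2.le⟩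
  have hp0 : p ≠ 0 := H.ne_zero_of_near hij (by linarith)
  obtain ⟨F, G, hF, hG, hFG⟩ := hcut.exchangedAcross_pairRoot H hij h1 h2
  have hI : AnalyticAt ℂ (fun z : ℂ => I / z) p := analyticAt_const.div analyticAt_id hp0
  refine ⟨fun z => I / z * F z, fun z => I / z * G z, hI.mul hF, hI.mul hG, ?_⟩
  have hopen : ∀ᶠ z : ℂ in 𝓝 p, ‖z - (pencilCross u (curvePencil A) i j : ℝ)‖ < 2 * R :=
    (isOpen_lt (by fun_prop) continuous_const).mem_nhds (show _ < 2 * R by linarith)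
  filter_upwards [hFG, hopen] with z hz hn
  have e1 := C.sheet_eq_pairRoot H hij hn
  rw [pencilCross_comm] at hn
  have e2 := C.sheet_eq_pairRoot H hij.symm hn
  rw [C.c_comm j i, C.h_comm j i] at e2
  simp only [e1, e2]
  exact ⟨fun hl => ⟨by rw [(hz.1 hl).1], by rw [(hz.1 hl).2]⟩,
    fun hl => ⟨by rw [(hz.2 hl).1], by rw [(hz.2 hl).2]⟩⟩

theorem isSimpleBranchPoint {i j : Fin n} (hij : i ≠ j) (s : ℝ) (hs : s = h i j ∨ s = -h i j) :
    IsSimpleBranchPoint u A ⟨c i j, s⟩ := by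
  have hR := H.R_pos
  have hn := C.norm_branchPoint_sub_lt hij s hs
  refine (C.isCut i j hij).isSimpleBranchPoint H hij (by linarith) ?_
  have e : (⟨c i j, s⟩ : ℂ) - c i j = s * I := by apply Complex.ext <;> simp
  rw [e, mul_pow, I_sq]
  rcases hs with rfl | rfl
  · ring
  · push_cast; ring

theorem ncard_branchPoints :
    {b : ℂ | ∃ i j, i ≠ j ∧ (b = ⟨c i j, h i j⟩ ∨ b = ⟨c i j, -h i j⟩)}.ncard = n * (n - 1) := by
  classical
  -- the upper point belongs to the pair `(i, j)` with `i < j`, the lower one to `(j, i)`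
  set f : Fin n × Fin n → ℂ := fun p =>
    ⟨c p.1 p.2, if p.1 < p.2 then h p.1 p.2 else -h p.1 p.2⟩ with hf
  have hset : {b : ℂ | ∃ i j, i ≠ j ∧ (b = ⟨c i j, h i j⟩ ∨ b = ⟨c i j, -h i j⟩)} =
      ((Finset.univ.offDiag.image f : Finset ℂ) : Set ℂ) := by
    ext b
    simp only [Set.mem_ofPred_eq, Finset.coe_image, Set.mem_image, Finset.mem_coe,
      Finset.mem_offDiag, Finset.mem_univ, true_and, Prod.exists]
    constructor
    · rintro ⟨i, j, hij, hb⟩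
      rcases lt_or_gt_of_ne hij with hlt | hlt
      · rcases hb with rfl | rfl
        · exact ⟨i, j, hij, by simp [hf, hlt]⟩
        · exact ⟨j, i, hij.symm, by simp [hf, hlt.not_gt, C.c_comm j i, C.h_comm j i]⟩
      · rcases hb with rfl | rfl
        · exact ⟨j, i, hij.symm, by simp [hf, hlt, C.c_comm j i, C.h_comm j i]⟩
        · exact ⟨i, j, hij, by simp [hf, hlt.not_gt]⟩
    · rintro ⟨i, j, hij, rfl⟩
      refine ⟨i, j, hij, ?_⟩
      by_cases hlt : i < j
      · left; simp [hf, hlt]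
      · right; simp [hf, hlt]
  rw [hset, Set.ncard_coe_finset, Finset.card_image_of_injOn, Finset.offDiag_card]
  · simp [Nat.mul_sub]
  · rintro ⟨i, j⟩ hij ⟨k, l⟩ hkl heq
    simp only [Finset.coe_offDiag, Set.mem_offDiag, Finset.coe_univ, Set.mem_univ, true_and]
      at hij hkl
    have h1 : ‖f (i, j) - (pencilCross u (curvePencil A) i j : ℝ)‖ < R / 100 :=
      C.norm_branchPoint_sub_lt hij _ (by by_cases hlt : i < j <;> simp [hlt])
    have h2 : ‖f (i, j) - (pencilCross u (curvePencil A) k l : ℝ)‖ < R / 100 := by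
      rw [heq]
      exact C.norm_branchPoint_sub_lt hkl _ (by by_cases hlt : k < l <;> simp [hlt])
    rcases H.eq_or_swap_of_near hij hkl h1 h2 with ⟨rfl, rfl⟩ | ⟨rfl, rfl⟩
    · rfl
    · exfalso
      have him := congrArg im heq
      have hpos := (C.isCut i j hij).h_pos
      simp only [hf] at him
      rw [C.h_comm j i] at him
      rcases lt_or_gt_of_ne hij with hlt | hlt
      · rw [if_pos hlt, if_neg hlt.not_gt] at him; linarith
      · rw [if_neg hlt.not_gt, if_pos hlt] at him; linarith

theorem spectralSmoothAt {p : ℂ × ℂ} (hp : p ∈ spectralCurve u A) : SpectralSmoothAt u A p := by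
  have hR := H.R_pos
  have hp0 := (mem_spectralCurve_iff.mp hp).1
  by_cases hx : ∃ i j, i ≠ j ∧ ‖p.1 - (pencilCross u (curvePencil A) i j : ℝ)‖ < 2 * R ∧
      pairDisc u (curvePencil A) ρ i j p.1 = 0
  · obtain ⟨i, j, hij, hn, h0⟩ := hx
    have hn' := H.norm_sub_lt_of_pairDisc_eq_zero hij (by linarith) h0
    exact ((C.isCut i j hij).isSimpleBranchPoint H hij (by linarith)
      (((C.isCut i j hij).pairDisc_eq_zero_iff H hn).mp h0)).spectralSmoothAt hp
  · push Not at hx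
    refine spectralSmoothAt_of_count_le_one hp ?_
    have e : p.2 = I / p.1 * (p.2 * p.1 / I) := by
      field_simp
    rw [e, rootMultiplicity_specMat hp0]
    exact Multiset.nodup_iff_count_le_one.mp (H.nodup_roots hx) _

end IsCutSystem

theorem NearDiagonal.exists_sheets (H : NearDiagonal u (curvePencil A) R ρ ε) :
    ∃ (zp zm : Fin n → Fin n → ℂ) (μ : Fin n → ℂ → ℂ),
      (∀ i j, zp i j = zp j i ∧ zm i j = zm j i) ∧
      (∀ i j, i ≠ j → (zp i j).re = (zm i j).re ∧ (zm i j).im < (zp i j).im) ∧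
      (∀ i j k l, i < j → k < l → (i, j) ≠ (k, l) → crossing u A i j ≠ crossing u A k l) ∧
      (∀ i j k l, i < j → k < l →
        ((zp i j).re < (zp k l).re ↔ crossing u A i j < crossing u A k l)) ∧
      (∀ i, Tendsto (μ i) (Bornology.cobounded ℂ) (𝓝 (I * (u i : ℂ)))) ∧
      (∀ i, AnalyticOnNhd ℂ (μ i) (sheetDomain zp zm i)) ∧
      (∀ z, (∀ i, z ∈ sheetDomain zp zm i) →
        (specMat u A z).charpoly = ∏ i, (Polynomial.X - Polynomial.C (μ i z))) ∧
      (∀ i j, i ≠ j → ExchangedAcross (μ i) (μ j) (zp i j) (zm i j)) ∧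
      (∀ i j k, i ≠ j → k ≠ i → k ≠ j → ∀ p ∈ segment ℝ (zp i j) (zm i j),
        AnalyticAt ℂ (μ k) p) ∧
      {b : ℂ | ∃ i j, i ≠ j ∧ (b = zp i j ∨ b = zm i j)}.ncard = n * (n - 1) ∧
      (∀ i j, i ≠ j →
        IsSimpleBranchPoint u A (zp i j) ∧ IsSimpleBranchPoint u A (zm i j)) ∧
      (∀ p ∈ spectralCurve u A, SpectralSmoothAt u A p) ∧
      (∀ i, ∀ z ∈ sheetDomain zp zm i,
        μ i ((starRingEnd ℂ) z) = -(starRingEnd ℂ) (μ i z)) := by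
  obtain ⟨c, h, C⟩ := H.exists_isCutSystem
  have hR := H.R_pos
  refine ⟨fun i j => ⟨c i j, h i j⟩, fun i j => ⟨c i j, -h i j⟩,
    fun i z => I / z * sheet u (curvePencil A) R ρ c h i z,
    fun i j => ⟨by simp only [C.c_comm i j, C.h_comm i j], by simp only [C.c_comm i j, C.h_comm i j]⟩,
    fun i j hij => ⟨rfl, ?_⟩, fun i j k l hij hkl hne => ?_, fun i j k l hij hkl => ?_,
    fun i => ?_, fun i z hz => ?_, fun z hz => ?_, fun i j hij => C.exchangedAcross_sheet H hij,
    fun i j k hij hki hkj p hp => ?_, C.ncard_branchPoints H,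
    fun i j hij => ⟨C.isSimpleBranchPoint H hij _ (Or.inl rfl),
      C.isSimpleBranchPoint H hij _ (Or.inr rfl)⟩,
    fun p hp => C.spectralSmoothAt H hp, fun i z hz => ?_⟩
  · have := (C.isCut i j hij).h_pos
    simp only
    linarith
  · rw [← pencilCross_curvePencil, ← pencilCross_curvePencil]
    intro he
    have := H.cross_sep i j k l hij hkl hne
    rw [he, sub_self, abs_zero] at this
    linarith
  · rw [← pencilCross_curvePencil, ← pencilCross_curvePencil]
    simp only
    by_cases hne : (i, j) = (k, l)
    · rw [Prod.mk.injEq] at hne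
      rw [hne.1, hne.2]
      simp
    · have h1 := abs_lt.mp (C.isCut i j hij.ne).abs_c_sub_lt
      have h2 := abs_lt.mp (C.isCut k l hkl.ne).abs_c_sub_lt
      have h3 := H.cross_sep i j k l hij hkl hne
      constructor
      · intro hlt
        by_contra hge
        rw [abs_of_nonneg (by linarith)] at h3
        linarith
      · intro hlt
        rw [abs_of_neg (by linarith)] at h3
        linarith
  · refine ((H.tendsto_sheet_div c h i).const_mul I).congr fun z => ?_
    ring
  · obtain ⟨h0, h1⟩ := C.notMem_vSeg_of_mem_sheetDomain hz
    exact C.analyticAt_sheet_div H h0 h1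
  · by_cases hn : Nonempty (Fin n)
    · obtain ⟨i₀⟩ := hn
      exact C.charpoly_specMat_eq H (hz i₀).1
        fun i => (C.notMem_vSeg_of_mem_sheetDomain (hz i)).2
    · rw [not_nonempty_iff] at hn
      rw [Matrix.charpoly_isEmpty, Finset.univ_eq_empty, Finset.prod_empty]
  · have hseg := mem_vSeg_of_mem_segment (C.isCut i j hij).h_pos hp
    have hnear := (C.isCut i j hij).norm_sub_lt_of_mem_vSeg hseg
    refine C.analyticAt_sheet_div H (H.ne_zero_of_near hij (by linarith)) fun l hl hm => ?_
    rcases H.eq_or_swap_of_near hij hl.symm hnear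
      ((C.isCut k l hl.symm).norm_sub_lt_of_mem_vSeg hm) with e | e
    · exact hki e.1.symm
    · exact hkj e.2.symm
  · obtain ⟨h0, h1⟩ := C.notMem_vSeg_of_mem_sheetDomain hz
    simp only [C.sheet_conj H h1, map_mul, map_div₀, conj_I]
    ring

end

/-! ### The open set of nearly diagonal pencils -/

/-- The pairs `(u, A)` in the chamber whose pencil is nearly diagonal with distinct crossings. -/
def nearDiagonalSet (n : ℕ) : Set ((Fin n → ℝ) × HermMat n) :=
  {p | StrictMono p.1 ∧ ∃ R ρ ε, NearDiagonal p.1 (curvePencil p.2) R ρ ε}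

section

variable {n : ℕ}

theorem curvePencil_isHermitian (A : HermMat n) : (curvePencil A).IsHermitian := by
  have hA : A.1.IsHermitian := A.2
  have : curvePencil A = ((1 / (2 * Real.pi) : ℝ) : ℂ) • A.1 := by
    rw [curvePencil]; push_cast; rfl
  rw [this, Matrix.IsHermitian, Matrix.conjTranspose_smul, hA.eq]
  simp

theorem continuous_curvePencil_apply (i j : Fin n) :
    Continuous fun A : HermMat n => curvePencil A i j := by
  have : Continuous fun A : HermMat n => A.1 i j := continuous_subtype_val.matrix_elem i j
  simp only [curvePencil, Matrix.smul_apply, smul_eq_mul]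
  exact continuous_const.mul this

theorem continuousAt_pencilCross {p : (Fin n → ℝ) × HermMat n} {i j : Fin n}
    (hp : p.1 i ≠ p.1 j) :
    ContinuousAt (fun q : (Fin n → ℝ) × HermMat n =>
      pencilCross q.1 (curvePencil q.2) i j) p := by
  have h1 : ∀ i : Fin n, Continuous fun q : (Fin n → ℝ) × HermMat n =>
      (curvePencil q.2 i i).re := fun i =>
    Complex.continuous_re.comp ((continuous_curvePencil_apply i i).comp continuous_snd)
  have h2 : ∀ i : Fin n, Continuous fun q : (Fin n → ℝ) × HermMat n => q.1 i := fun i =>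
    (continuous_apply i).comp continuous_fst
  unfold pencilCross
  exact ((h1 i).sub (h1 j)).neg.continuousAt.div ((h2 i).sub (h2 j)).continuousAt
    (sub_ne_zero.mpr hp)

theorem isOpen_nearDiagonalSet : IsOpen (nearDiagonalSet n) := by
  rw [isOpen_iff_eventually]
  rintro p ⟨hmono, R, ρ, ε, H⟩
  have hu : ∀ i : Fin n, Continuous fun q : (Fin n → ℝ) × HermMat n => q.1 i := fun i =>
    (continuous_apply i).comp continuous_fst
  have hB : ∀ i j : Fin n, Continuous fun q : (Fin n → ℝ) × HermMat n =>
      ‖curvePencil q.2 i j‖ := fun i j =>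
    ((continuous_curvePencil_apply i j).comp continuous_snd).norm
  have e1 : ∀ᶠ q : (Fin n → ℝ) × HermMat n in 𝓝 p, ∀ i j, i < j → q.1 i < q.1 j :=
    eventually_all.mpr fun i => eventually_all.mpr fun j => eventually_imp_distrib_left.mpr
      fun hij => (hu i).continuousAt.eventually_lt (hu j).continuousAt (hmono hij)
  have e2 : ∀ᶠ q : (Fin n → ℝ) × HermMat n in 𝓝 p, ∀ i j, i ≠ j → ‖curvePencil q.2 i j‖ < ε :=
    eventually_all.mpr fun i => eventually_all.mpr fun j => eventually_imp_distrib_left.mpr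
      fun hij => (hB i j).continuousAt.eventually_lt continuousAt_const (H.off_lt i j hij)
  have e3 : ∀ᶠ q : (Fin n → ℝ) × HermMat n in 𝓝 p, ∀ i j, i ≠ j →
      n * ε * (n * ε / ρ) < ‖curvePencil q.2 i j‖ :=
    eventually_all.mpr fun i => eventually_all.mpr fun j => eventually_imp_distrib_left.mpr
      fun hij => continuousAt_const.eventually_lt (hB i j).continuousAt (H.coupling_lt i j hij)
  have e4 : ∀ᶠ q : (Fin n → ℝ) × HermMat n in 𝓝 p, ∀ i j, i ≠ j →
      200 * ρ < R * |q.1 i - q.1 j| :=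
    eventually_all.mpr fun i => eventually_all.mpr fun j => eventually_imp_distrib_left.mpr
      fun hij => continuousAt_const.eventually_lt
        (continuous_const.mul ((hu i).sub (hu j)).abs).continuousAt (H.gap_lt i j hij)
  have e5 : ∀ᶠ q : (Fin n → ℝ) × HermMat n in 𝓝 p, ∀ i j, i ≠ j →
      R < |pencilCross q.1 (curvePencil q.2) i j| :=
    eventually_all.mpr fun i => eventually_all.mpr fun j => eventually_imp_distrib_left.mpr
      fun hij => continuousAt_const.eventually_lt
        (continuousAt_pencilCross (H.u_ne i j hij)).abs (H.cross_far i j hij)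
  have e6 : ∀ᶠ q : (Fin n → ℝ) × HermMat n in 𝓝 p, ∀ i j k l, i < j → k < l → (i, j) ≠ (k, l) →
      4 * R < |pencilCross q.1 (curvePencil q.2) i j - pencilCross q.1 (curvePencil q.2) k l| :=
    eventually_all.mpr fun i => eventually_all.mpr fun j => eventually_all.mpr fun k =>
      eventually_all.mpr fun l => eventually_imp_distrib_left.mpr fun hij =>
        eventually_imp_distrib_left.mpr fun hkl => eventually_imp_distrib_left.mpr fun hne =>
        continuousAt_const.eventually_lt ((continuousAt_pencilCross (H.u_ne i j hij.ne)).sub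
          (continuousAt_pencilCross (H.u_ne k l hkl.ne))).abs (H.cross_sep i j k l hij hkl hne)
  filter_upwards [e1, e2, e3, e4, e5, e6] with q q1 q2 q3 q4 q5 q6
  have hq : StrictMono q.1 := fun i j hij => q1 i j hij
  exact ⟨hq, R, ρ, ε, curvePencil_isHermitian _, fun i j hij => hq.injective.ne hij, H.R_pos,
    H.ρ_pos, q2, H.ε_lt, H.two_n_ε_lt, q3, q4, q5, q6⟩

theorem smul_apply_hermMat (s : ℝ) (K : HermMat n) (i j : Fin n) :
    (s • K).1 i j = s * K.1 i j := by
  simp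

theorem tendsto_diagHerm_add_smul (d : Fin n → ℝ) (K : HermMat n) :
    Tendsto (fun s : ℝ => diagHerm d + s • K) (𝓝[>] 0) (𝓝 (diagHerm d)) := by
  have hc : Continuous fun s : ℝ => diagHerm d + s • K := by
    refine continuous_induced_rng.mpr (continuous_matrix fun i j => ?_)
    have : (fun s : ℝ => (diagHerm d).1 i j + (s : ℂ) * K.1 i j) =
        fun s : ℝ => (Subtype.val ∘ fun s : ℝ => diagHerm d + s • K) s i j := by
      funext s
      rw [← smul_apply_hermMat]
      rfl
    rw [← this]
    fun_prop
  have := hc.tendsto 0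
  rw [zero_smul, add_zero] at this
  exact this.mono_left nhdsWithin_le_nhds

theorem norm_curvePencil_add_smul (d : Fin n → ℝ) (K : HermMat n) {s : ℝ} (hs : 0 < s)
    {i j : Fin n} (hij : i ≠ j) :
    ‖curvePencil (diagHerm d + s • K) i j‖ = s * ‖curvePencil K i j‖ := by
  have : curvePencil (diagHerm d + s • K) i j = s * curvePencil K i j := by
    simp only [curvePencil, Matrix.smul_apply, smul_eq_mul]
    have : (diagHerm d + s • K).1 i j = s * K.1 i j := by
      rw [← smul_apply_hermMat, ← zero_add ((s • K).1 i j)]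
      exact congrArg (· + (s • K).1 i j) (Matrix.diagonal_apply_ne _ hij)
    rw [this]; ring
  rw [this, norm_mul, norm_real, Real.norm_eq_abs, abs_of_pos hs]

theorem eventually_const_mul_lt (a : ℝ) {b : ℝ} (hb : 0 < b) :
    ∀ᶠ x in 𝓝[>] (0 : ℝ), a * x < b := by
  have : Tendsto (fun x : ℝ => a * x) (𝓝 0) (𝓝 (a * 0)) :=
    (continuous_const.mul continuous_id).tendsto 0
  rw [mul_zero] at this
  exact (this.mono_left nhdsWithin_le_nhds).eventually_lt_const hb

theorem tendsto_pencilCross_add_smul {u : Fin n → ℝ} {i j : Fin n} (hu : u i ≠ u j)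
    (d : Fin n → ℝ) (K : HermMat n) :
    Tendsto (fun s : ℝ => pencilCross u (curvePencil (diagHerm d + s • K)) i j) (𝓝[>] 0)
      (𝓝 (pencilCross u (curvePencil (diagHerm d)) i j)) := by
  have h1 := continuousAt_pencilCross (p := (u, diagHerm d)) hu
  have h2 : Tendsto (fun s : ℝ => ((u, diagHerm d + s • K) : (Fin n → ℝ) × HermMat n)) (𝓝[>] 0)
      (𝓝 (u, diagHerm d)) := tendsto_const_nhds.prodMk_nhds (tendsto_diagHerm_add_smul d K)
  have h3 := Tendsto.comp h1 h2
  simpa only [Function.comp_def] using h3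

theorem exists_scales {u : Fin n → ℝ} (hu : ∀ i j, i ≠ j → u i ≠ u j) {x : Fin n → Fin n → ℝ}
    (hx : ∀ i j, i ≠ j → 0 < |x i j|)
    (hxx : ∀ i j k l, i < j → k < l → (i, j) ≠ (k, l) → 0 < |x i j - x k l|) :
    ∃ R ρ : ℝ, 0 < R ∧ 0 < ρ ∧ (∀ i j, i ≠ j → 200 * ρ < R * |u i - u j|) ∧
      (∀ i j, i ≠ j → R < |x i j|) ∧
      ∀ i j k l, i < j → k < l → (i, j) ≠ (k, l) → 4 * R < |x i j - x k l| := by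
  have hR1 : ∀ᶠ R in 𝓝[>] (0 : ℝ), ∀ i j, i ≠ j → R < |x i j| :=
    eventually_all.mpr fun i => eventually_all.mpr fun j =>
      eventually_imp_distrib_left.mpr fun hij => by
        simpa using eventually_const_mul_lt 1 (hx i j hij)
  have hR2 : ∀ᶠ R in 𝓝[>] (0 : ℝ), ∀ i j k l, i < j → k < l → (i, j) ≠ (k, l) →
      4 * R < |x i j - x k l| :=
    eventually_all.mpr fun i => eventually_all.mpr fun j => eventually_all.mpr fun k =>
      eventually_all.mpr fun l => eventually_imp_distrib_left.mpr fun hij =>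
        eventually_imp_distrib_left.mpr fun hkl => eventually_imp_distrib_left.mpr fun hne =>
          eventually_const_mul_lt 4 (hxx i j k l hij hkl hne)
  obtain ⟨R, ⟨h1, h2⟩, hR⟩ := ((hR1.and hR2).and
    (self_mem_nhdsWithin : Set.Ioi (0 : ℝ) ∈ 𝓝[>] (0 : ℝ))).exists
  have hρ1 : ∀ᶠ ρ in 𝓝[>] (0 : ℝ), ∀ i j, i ≠ j → 200 * ρ < R * |u i - u j| :=
    eventually_all.mpr fun i => eventually_all.mpr fun j =>
      eventually_imp_distrib_left.mpr fun hij => eventually_const_mul_lt 200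
        (mul_pos hR (abs_pos.mpr (sub_ne_zero.mpr (hu i j hij))))
  obtain ⟨ρ, h3, hρ⟩ := (hρ1.and (self_mem_nhdsWithin : Set.Ioi (0 : ℝ) ∈ 𝓝[>] (0 : ℝ))).exists
  exact ⟨R, ρ, hR, hρ, h3, h1, h2⟩

/-- Starting from a diagonal matrix with distinct crossings, a perturbation of size `s` all of
whose entries are of order `s` is nearly diagonal for small `s`, because the products that have to
be dominated by the off-diagonal entries are of order `s²`. -/
theorem eventually_mem_nearDiagonalSet {u : Fin n → ℝ} (hu : StrictMono u) {d : Fin n → ℝ}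
    (hd : Function.Injective d)
    (hcross : ∀ i j k l, i < j → k < l → (i, j) ≠ (k, l) →
      crossing u (diagHerm d) i j ≠ crossing u (diagHerm d) k l)
    (K : HermMat n) (hK : ∀ i j, i ≠ j → K.1 i j ≠ 0) :
    ∀ᶠ s in 𝓝[>] (0 : ℝ), (u, diagHerm d + s • K) ∈ nearDiagonalSet n := by
  have hpi := Real.pi_pos
  have hu' : ∀ i j, i ≠ j → u i ≠ u j := fun i j hij => hu.injective.ne hij
  have hdiag : ∀ i, diagEntry (diagHerm d) i = d i := fun i => by
    simp [diagEntry, diagHerm]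
  have hx0 : ∀ i j, i ≠ j → 0 < |pencilCross u (curvePencil (diagHerm d)) i j| :=
    fun i j hij => by
    rw [abs_pos, pencilCross_curvePencil, crossing, hdiag, hdiag]
    refine div_ne_zero (neg_ne_zero.mpr (sub_ne_zero.mpr (hd.ne hij)))
      (mul_ne_zero (by positivity) (sub_ne_zero.mpr (hu' i j hij)))
  have hxx : ∀ i j k l, i < j → k < l → (i, j) ≠ (k, l) →
      0 < |pencilCross u (curvePencil (diagHerm d)) i j -
        pencilCross u (curvePencil (diagHerm d)) k l| := fun i j k l hij hkl hne => by
    rw [abs_pos, pencilCross_curvePencil, pencilCross_curvePencil]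
    exact sub_ne_zero.mpr (hcross i j k l hij hkl hne)
  obtain ⟨R, ρ, hR, hρ, hρ1, hR1, hR2⟩ := exists_scales hu' hx0 hxx
  have hCev : ∀ᶠ C : ℝ in atTop, ∀ i j, ‖curvePencil K i j‖ < C :=
    eventually_all.mpr fun i => eventually_all.mpr fun j => eventually_gt_atTop _
  obtain ⟨C, hC⟩ := hCev.exists
  have hK0 : ∀ i j, i ≠ j → 0 < ‖curvePencil K i j‖ := fun i j hij => by
    rw [norm_pos_iff, curvePencil, Matrix.smul_apply, smul_eq_mul]
    exact mul_ne_zero (by simp [Real.pi_ne_zero]) (hK i j hij)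
  have e1 : ∀ᶠ s in 𝓝[>] (0 : ℝ), ∀ i j, i ≠ j →
      R < |pencilCross u (curvePencil (diagHerm d + s • K)) i j| :=
    eventually_all.mpr fun i => eventually_all.mpr fun j => eventually_imp_distrib_left.mpr
      fun hij => (tendsto_pencilCross_add_smul (hu' i j hij) d K).abs.eventually_const_lt (hR1 i j hij)
  have e2 : ∀ᶠ s in 𝓝[>] (0 : ℝ), ∀ i j k l, i < j → k < l → (i, j) ≠ (k, l) →
      4 * R < |pencilCross u (curvePencil (diagHerm d + s • K)) i j -
        pencilCross u (curvePencil (diagHerm d + s • K)) k l| :=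
    eventually_all.mpr fun i => eventually_all.mpr fun j => eventually_all.mpr fun k =>
      eventually_all.mpr fun l => eventually_imp_distrib_left.mpr fun hij =>
        eventually_imp_distrib_left.mpr fun hkl => eventually_imp_distrib_left.mpr fun hne =>
        ((tendsto_pencilCross_add_smul (hu' i j hij.ne) d K).sub
          (tendsto_pencilCross_add_smul (hu' k l hkl.ne) d K)).abs.eventually_const_lt
          (hR2 i j k l hij hkl hne)
  have e3 : ∀ᶠ s in 𝓝[>] (0 : ℝ), C * s < detConst n * ρ :=
    eventually_const_mul_lt C (mul_pos (detConst_pos n) hρ)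
  have e4 : ∀ᶠ s in 𝓝[>] (0 : ℝ), 2 * (n * C) * s < ρ := eventually_const_mul_lt _ hρ
  have e5 : ∀ᶠ s in 𝓝[>] (0 : ℝ), ∀ i j, i ≠ j →
      n * C * (n * C / ρ) * s < ‖curvePencil K i j‖ :=
    eventually_all.mpr fun i => eventually_all.mpr fun j => eventually_imp_distrib_left.mpr
      fun hij => eventually_const_mul_lt _ (hK0 i j hij)
  filter_upwards [e1, e2, e3, e4, e5, self_mem_nhdsWithin] with s h1 h2 h3 h4 h5 hs
  have hs : 0 < s := hs
  refine ⟨hu, R, ρ, C * s, curvePencil_isHermitian _, hu', hR, hρ, fun i j hij => ?_, h3,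
    by linarith, fun i j hij => ?_, hρ1, h1, h2⟩
  · rw [norm_curvePencil_add_smul d K hs hij, mul_comm C]
    exact mul_lt_mul_of_pos_left (hC i j) hs
  · rw [norm_curvePencil_add_smul d K hs hij]
    have := mul_lt_mul_of_pos_left (h5 i j hij) hs
    calc _ = s * (n * C * (n * C / ρ) * s) := by ring
      _ < _ := this

end

/-! ### Crossings near the caterpillar line -/

section

variable {n : ℕ}

theorem eventually_nhdsCat_gap (hn : 2 ≤ n) (t K : ℝ) :
    ∀ᶠ u in nhdsCat hn t, StrictMono u ∧ ∀ (j : ℕ) (hj : j + 2 < n),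
      K * (u ⟨j + 1, by omega⟩ - u ⟨j, by omega⟩) ≤ u ⟨j + 2, hj⟩ - u ⟨j + 1, by omega⟩ := by
  have h1 : ∀ᶠ u in nhdsCat hn t, StrictMono u :=
    (inf_le_right : nhdsCat hn t ≤ _) (mem_principal_self _)
  have h2 : ∀ᶠ u in nhdsCat hn t, ∀ j : Fin n, ∀ hj : (j : ℕ) + 2 < n,
      K ≤ (u ⟨j + 2, hj⟩ - u ⟨j + 1, by omega⟩) / (u ⟨j + 1, by omega⟩ - u ⟨j, by omega⟩) := by
    refine eventually_all.mpr fun j => ?_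
    by_cases hj : (j : ℕ) + 2 < n
    · have hle : nhdsCat hn t ≤ comap (fun u : Fin n → ℝ => (u ⟨j + 2, hj⟩ - u ⟨j + 1, by omega⟩) /
          (u ⟨j + 1, by omega⟩ - u ⟨j, by omega⟩)) atTop :=
        inf_le_left.trans (inf_le_right.trans (iInf₂_le (j : ℕ) hj))
      have := (tendsto_comap.mono_left hle).eventually_ge_atTop K
      filter_upwards [this] with u hu _
      exact hu
    · exact Eventually.of_forall fun u hj' => absurd hj' hj
  filter_upwards [h1, h2] with u hu h
  refine ⟨hu, fun j hj => ?_⟩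
  have h3 := h ⟨j, by omega⟩ hj
  have hpos : 0 < u ⟨j + 1, by omega⟩ - u ⟨j, by omega⟩ :=
    sub_pos.mpr (hu (by simp [Fin.lt_def]))
  exact (le_div_iff₀ hpos).mp h3

/-- If the gaps of `u` grow at least by the factor `K + 1`, then every gap is at least `K` times the
sum of the previous ones. -/
theorem gap_ge_sum {u : Fin n → ℝ} (hu : StrictMono u) {K : ℝ}
    (h : ∀ (j : ℕ) (hj : j + 2 < n), (K + 1) * (u ⟨j + 1, by omega⟩ - u ⟨j, by omega⟩) ≤
      u ⟨j + 2, hj⟩ - u ⟨j + 1, by omega⟩) (m : ℕ) (hm : m + 1 < n) :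
    K * (u ⟨m, by omega⟩ - u ⟨0, by omega⟩) ≤ u ⟨m + 1, hm⟩ - u ⟨m, by omega⟩ := by
  induction m with
  | zero =>
    rw [sub_self, mul_zero]
    exact sub_nonneg.mpr (hu.monotone (by simp [Fin.le_def]))
  | succ m ih =>
    have h1 := ih (by omega)
    have h2 := h m hm
    linarith

theorem sub_ge_mul_sub {u : Fin n → ℝ} (hu : StrictMono u) {K : ℝ} (hK : 0 ≤ K)
    (h : ∀ (j : ℕ) (hj : j + 2 < n), (K + 1) * (u ⟨j + 1, by omega⟩ - u ⟨j, by omega⟩) ≤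
      u ⟨j + 2, hj⟩ - u ⟨j + 1, by omega⟩) {i j k l : Fin n} (hjl : j < l) (hkl : k < l) :
    K * (u j - u i) ≤ u l - u k := by
  obtain ⟨m, hm⟩ : ∃ m, (l : ℕ) = m + 1 := ⟨l - 1, by have := Fin.lt_def.mp hjl; omega⟩
  have hl : l = ⟨m + 1, hm ▸ l.2⟩ := Fin.ext hm
  have h1 := gap_ge_sum hu h m (hm ▸ l.2)
  rw [← hl] at h1
  have h2 : u k ≤ u ⟨m, by omega⟩ := hu.monotone (Fin.le_def.mpr (by
    have := Fin.lt_def.mp hkl; simp only; omega))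
  have h3 : u j ≤ u ⟨m, by omega⟩ := hu.monotone (Fin.le_def.mpr (by
    have := Fin.lt_def.mp hjl; simp only; omega))
  have h4 : u ⟨0, by omega⟩ ≤ u i := hu.monotone (Fin.le_def.mpr (Nat.zero_le _))
  have h5 : K * (u j - u i) ≤ K * (u ⟨m, by omega⟩ - u ⟨0, by omega⟩) :=
    mul_le_mul_of_nonneg_left (by linarith) hK
  linarith

theorem eventually_crossing_ne (hn : 2 ≤ n) (t : ℝ) {d : Fin n → ℝ}
    (hd : Function.Injective d) :
    ∀ᶠ u in nhdsCat hn t, StrictMono u ∧ ∀ i j k l, i < j → k < l → (i, j) ≠ (k, l) →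
      crossing u (diagHerm d) i j ≠ crossing u (diagHerm d) k l := by
  obtain ⟨K, hK0, hK⟩ : ∃ K : ℝ, 0 ≤ K ∧ ∀ i j k l, i ≠ j → |d k - d l| < K * |d i - d j| := by
    refine ((eventually_ge_atTop (0 : ℝ)).and (eventually_all.mpr fun i => eventually_all.mpr
      fun j => eventually_all.mpr fun k => eventually_all.mpr fun l =>
      eventually_imp_distrib_left.mpr fun hij => ?_)).exists
    have hpos : 0 < |d i - d j| := abs_pos.mpr (sub_ne_zero.mpr (hd.ne hij))
    filter_upwards [eventually_gt_atTop (|d k - d l| / |d i - d j|)] with K hK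
    exact (div_lt_iff₀ hpos).mp hK
  filter_upwards [eventually_nhdsCat_gap hn t (K + 1)] with u hu
  obtain ⟨hu, hgap⟩ := hu
  refine ⟨hu, ?_⟩
  have key : ∀ i j k l p q r s, i < j → k < l → j < l → p ≠ q →
      |d r - d s| * (u j - u i) < |d p - d q| * (u l - u k) := by
    intro i j k l p q r s hij hkl hjl hpq
    have h1 := sub_ge_mul_sub hu hK0 hgap (i := i) hjl hkl
    have h2 : 0 < u j - u i := sub_pos.mpr (hu hij)
    calc |d r - d s| * (u j - u i) < K * |d p - d q| * (u j - u i) :=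
          mul_lt_mul_of_pos_right (hK p q r s hpq) h2
      _ = |d p - d q| * (K * (u j - u i)) := by ring
      _ ≤ _ := mul_le_mul_of_nonneg_left h1 (abs_nonneg _)
  have hdiag : ∀ i, diagEntry (diagHerm d) i = d i := fun i => by
    simp [diagEntry, diagHerm]
  -- clearing denominators in an equality between two crossings
  have hclear : ∀ i j k l, i < j → k < l →
      crossing u (diagHerm d) i j = crossing u (diagHerm d) k l →
      (d i - d j) * (u l - u k) = (d k - d l) * (u j - u i) := by
    intro i j k l hij hkl he
    have h1 : u i - u j ≠ 0 := sub_ne_zero.mpr (hu hij).ne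
    have h2 : u k - u l ≠ 0 := sub_ne_zero.mpr (hu hkl).ne
    have hpi := Real.pi_ne_zero
    rw [crossing, crossing, hdiag, hdiag, hdiag, hdiag,
      div_eq_div_iff (by positivity) (by positivity)] at he
    have h3 : (2 * Real.pi) * ((d i - d j) * (u l - u k)) =
        (2 * Real.pi) * ((d k - d l) * (u j - u i)) := by linear_combination he
    exact mul_left_cancel₀ (by positivity) h3
  have habs : ∀ i j k l, i < j → k < l → ∀ a b : ℝ, a * (u l - u k) = b * (u j - u i) →
      |a| * (u l - u k) = |b| * (u j - u i) := by
    intro i j k l hij hkl a b he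
    have := congrArg abs he
    rwa [abs_mul, abs_mul, abs_of_pos (sub_pos.mpr (hu hij)), abs_of_pos (sub_pos.mpr (hu hkl))]
      at this
  -- two crossings `(i, j)` and `(k, j)` with the same larger index
  have hsame : ∀ i j k, i < k → k < j →
      crossing u (diagHerm d) i j ≠ crossing u (diagHerm d) k j := by
    intro i j k hik hkj he
    have h1 := hclear i j k j (hik.trans hkj) hkj he
    have h2 : (d i - d k) * (u j - u k) = (d k - d j) * (u k - u i) := by
      linear_combination h1
    exact absurd (habs i k k j hik hkj _ _ h2) (key i k k j i k k j hik hkj hkj hik.ne).ne'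
  intro i j k l hij hkl hne he
  rcases lt_trichotomy j l with hjl | rfl | hlj
  · exact absurd (habs i j k l hij hkl _ _ (hclear i j k l hij hkl he))
      (key i j k l i j k l hij hkl hjl hij.ne).ne'
  · rcases lt_trichotomy i k with hik | rfl | hki
    · exact hsame i j k hik hkl he
    · exact hne rfl
    · exact hsame k j i hki hij he.symm
  · exact absurd (habs k l i j hkl hij _ _ (hclear k l i j hkl hij he.symm))
      (key k l i j k l i j hkl hij hlj hkl.ne).ne'

/-- Geometric progressions of gaps with ratios tending to infinity converge to the caterpillar
point. -/
theorem nhdsCat_neBot (hn : 2 ≤ n) {t : ℝ} (ht : 0 < t) : (nhdsCat hn t).NeBot := by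
  set f : ℝ → Fin n → ℝ := fun x j => t * ∑ m ∈ Finset.range j, x ^ m with hf
  have hgap : ∀ (x : ℝ) (j : ℕ), t * ∑ m ∈ Finset.range (j + 1), x ^ m -
      t * ∑ m ∈ Finset.range j, x ^ m = t * x ^ j := fun x j => by
    rw [Finset.sum_range_succ]; ring
  have hle : Tendsto f atTop (nhdsCat hn t) := by
    refine tendsto_inf.mpr ⟨tendsto_inf.mpr ⟨?_, ?_⟩, ?_⟩
    · rw [tendsto_comap_iff]
      refine tendsto_const_nhds.congr fun x => ?_
      simp [hf]
    · simp only [tendsto_iInf, tendsto_comap_iff]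
      intro j hj
      refine tendsto_id.congr' ?_
      filter_upwards [eventually_gt_atTop 0] with x hx
      simp only [hf, Function.comp, id, hgap]
      field_simp
      ring
    · rw [tendsto_principal]
      filter_upwards [eventually_gt_atTop 0] with x hx
      have hm : StrictMono fun j : ℕ => t * ∑ m ∈ Finset.range j, x ^ m :=
        strictMono_nat_of_lt_succ fun j => by
          have := hgap x j
          have hp : 0 < t * x ^ j := by positivity
          linarith
      exact hm.comp Fin.val_strictMono
  exact hle.neBot

theorem exists_injective_mem_nhds (d : Fin n → ℝ) {S : Set (HermMat n)}
    (hS : S ∈ 𝓝 (diagHerm d)) :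
    ∃ d' : Fin n → ℝ, Function.Injective d' ∧ S ∈ 𝓝 (diagHerm d') := by
  have hcont : Continuous fun s : ℝ => diagHerm fun i : Fin n => d i + s * (i : ℝ) := by
    refine Continuous.subtype_mk (Continuous.matrix_diagonal (continuous_pi fun i => ?_)) _
    fun_prop
  have hT : Tendsto (fun s : ℝ => diagHerm fun i : Fin n => d i + s * (i : ℝ)) (𝓝[>] 0)
      (𝓝 (diagHerm d)) := by
    have := hcont.tendsto 0
    simp only [zero_mul, add_zero] at this
    exact this.mono_left nhdsWithin_le_nhds
  have hinj : ∀ᶠ s in 𝓝[>] (0 : ℝ), ∀ i j : Fin n, i ≠ j →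
      d i + s * (i : ℝ) ≠ d j + s * (j : ℝ) := by
    refine eventually_all.mpr fun i => eventually_all.mpr fun j =>
      eventually_imp_distrib_left.mpr fun hij => ?_
    have hij' : ((i : ℕ) : ℝ) - (j : ℕ) ≠ 0 :=
      sub_ne_zero.mpr (by exact_mod_cast Fin.val_ne_of_ne hij)
    by_cases h0 : d i = d j
    · filter_upwards [self_mem_nhdsWithin] with s hs he
      have hs : 0 < s := hs
      rw [h0] at he
      exact (mul_ne_zero hs.ne' hij') (by linarith)
    · have h1 : Tendsto (fun s : ℝ => d i + s * (i : ℝ) - (d j + s * (j : ℝ))) (𝓝[>] 0)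
          (𝓝 (d i - d j)) := by
        have : Continuous fun s : ℝ => d i + s * (i : ℝ) - (d j + s * (j : ℝ)) := by fun_prop
        have := this.tendsto 0
        simp only [zero_mul, add_zero] at this
        exact this.mono_left nhdsWithin_le_nhds
      filter_upwards [h1.eventually_ne (sub_ne_zero.mpr h0)] with s hs he
      exact hs (sub_eq_zero.mpr he)
  obtain ⟨s, hs1, hs2⟩ := (hinj.and (hT.eventually (eventually_mem_nhds_iff.mpr hS))).exists
  exact ⟨_, fun i j hij => by_contra fun hne => hs1 i j hne hij, hs2⟩

/-- A Hermitian matrix with non-zero off-diagonal entries. -/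
theorem exists_hermMat_offDiag_ne_zero (n : ℕ) : ∃ K : HermMat n, ∀ i j, i ≠ j → K.1 i j ≠ 0 :=
  ⟨⟨Matrix.of fun _ _ => 1, by
    rw [selfAdjoint.mem_iff, Matrix.star_eq_conjTranspose]; ext; simp⟩, fun i j _ => by simp⟩

theorem frequently_mem_nearDiagonalSet (hn : 2 ≤ n) {t : ℝ} (ht : 0 < t) (d : Fin n → ℝ) :
    ∃ᶠ p in nhdsCat hn t ×ˢ 𝓝 (diagHerm d), p ∈ nearDiagonalSet n := by
  rw [frequently_iff]
  intro U hU
  obtain ⟨S, hS, T, hT, hST⟩ := mem_prod_iff.mp hU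
  obtain ⟨d', hd', hT'⟩ := exists_injective_mem_nhds d hT
  obtain ⟨K, hK⟩ := exists_hermMat_offDiag_ne_zero n
  have := nhdsCat_neBot hn ht
  obtain ⟨u, hu, huS⟩ := ((eventually_crossing_ne hn t hd').and hS).exists
  obtain ⟨s, hs1, hs2⟩ :=
    ((eventually_mem_nearDiagonalSet hu.1 hd' hu.2 K hK).and (tendsto_diagHerm_add_smul d' K hT')).exists
  exact ⟨_, hST (Set.mk_mem_prod huS hs2), hs1⟩

end

theorem mainTheorem11 (n : ℕ) (hn : 2 ≤ n) :
    ∃ W : Set ((Fin n → ℝ) × HermMat n),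
      -- `W` is an open subset of (chamber `u_1 < ⋯ < u_n`) × `Herm(n)`
      IsOpen W ∧ (∀ p ∈ W, StrictMono p.1) ∧
      -- its closure contains all `(u_cat(t), D)` with `t > 0` and `D` diagonal
      (∀ t : ℝ, 0 < t → ∀ d : Fin n → ℝ, ∃ᶠ p in nhdsCat hn t ×ˢ 𝓝 (diagHerm d), p ∈ W) ∧
      -- it contains the points near `(u, D)` in every direction with nonzero off-diagonal entries
      (∀ t : ℝ, 0 < t → ∀ d : Fin n → ℝ, StrictMono d → ∀ᶠ u in nhdsCat hn t,
        ∀ H : HermMat n, (∀ i j, i ≠ j → H.1 i j ≠ 0) →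
          ∀ᶠ s in 𝓝[>] (0 : ℝ), (u, diagHerm d + s • H) ∈ W) ∧
      ∀ (u : Fin n → ℝ) (A : HermMat n), (u, A) ∈ W →
        (∀ i j, i ≠ j → A.1 i j ≠ 0) → StrictMono (diagEntry A) →
        ∃ (zp zm : Fin n → Fin n → ℂ) (μ : Fin n → ℂ → ℂ),
          -- the cuts are vertical segments `B_ij = B_ji`, ordered like the points `z_ij`
          (∀ i j, zp i j = zp j i ∧ zm i j = zm j i) ∧
          (∀ i j, i ≠ j → (zp i j).re = (zm i j).re ∧ (zm i j).im < (zp i j).im) ∧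
          (∀ i j k l, i < j → k < l → (i, j) ≠ (k, l) → crossing u A i j ≠ crossing u A k l) ∧
          (∀ i j k l, i < j → k < l →
            ((zp i j).re < (zp k l).re ↔ crossing u A i j < crossing u A k l)) ∧
          -- (1) the sheets
          (∀ i, Tendsto (μ i) (Bornology.cobounded ℂ) (𝓝 (I * (u i : ℂ)))) ∧
          (∀ i, AnalyticOnNhd ℂ (μ i) (sheetDomain zp zm i)) ∧
          (∀ z, (∀ i, z ∈ sheetDomain zp zm i) →
            (specMat u A z).charpoly = ∏ i, (Polynomial.X - Polynomial.C (μ i z))) ∧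
          -- (2) crossing `B_ij`
          (∀ i j, i ≠ j → ExchangedAcross (μ i) (μ j) (zp i j) (zm i j)) ∧
          (∀ i j k, i ≠ j → k ≠ i → k ≠ j → ∀ p ∈ segment ℝ (zp i j) (zm i j),
            AnalyticAt ℂ (μ k) p) ∧
          -- (3) the `n (n - 1)` endpoints
          {b : ℂ | ∃ i j, i ≠ j ∧ (b = zp i j ∨ b = zm i j)}.ncard = n * (n - 1) ∧
          (∀ i j, i ≠ j →
            IsSimpleBranchPoint u A (zp i j) ∧ IsSimpleBranchPoint u A (zm i j)) ∧
          -- (4) smoothness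
          (∀ p ∈ spectralCurve u A, SpectralSmoothAt u A p) ∧
          -- (5) reality
          (∀ i, ∀ z ∈ sheetDomain zp zm i,
            μ i ((starRingEnd ℂ) z) = -(starRingEnd ℂ) (μ i z)) := by
  refine ⟨nearDiagonalSet n, isOpen_nearDiagonalSet, fun p hp => hp.1,
    fun t ht d => frequently_mem_nearDiagonalSet hn ht d, fun t _ d hd => ?_, fun u A hW _ _ => ?_⟩
  · filter_upwards [eventually_crossing_ne hn t hd.injective] with u hu K hK
    exact eventually_mem_nearDiagonalSet hu.1 hd.injective hu.2 K hK
  · obtain ⟨-, R, ρ, ε, H⟩ := hW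
    exact H.exists_sheets
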